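/- Let $k$ be an algebraically closed field of characteristic $0$ and let $\mathcal A$ be a premodular category over $k$, that is, a ribbon fusion category, with braiding $c_{X,Y}:X\otimes Y\to Y\otimes X$, twist $\theta$, simple objects $X_i$ ($i\in\mathrm{Irr}(\mathcal A)$), $d_i=\dim X_i$ and $\mathcal D=\sum_i d_i^2$. Let $\mathcal Z(\mathcal A)$ be its Drinfeld center, with objects $(X,\gamma)$, where $\gamma_B:B\otimes X\to X\otimes B$ is a half-braiding. For $(X,\gamma),(Y,\mu)\in\mathcal Z(\mathcal A)$ and an object $B$ put $$u_B=(\mathrm{id}_X\otimes\mu_B)(c_{B,X}\otimes\mathrm{id}_Y),\qquad l_B=(\mathrm{id}_X\otimes c_{Y,B}^{-1})(\gamma_B\otimes\mathrm{id}_Y):\ B\otimes X\otimes Y\to X\otimes Y\otimes B ,$$ and for $\varphi:B\to P\otimes R$ and $\psi:P\otimes R\to B'$ put $$T(\varphi,\psi)=(\mathrm{id}_{X\otimes Y}\otimes\psi)(l_P\otimes\mathrm{id}_R)(\mathrm{id}_P\otimes u_R)(\varphi\otimes\mathrm{id}_{X\otimes Y}):\ B\otimes X\otimes Y\to X\otimes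 Y\otimes B'.$$ Let $Q_{\gamma,\mu}=\frac1{\mathcal D}\sum_i d_i\,T(\mathrm{coev}_{X_i},\widetilde{\mathrm{ev}}_{X_i})\in\mathrm{End}(X\otimes Y)$, with $\mathrm{coev}_{X_i}:\mathbf 1\to X_i\otimes X_i^*$ and $\widetilde{\mathrm{ev}}_{X_i}:X_i\otimes X_i^*\to\mathbf 1$ the (pivotal) coevaluation and evaluation, and let $$(\gamma\,\overline\otimes\,\mu)_B=\frac1{\mathcal D}\sum_{i,j}d_id_j\sum_\alpha T(\varphi_\alpha,\varphi^\alpha),$$ where $(\varphi_\alpha)$, $(\varphi^\alpha)$ are bases of $\mathrm{Hom}(B,X_j\otimes X_i^*)$ and $\mathrm{Hom}(X_j\otimes X_i^*,B)$ dual under the trace pairing. Then $\mathcal Z(\mathcal A)$ has a monoidal structure $\overline\otimes$, the reduced tensor product, in which $(X,\gamma)\,\overline\otimes\,(Y,\mu)$ is the image of the projection $Q_{\gamma,\mu}$ with the half-braiding induced by $\gamma\,\overline\otimes\,\mu$, and in which the tensor product of morphisms and the associativity constraint are the restrictions of those of $\mathcal A$. For every such structure the following holds. For a half-braiding $\gamma$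 on $X$ let $(^*\gamma)^\vee$ be the half-braiding on $X$ obtained by taking first the usual dual $^*\gamma$ on ${}^*X$, $(^*\gamma)_B={}^*(\gamma_{B^*})$, and then the dual for $\overline\otimes$: for a half-braiding $\sigma$ on $V$, $\sigma^\vee_B=c_{V^*,B}^{-1}\circ\sigma^r_B\circ c_{B,V^*}$ on $V^*$, where $\sigma^r_B:V^*\otimes B\to B\otimes V^*$ is the partial transpose of $\sigma_B$. Then the functor $$U:(\mathcal Z(\mathcal A),\overline\otimes)\to(\mathcal Z(\mathcal A),\overline\otimes^{\mathrm{op}}),\qquad (X,\gamma)\mapsto(X,(^*\gamma)^\vee),$$ which is the identity on morphisms, is a tensor equivalence, with tensor structure $U(Y,\mu)\,\overline\otimes\,U(X,\gamma)\to U((X,\gamma)\,\overline\otimes\,(Y,\mu))$ the restriction of the braiding $c_{Y,X}$. Furthermore $\theta_X^{-1}$ defines a natural isomorphism $U^2\cong\mathrm{id}$, and $U$ together with this isomorphism generates an action of $\mathbb Z/2$ on the category $\mathcal Z(\mathcal A)$. -/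

import Mathlib

open CategoryTheory MonoidalCategory Limits

noncomputable section

namespace Premodular

universe w v u

/-! ### Premodular categories -/

/-- A ribbon structure (twist) on a braided rigid monoidal category: a natural automorphism `θ` of
the identity functor with `θ_{X ⊗ Y} = c_{Y,X} ∘ c_{X,Y} ∘ (θ_X ⊗ θ_Y)` and `θ_{X^*} = (θ_X)^*`.
It is equivalent to a spherical pivotal structure. In Mathlib's notation `Xᘁ` is the dual with
`ε_ : Xᘁ ⊗ X ⟶ 𝟙_` and `η_ : 𝟙_ ⟶ X ⊗ Xᘁ`. -/
class RibbonCategory (A : Type u) [Category.{v} A] [MonoidalCategory A] [BraidedCategory A]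
    [RigidCategory A] where
  /-- The twist `θ_X`. -/
  twist : ∀ X : A, X ≅ X
  twist_naturality : ∀ {X Y : A} (f : X ⟶ Y), f ≫ (twist Y).hom = (twist X).hom ≫ f
  twist_tensor : ∀ X Y : A, (twist (X ⊗ Y)).hom =
    ((twist X).hom ⊗ₘ (twist Y).hom) ≫ (β_ X Y).hom ≫ (β_ Y X).hom
  twist_dual : ∀ X : A, (twist Xᘁ).hom = rightAdjointMate (twist X).hom

/-- The set of isomorphism classes of simple objects. -/
def Irr (A : Type u) [Category.{v} A] [HasZeroMorphisms A] : Type u :=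
  {c : Quotient (isIsomorphicSetoid A) // Simple c.out}

/-- The chosen representative of an isomorphism class of simple objects. -/
def Irr.rep {A : Type u} [Category.{v} A] [HasZeroMorphisms A] (i : Irr A) : A := i.1.out

/-- The finiteness and semisimplicity conditions on a `k`-linear abelian rigid monoidal category
that make it a fusion category. -/
class IsFusion (k : Type w) [Field k] (A : Type u) [Category.{v} A] [Abelian A] [Linear k A]
    [MonoidalCategory A] : Prop where
  simple_unit : Simple (𝟙_ A)
  finite_hom : ∀ X Y : A, Module.Finite k (X ⟶ Y)
  finite_irr : Finite (Irr A)
  semisimple : ∀ X : A, ∃ (n : ℕ) (S : Fin n → A), (∀ i, Simple (S i)) ∧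
    ∃ b : Bicone S, Nonempty b.IsBilimit ∧ Nonempty (X ≅ b.pt)

instance {k : Type w} [Field k] {A : Type u} [Category.{v} A] [Abelian A] [Linear k A]
    [MonoidalCategory A] [h : IsFusion k A] (X Y : A) : Module.Finite k (X ⟶ Y) :=
  h.finite_hom X Y

/-! ### The Drinfeld center -/

/-- The Drinfeld center of `A` as a category. It is Mathlib's `Center A`, under a new name because
it will carry another tensor product than the one Mathlib puts on `Center A`. -/
def ZCenter (A : Type u) [Category.{v} A] [MonoidalCategory A] := Center A

instance (A : Type u) [Category.{v} A] [MonoidalCategory A] : Category (ZCenter A) :=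
  inferInstanceAs (Category (Center A))

section Center

variable {A : Type u} [Category.{v} A] [MonoidalCategory A]

/-- The forgetful functor `(X, γ) ↦ X`. -/
def F (A : Type u) [Category.{v} A] [MonoidalCategory A] : ZCenter A ⥤ A where
  obj X := Sigma.fst X
  map f := Center.Hom.f f

/-- The half-braiding `γ_B : B ⊗ X ≅ X ⊗ B` of an object `(X, γ)` of the center. (Mathlib records
the inverse isomorphisms `X ⊗ B ≅ B ⊗ X`.) -/
def halfBraidingIso (X : ZCenter A) (B : A) : B ⊗ (F A).obj X ≅ (F A).obj X ⊗ B :=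
  ((Sigma.snd X).β B).symm

/-- The half-braiding `γ` of an object `(X, γ)` of the center, as a family of morphisms. -/
def halfBraiding (X : ZCenter A) (B : A) : B ⊗ (F A).obj X ⟶ (F A).obj X ⊗ B :=
  (halfBraidingIso X B).hom

end Center

/-! ### Duals of half-braidings and the functor `U` -/

section Flip

variable {A : Type u} [Category.{v} A] [MonoidalCategory A]

/-- For a family `γ_B : B ⊗ V ⟶ V ⊗ B` and an exact pairing of `V` with `W = V^*`
(`𝟙_ ⟶ V ⊗ W`, `W ⊗ V ⟶ 𝟙_`), the partial transpose `W ⊗ B ⟶ B ⊗ W` of `γ_B`. -/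
def rotate {V : A} (W : A) [ExactPairing V W] (γ : ∀ B : A, B ⊗ V ⟶ V ⊗ B) (B : A) :
    W ⊗ B ⟶ B ⊗ W :=
  (ρ_ (W ⊗ B)).inv ≫ (W ⊗ B) ◁ η_ V W ≫ (α_ W B (V ⊗ W)).hom ≫ W ◁ (α_ B V W).inv ≫
    W ◁ (γ B ▷ W) ≫ W ◁ (α_ V B W).hom ≫ (α_ W V (B ⊗ W)).inv ≫ ε_ V W ▷ (B ⊗ W) ≫
    (λ_ (B ⊗ W)).hom

/-- The dual `γ^∨` of a half-braiding `γ` on `V` for the reduced tensor product, a family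
`B ⊗ W ⟶ W ⊗ B` with `W = V^*`: the strand `B` passes under `V^*`, then through `γ`, and then
over `V^*`. -/
def vee [BraidedCategory A] {V : A} (W : A) [ExactPairing V W] (γ : ∀ B : A, B ⊗ V ⟶ V ⊗ B)
    (B : A) : B ⊗ W ⟶ W ⊗ B :=
  (β_ B W).hom ≫ rotate W γ B ≫ (β_ W B).inv

/-- The partial transpose `X ⊗ B ⟶ B ⊗ X` of `γ_{B^*}` in the variable `B`. -/
def rotateVar [RigidCategory A] {X : A} (γ : ∀ B : A, B ⊗ X ⟶ X ⊗ B) (B : A) :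
    X ⊗ B ⟶ B ⊗ X :=
  (λ_ (X ⊗ B)).inv ≫ η_ B Bᘁ ▷ (X ⊗ B) ≫ (α_ B Bᘁ (X ⊗ B)).hom ≫ B ◁ (α_ Bᘁ X B).inv ≫
    B ◁ (γ Bᘁ ▷ B) ≫ B ◁ (α_ X Bᘁ B).hom ≫ (α_ B X (Bᘁ ⊗ B)).inv ≫ (B ⊗ X) ◁ ε_ B Bᘁ ≫
    (ρ_ (B ⊗ X)).hom

/-- The usual dual `*γ` of a half-braiding `γ` on `X`, the half-braiding
`(*γ)_B = *(γ_{B^*}) : B ⊗ *X ⟶ *X ⊗ B` on `*X = ᘁX` (with `*(B^*) = B`). -/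
def starDual [RigidCategory A] {X : A} (γ : ∀ B : A, B ⊗ X ⟶ X ⊗ B) (B : A) :
    B ⊗ (ᘁX : A) ⟶ (ᘁX : A) ⊗ B :=
  (λ_ (B ⊗ (ᘁX : A))).inv ≫ η_ (ᘁX : A) X ▷ (B ⊗ (ᘁX : A)) ≫
    (α_ (ᘁX : A) X (B ⊗ (ᘁX : A))).hom ≫ (ᘁX : A) ◁ (α_ X B (ᘁX : A)).inv ≫
    (ᘁX : A) ◁ (rotateVar γ B ▷ (ᘁX : A)) ≫ (ᘁX : A) ◁ (α_ B X (ᘁX : A)).hom ≫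
    (α_ (ᘁX : A) B (X ⊗ (ᘁX : A))).inv ≫ ((ᘁX : A) ⊗ B) ◁ ε_ (ᘁX : A) X ≫
    (ρ_ ((ᘁX : A) ⊗ B)).hom

theorem hb_unit {X : A} (b : HalfBraiding X) : (b.β (𝟙_ A)).hom = (ρ_ X).hom ≫ (λ_ X).inv :=
  by
  have h := congrArg Center.Hom.f (braiding_tensorUnit_right (C := Center A) ⟨X, b⟩)
  exact h.trans (congrArg ((ρ_ X).hom ≫ ·) (Center.leftUnitor_inv_f ⟨X, b⟩))

theorem hb_inv_tensor {X : A} (b : HalfBraiding X) (U V : A) : (b.β (U ⊗ V)).inv =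
    (α_ U V X).hom ≫ U ◁ (b.β V).inv ≫ (α_ U X V).inv ≫ (b.β U).inv ▷ V ≫ (α_ X U V).hom := by
  rw [← cancel_epi (b.β (U ⊗ V)).hom, Iso.hom_inv_id, b.monoidal]
  simp

theorem hb_inv_naturality {X : A} (b : HalfBraiding X) {U V : A} (f : U ⟶ V) :
    f ▷ X ≫ (b.β V).inv = (b.β U).inv ≫ X ◁ f := by
  rw [Iso.comp_inv_eq, Category.assoc, b.naturality, Iso.inv_hom_id_assoc]

theorem hb_coev [RigidCategory A] {X : A} (b : HalfBraiding X) (B : A) :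
  η_ B Bᘁ ▷ X ≫ (α_ _ _ _).hom ≫ B ◁ (b.β Bᘁ).inv = 
   (λ_ X).hom ≫ (ρ_ X).inv ≫ X ◁ η_ B Bᘁ ≫ (α_ _ _ _).inv ≫ (b.β B).hom ▷ Bᘁ ≫ (α_ _ _ _).hom := by
  have h := b.naturality (η_ B Bᘁ)
  rw [hb_unit, b.monoidal] at h
  have h' := (λ_ X).hom ≫= (ρ_ X).inv ≫= ((h =≫ (α_ B Bᘁ X).hom) =≫ B ◁ (b.β Bᘁ).inv)
  simp only [Category.assoc, Iso.inv_hom_id_assoc, Iso.hom_inv_id_assoc, Iso.inv_hom_id, Category.comp_id, ← MonoidalCategory.whiskerLeft_comp, Iso.hom_inv_id, MonoidalCategory.whiskerLeft_id] at h'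
  exact h'.symm

theorem hb_rotateVar [RigidCategory A] {X : A} (b : HalfBraiding X) (B : A) :
  (λ_ (X ⊗ B)).inv ≫ η_ B Bᘁ ▷ (X ⊗ B) ≫ (α_ B Bᘁ (X ⊗ B)).hom ≫ B ◁ (α_ Bᘁ X B).inv ≫
    B ◁ ((b.β Bᘁ).inv ▷ B) ≫ B ◁ (α_ X Bᘁ B).hom ≫ (α_ B X (Bᘁ ⊗ B)).inv ≫ (B ⊗ X) ◁ ε_ B Bᘁ ≫
    (ρ_ (B ⊗ X)).hom = (b.β B).hom := by
  calc _ = 𝟙 _ ⊗≫ (η_ B Bᘁ ▷ X ≫ (α_ _ _ _).hom ≫ B ◁ (b.β Bᘁ).inv) ▷ B ⊗≫ (B ⊗ X) ◁ ε_ B Bᘁ ⊗≫ 𝟙 _ := by monoidal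
    _ = 𝟙 _ ⊗≫ X ◁ η_ B Bᘁ ▷ B ⊗≫ ((b.β B).hom ▷ (Bᘁ ⊗ B) ≫ (B ⊗ X) ◁ ε_ B Bᘁ) ⊗≫ 𝟙 _ := by
      rw [hb_coev]; monoidal
    _ = 𝟙 _ ⊗≫ X ◁ (η_ B Bᘁ ▷ B ⊗≫ B ◁ ε_ B Bᘁ) ⊗≫ (b.β B).hom ⊗≫ 𝟙 _ := by
      rw [← whisker_exchange]; monoidal
    _ = _ := by rw [ExactPairing.evaluation_coevaluation'']; monoidal

theorem rotate_mate {V W : A} [ExactPairing V W] {B : A} (f : W ⊗ B ⟶ B ⊗ W) :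
  (ρ_ (W ⊗ B)).inv ≫ (W ⊗ B) ◁ η_ V W ≫ (α_ W B (V ⊗ W)).hom ≫ W ◁ (α_ B V W).inv ≫
    W ◁ (((λ_ (B ⊗ V)).inv ≫ η_ V W ▷ (B ⊗ V) ≫
    (α_ V W (B ⊗ V)).hom ≫ V ◁ (α_ W B V).inv ≫
    V ◁ (f ▷ V) ≫ V ◁ (α_ B W V).hom ≫
    (α_ V B (W ⊗ V)).inv ≫ (V ⊗ B) ◁ ε_ V W ≫
    (ρ_ (V ⊗ B)).hom) ▷ W) ≫ W ◁ (α_ V B W).hom ≫ (α_ W V (B ⊗ W)).inv ≫ ε_ V W ▷ (B ⊗ W) ≫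
    (λ_ (B ⊗ W)).hom = f := by
  calc _ = 𝟙 _ ⊗≫ (W ⊗ B) ◁ η_ V W ⊗≫ W ◁ η_ V W ▷ (B ⊗ V ⊗ W) ⊗≫
        ((W ⊗ V) ◁ (f ▷ (V ⊗ W) ≫ (α_ _ _ _).hom ≫ B ◁ (α_ _ _ _).inv ≫ B ◁ ε_ V W ▷ W) ≫
          ε_ V W ▷ (B ⊗ (𝟙_ A) ⊗ W)) ⊗≫ 𝟙 _ := by monoidal
    _ = 𝟙 _ ⊗≫ (W ⊗ B) ◁ η_ V W ⊗≫ (W ◁ η_ V W ⊗≫ ε_ V W ▷ W) ▷ (B ⊗ V ⊗ W) ⊗≫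
        (f ▷ (V ⊗ W) ≫ (α_ _ _ _).hom ≫ B ◁ (α_ _ _ _).inv ≫ B ◁ ε_ V W ▷ W) ⊗≫ 𝟙 _ := by
      rw [whisker_exchange]
      simp only [MonoidalCategory.whiskerLeft_comp]
      monoidal
    _ = 𝟙 _ ⊗≫ ((W ⊗ B) ◁ η_ V W ≫ f ▷ (V ⊗ W)) ⊗≫ B ◁ ε_ V W ▷ W ⊗≫ 𝟙 _ := by
      rw [ExactPairing.coevaluation_evaluation'']; monoidal
    _ = 𝟙 _ ⊗≫ f ⊗≫ B ◁ (W ◁ η_ V W ⊗≫ ε_ V W ▷ W) ⊗≫ 𝟙 _ := by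
      rw [whisker_exchange]; monoidal
    _ = f := by rw [ExactPairing.coevaluation_evaluation'']; monoidal

theorem hb_L1 [BraidedCategory A] {X : A} (b : HalfBraiding X) (U V : A) :
    U ◁ ((β_ X V).hom ≫ (b.β V).inv) ≫ (α_ U X V).inv ≫ (b.β U).inv ▷ V ≫ (α_ X U V).hom ≫
      X ◁ (β_ U V).hom =
    (α_ U X V).inv ≫ (b.β U).inv ▷ V ≫ (α_ X U V).hom ≫ X ◁ (β_ U V).hom ≫ (α_ X V U).inv ≫
      ((β_ X V).hom ≫ (b.β V).inv) ▷ U ≫ (α_ X V U).hom := by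
  have h1 : (b.β U).inv ▷ V ≫ (α_ X U V).hom ≫ X ◁ (β_ U V).hom ≫ (α_ X V U).inv ≫
      (β_ X V).hom ▷ U = (β_ (U ⊗ X) V).hom ≫ V ◁ (b.β U).inv ≫ (α_ V X U).inv := by
    rw [← BraidedCategory.braiding_naturality_left_assoc,
      BraidedCategory.braiding_tensor_left_hom]
    simp
  have h2 : (α_ U V X).hom ≫ U ◁ (b.β V).inv ≫ (α_ U X V).inv ≫ (b.β U).inv ▷ V ≫ (α_ X U V).hom ≫
      X ◁ (β_ U V).hom = (β_ U V).hom ▷ X ≫ (b.β (V ⊗ U)).inv := by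
    rw [hb_inv_naturality, hb_inv_tensor]; simp
  rw [comp_whiskerRight]
  simp only [Category.assoc]
  rw [reassoc_of% h1, ← cancel_epi (α_ U X V).hom]
  simp only [MonoidalCategory.whiskerLeft_comp, Category.assoc, Iso.hom_inv_id_assoc]
  rw [← Iso.eq_inv_comp] at h2
  rw [h2, hb_inv_tensor, BraidedCategory.braiding_tensor_left_hom]
  simp

theorem hb_comm [BraidedCategory A] {X : A} (b : HalfBraiding X) (U V : A) :
    U ◁ ((β_ X V).hom ≫ (b.β V).inv) ≫ (α_ U X V).inv ≫ ((b.β U).inv ≫ (β_ U X).inv) ▷ V =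
    (α_ U X V).inv ≫ ((b.β U).inv ≫ (β_ U X).inv) ▷ V ≫ (α_ U X V).hom ≫
      U ◁ ((β_ X V).hom ≫ (b.β V).inv) ≫ (α_ U X V).inv := by
  have h1 := hb_L1 b U V
  generalize (β_ X V).hom ≫ (b.β V).inv = k at *
  have h2 := BraidedCategory.braiding_naturality_right U k
  rw [BraidedCategory.braiding_tensor_right_hom] at h2
  have h3 : X ◁ (β_ U V).hom ≫ (α_ X V U).inv ≫ k ▷ U ≫ (α_ X V U).hom =
      (α_ X U V).inv ≫ (β_ U X).inv ▷ V ≫ (α_ U X V).hom ≫ U ◁ k ≫ (α_ U X V).inv ≫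
        (β_ U X).hom ▷ V ≫ (α_ X U V).hom ≫ X ◁ (β_ U V).hom := by
    have := h2 =≫ (α_ X V U).hom
    simp only [Category.assoc, Iso.inv_hom_id, Category.comp_id] at this
    rw [this]; simp
  rw [h3] at h1
  simp only [← Category.assoc] at h1
  rw [cancel_mono, cancel_mono] at h1
  simp only [Category.assoc] at h1
  have := h1 =≫ (β_ U X).inv ▷ V
  simpa using this

theorem hb_flip [BraidedCategory A] {X : A} (b : HalfBraiding X) (U V : A) :
   ((β_ X (U ⊗ V)) ≪≫ (b.β (U ⊗ V)).symm ≪≫ (β_ (U ⊗ V) X).symm).hom =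
      (α_ _ _ _).inv ≫
        (((β_ X U) ≪≫ (b.β U).symm ≪≫ (β_ U X).symm).hom ▷ V) ≫ (α_ _ _ _).hom ≫
          (U ◁ ((β_ X V) ≪≫ (b.β V).symm ≪≫ (β_ V X).symm).hom) ≫ (α_ _ _ _).inv := by
  have := hb_comm b U V
  simp only [Iso.trans_hom, Iso.symm_hom, hb_inv_tensor, BraidedCategory.braiding_tensor_right_hom,
    BraidedCategory.braiding_tensor_left_inv]
  simp only [comp_whiskerRight, MonoidalCategory.whiskerLeft_comp, Category.assoc] at this ⊢
  simp only [Iso.inv_hom_id_assoc, Iso.hom_inv_id_assoc]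
  rw [reassoc_of% this]
  simp

theorem rotateVar_halfBraiding [RigidCategory A] (X : ZCenter A) (B : A) :
    rotateVar (halfBraiding X) B = (halfBraidingIso X B).inv :=
  hb_rotateVar (Sigma.snd X) B

/-- Explicitly, `(*γ)^∨_B = c_{X,B}⁻¹ ∘ γ_B⁻¹ ∘ c_{B,X}`. -/
theorem vee_starDual [BraidedCategory A] [RigidCategory A] (X : ZCenter A) (B : A) :
    vee ((F A).obj X) (starDual (halfBraiding X)) B =
      (β_ B ((F A).obj X)).hom ≫ (halfBraidingIso X B).inv ≫ (β_ ((F A).obj X) B).inv := by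
  have h : rotate ((F A).obj X) (starDual (halfBraiding X)) B = rotateVar (halfBraiding X) B :=
    rotate_mate (rotateVar (halfBraiding X) B)
  rw [vee, h, rotateVar_halfBraiding]

/-- The half-braiding `(*γ)^∨` on `X`, for `(X, γ)` in the center. (The identification of `(*X)^*`
with `X` is through the given exact pairing of `ᘁX` with `X`.) -/
def flipHalfBraiding [BraidedCategory A] [RigidCategory A] (X : ZCenter A) :
    HalfBraiding ((F A).obj X) where
  β B :=
    { hom := (β_ ((F A).obj X) B).hom ≫ halfBraiding X B ≫ (β_ B ((F A).obj X)).inv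
      inv := vee ((F A).obj X) (starDual (halfBraiding X)) B
      hom_inv_id := by rw [vee_starDual]; simp [halfBraiding]
      inv_hom_id := by rw [vee_starDual]; simp [halfBraiding] }
  monoidal V W := hb_flip (Sigma.snd X) V W
  naturality {V W} f := by
    have h : f ▷ (F A).obj X ≫ halfBraiding X W = halfBraiding X V ≫ (F A).obj X ◁ f :=
      hb_inv_naturality (Sigma.snd X) f
    simp only [Category.assoc]
    rw [BraidedCategory.braiding_naturality_right_assoc, reassoc_of% h,
      ← BraidedCategory.braiding_inv_naturality_right]

/-- The functor `U : (X, γ) ↦ (X, (*γ)^∨)` on the center; it is the identity on morphisms. -/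
def U (A : Type u) [Category.{v} A] [MonoidalCategory A] [BraidedCategory A] [RigidCategory A] :
    ZCenter A ⥤ ZCenter A where
  obj X := ⟨(F A).obj X, flipHalfBraiding X⟩
  map {X Y} f :=
    { f := (F A).map f
      comm := fun B => by
        have h : B ◁ (F A).map f ≫ halfBraiding Y B = halfBraiding X B ≫ (F A).map f ▷ B := by
          have := Center.Hom.comm f B
          change B ◁ Center.Hom.f f ≫ ((Sigma.snd Y).β B).inv =
            ((Sigma.snd X).β B).inv ≫ Center.Hom.f f ▷ B
          rw [Iso.comp_inv_eq, Category.assoc, this, Iso.inv_hom_id_assoc]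
        change (F A).map f ▷ B ≫ (β_ ((F A).obj Y) B).hom ≫ halfBraiding Y B ≫
            (β_ B ((F A).obj Y)).inv =
          ((β_ ((F A).obj X) B).hom ≫ halfBraiding X B ≫ (β_ B ((F A).obj X)).inv) ≫
            B ◁ (F A).map f
        rw [BraidedCategory.braiding_naturality_left_assoc, reassoc_of% h]
        simp [BraidedCategory.braiding_inv_naturality_left] }
  map_id _ := rfl
  map_comp _ _ := rfl

end Flip

/-! ### Traces, dimensions and dual bases -/

section Trace

/-- The evaluation `X ⊗ X^* ⟶ 𝟙_` coming from the twist (equivalently, from the pivotal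
structure). -/
def evRight {A : Type u} [Category.{v} A] [MonoidalCategory A] [BraidedCategory A]
    [RigidCategory A] [RibbonCategory A] (X : A) : X ⊗ Xᘁ ⟶ 𝟙_ A :=
  (RibbonCategory.twist X).hom ▷ Xᘁ ≫ (β_ X Xᘁ).hom ≫ ε_ X Xᘁ

variable (k : Type w) [Field k] {A : Type u} [Category.{v} A] [Abelian A]
  [Linear k A] [MonoidalCategory A] [IsFusion k A]

/-- The finite set of all isomorphism classes of simple objects. -/
def irrFinset (A : Type u) [Category.{v} A] [Abelian A] [Linear k A] [MonoidalCategory A]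
    [IsFusion k A] : Finset (Irr A) :=
  haveI : Finite (Irr A) := IsFusion.finite_irr k
  (Set.finite_univ : (Set.univ : Set (Irr A)).Finite).toFinset

theorem exists_scalar [IsAlgClosed k] (f : 𝟙_ A ⟶ 𝟙_ A) : ∃ r : k, r • 𝟙 (𝟙_ A) = f :=
  haveI : Simple (𝟙_ A) := IsFusion.simple_unit k
  endomorphism_simple_eq_smul_id k f

/-- The scalar `r` with `f = r • 𝟙`, for an endomorphism `f` of the unit object. -/
def scalar [IsAlgClosed k] (f : 𝟙_ A ⟶ 𝟙_ A) : k := (exists_scalar k f).choose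

variable [IsAlgClosed k] [BraidedCategory A] [RigidCategory A] [RibbonCategory A]

/-- The categorical trace of an endomorphism. -/
def trace {X : A} (f : X ⟶ X) : k := scalar k (η_ X Xᘁ ≫ f ▷ Xᘁ ≫ evRight X)

/-- The categorical dimension `d_i` of a simple object. -/
def Irr.dim (i : Irr A) : k := trace k (𝟙 i.rep)

/-- The dimension `𝒟 = ∑ d_i ^ 2` of the category. -/
def globalDim (A : Type u) [Category.{v} A] [Abelian A] [Linear k A] [MonoidalCategory A]
    [IsFusion k A] [BraidedCategory A] [RigidCategory A] [RibbonCategory A] : k :=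
  ∑ i ∈ irrFinset k A, i.dim k ^ 2

/-- A basis of `Hom(B, W)`. -/
def homBasis (B W : A) := Module.finBasis k (B ⟶ W)

/-- The dual basis of `Hom(W, B)` under the (nondegenerate) pairing `(φ, ψ) ↦ trace (ψ ∘ φ)`. -/
def homDualBasis (B W : A) (a : Fin (Module.finrank k (B ⟶ W))) : W ⟶ B :=
  Classical.epsilon fun ψ => ∀ b, trace k (homBasis k B W b ≫ ψ) = if b = a then 1 else 0

end Trace

/-! ### The reduced tensor product -/

section Reduced

variable {A : Type u} [Category.{v} A] [MonoidalCategory A] [BraidedCategory A]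

/-- The half-braiding `c ⊗ μ` on `X ⊗ Y`: the strand `B` passes under `X`, then through `μ`. -/
def upper (X Y : ZCenter A) (B : A) :
    B ⊗ ((F A).obj X ⊗ (F A).obj Y) ⟶ ((F A).obj X ⊗ (F A).obj Y) ⊗ B :=
  (α_ B ((F A).obj X) ((F A).obj Y)).inv ≫ (β_ B ((F A).obj X)).hom ▷ (F A).obj Y ≫
    (α_ ((F A).obj X) B ((F A).obj Y)).hom ≫ (F A).obj X ◁ halfBraiding Y B ≫
    (α_ ((F A).obj X) ((F A).obj Y) B).inv

/-- The half-braiding `γ ⊗ c⁻¹` on `X ⊗ Y`: the strand `B` passes through `γ`, then over `Y`. -/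
def lower (X Y : ZCenter A) (B : A) :
    B ⊗ ((F A).obj X ⊗ (F A).obj Y) ⟶ ((F A).obj X ⊗ (F A).obj Y) ⊗ B :=
  (α_ B ((F A).obj X) ((F A).obj Y)).inv ≫ halfBraiding X B ▷ (F A).obj Y ≫
    (α_ ((F A).obj X) B ((F A).obj Y)).hom ≫ (F A).obj X ◁ (β_ ((F A).obj Y) B).inv ≫
    (α_ ((F A).obj X) ((F A).obj Y) B).inv

/-- For `φ : B ⟶ P ⊗ R` and `ψ : P ⊗ R ⟶ B'`, the morphism in which `B` is split by `φ` to the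
left of `X ⊗ Y`, the strand `R` crosses `X ⊗ Y` by `upper`, the strand `P` crosses below it by
`lower`, and the two are joined by `ψ` on the right. -/
def tube (X Y : ZCenter A) {B B' P R : A} (φ : B ⟶ P ⊗ R) (ψ : P ⊗ R ⟶ B') :
    B ⊗ ((F A).obj X ⊗ (F A).obj Y) ⟶ ((F A).obj X ⊗ (F A).obj Y) ⊗ B' :=
  φ ▷ ((F A).obj X ⊗ (F A).obj Y) ≫ (α_ P R ((F A).obj X ⊗ (F A).obj Y)).hom ≫
    P ◁ upper X Y R ≫ (α_ P ((F A).obj X ⊗ (F A).obj Y) R).inv ≫ lower X Y P ▷ R ≫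
    (α_ ((F A).obj X ⊗ (F A).obj Y) P R).hom ≫ ((F A).obj X ⊗ (F A).obj Y) ◁ ψ

variable [RigidCategory A] [RibbonCategory A]

/-- A closed loop colored by `B` around `X ⊗ Y`, whose upper arc is `upper` and whose lower arc is
`lower`. -/
def loop (X Y : ZCenter A) (B : A) :
    (F A).obj X ⊗ (F A).obj Y ⟶ (F A).obj X ⊗ (F A).obj Y :=
  (λ_ ((F A).obj X ⊗ (F A).obj Y)).inv ≫ tube X Y (η_ B Bᘁ) (evRight B) ≫
    (ρ_ ((F A).obj X ⊗ (F A).obj Y)).hom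

end Reduced

section Reduced'

variable (k : Type w) [Field k] [IsAlgClosed k] {A : Type u} [Category.{v} A] [Abelian A]
  [Linear k A] [MonoidalCategory A] [BraidedCategory A] [RigidCategory A] [RibbonCategory A]
  [IsFusion k A]

/-- The projection `Q_{γ,μ}` of `X ⊗ Y`. -/
def Q (X Y : ZCenter A) : (F A).obj X ⊗ (F A).obj Y ⟶ (F A).obj X ⊗ (F A).obj Y :=
  (globalDim k A)⁻¹ • ∑ i ∈ irrFinset k A, i.dim k • loop X Y i.rep

/-- The natural transformation `(γ ⊗̄ μ)_B : B ⊗ (X ⊗ Y) ⟶ (X ⊗ Y) ⊗ B`: the strand `B` is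
absorbed on the left by a loop in the regular color around `X ⊗ Y` and leaves it on the right. -/
def reducedHalfBraiding (X Y : ZCenter A) (B : A) :
    B ⊗ ((F A).obj X ⊗ (F A).obj Y) ⟶ ((F A).obj X ⊗ (F A).obj Y) ⊗ B :=
  (globalDim k A)⁻¹ • ∑ i ∈ irrFinset k A, ∑ j ∈ irrFinset k A, (i.dim k * j.dim k) •
    ∑ a, tube X Y (homBasis k B (j.rep ⊗ i.repᘁ) a) (homDualBasis k B (j.rep ⊗ i.repᘁ) a)

variable (A) in
/-- A given monoidal structure on the center is a *reduced tensor product*: the object underlying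
`(X, γ) ⊗ (Y, μ)` is an image of the projection `Q_{γ,μ}` of `X ⊗ Y`, with the half-braiding
induced by `γ ⊗̄ μ`; on morphisms it is the restriction of the tensor product of `A`; and the
associativity constraint is the restriction of that of `A`. Such a structure is determined up to
unique isomorphism, since images and units are. -/
structure ReducedTensorProduct [MonoidalCategory (ZCenter A)] where
  /-- The inclusion of the image of `Q_{γ,μ}`. -/
  incl : ∀ X Y : ZCenter A, (F A).obj (X ⊗ Y) ⟶ (F A).obj X ⊗ (F A).obj Y
  /-- The projection to the image of `Q_{γ,μ}`. -/
  proj : ∀ X Y : ZCenter A, (F A).obj X ⊗ (F A).obj Y ⟶ (F A).obj (X ⊗ Y)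
  incl_proj : ∀ X Y, incl X Y ≫ proj X Y = 𝟙 _
  proj_incl : ∀ X Y, proj X Y ≫ incl X Y = Q k X Y
  halfBraiding_eq : ∀ X Y B, halfBraiding (X ⊗ Y) B =
    B ◁ incl X Y ≫ reducedHalfBraiding k X Y B ≫ proj X Y ▷ B
  tensorHom_eq : ∀ {X X' Y Y' : ZCenter A} (f : X ⟶ X') (g : Y ⟶ Y'),
    (F A).map (f ⊗ₘ g) = incl X Y ≫ ((F A).map f ⊗ₘ (F A).map g) ≫ proj X' Y'
  associator_eq : ∀ X Y Z : ZCenter A, (F A).map (α_ X Y Z).hom =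
    incl (X ⊗ Y) Z ≫ incl X Y ▷ (F A).obj Z ≫ (α_ ((F A).obj X) ((F A).obj Y) ((F A).obj Z)).hom ≫
      (F A).obj X ◁ proj Y Z ≫ proj X (Y ⊗ Z)

end Reduced'

/-! ### `U` as a functor to the opposite tensor category, and actions of `ℤ/2` -/

/-- `U` as a functor to the center with the opposite tensor product. -/
abbrev UOp (A : Type u) [Category.{v} A] [MonoidalCategory A] [BraidedCategory A]
    [RigidCategory A] : ZCenter A ⥤ (ZCenter A)ᴹᵒᵖ :=
  U A ⋙ mopFunctor (ZCenter A)

attribute [local instance] endofunctorMonoidalCategory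

open Functor.LaxMonoidal Functor.OplaxMonoidal in
/-- An action of `ℤ/2` on the category `C` (a monoidal functor from the discrete monoidal category
`ℤ/2` to the endofunctors of `C`) in which the generator acts by `T` and the isomorphism from
`T ∘ T` to the identity given by the action is `a`. -/
structure ZMod2Action {C : Type*} [Category* C] (T : C ⥤ C) (a : T ⋙ T ≅ 𝟭 C) where
  /-- The action, as a functor. -/
  action : Discrete (Multiplicative (ZMod 2)) ⥤ (C ⥤ C)
  /-- The monoidal structure of the action. -/
  monoidal : action.Monoidal
  /-- The generator acts by `T`. -/
  gen : action.obj ⟨Multiplicative.ofAdd 1⟩ ≅ T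
  square : (gen.hom ⊗ₘ gen.hom) ≫ a.hom =
    μ action ⟨Multiplicative.ofAdd 1⟩ ⟨Multiplicative.ofAdd 1⟩ ≫
      action.map (Discrete.eqToHom (by decide)) ≫ η action

end Premodular

end

/-! Call a crossing of `V` a family `B ⊗ V ⟶ V ⊗ B` that is natural, unital and multiplicative in
`B`. On `X ⊗ Y` there are two, `upper` (`c ⊗ μ`) and `lower` (`γ ⊗ c⁻¹`), and strands of the first
can be pulled over strands of the second. Everything rests on one fact about such a pair `x`, `y` on
any `V`: the averaged loop `average`, of which `Q` is a case, is the projection to the part of `V`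
on which `x` and `y` agree.

Indeed, fusing a strand with the loop shows that `x B` followed by the loop and the loop followed by
`y B` are the same morphism `averageCrossing`, while `x B` can also be pulled over the loop; so `x`
and `y` agree on the image (`IsCrossingPair.equalizes_average`). Conversely, where `x` and `y`
agree, both arcs of the loop cross by one half-braiding, the loop contracts, and what remains is
`𝒟⁻¹ ∑ d_i ^ 2 = 1` (`Equalizes.comp_average`). This needs `𝒟 ≠ 0`, the nondegeneracy of the trace
pairing and the sphericality of the trace. Questions about the reduced tensor product thus become
questions about which morphisms equalize which crossings.

Both bracketings of a triple product are the part of `X ⊗ Y ⊗ Z` on which three crossings agree,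
which gives the associator; the pentagon is inherited from `A`. The left unit is the end of `C ↦ ᘁC
⊗ C` with its canonical half-braiding: a map to its product with `Y` that equalizes the two
crossings is determined by its composite with the counit. A right unit comes from the left one by
applying `U`, and a unit in this weak sense already yields coherent unit constraints.

The half-braiding of `U X` is `flip γ = c⁻¹ γ⁻¹ c`. Flipping exchanges over- and undercrossings, and
the braiding turns a product of flips into the flip of the product in the other order. So the
braiding carries `upper` and `lower` of `U Y`, `U X` to the flips of `lower` and `upper` of `X`,
`Y`, and the parts where they agree correspond. Compatibility with the associators is an identity of
hexagons, and the unit comparison is automatic because `U` is an equivalence. Finally, naturality of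
the twist at `γ_B` says that `θ` intertwines `γ` with `flip (flip γ)`. As `U` does not change
morphisms, it sends `θ⁻¹` at `X` to `θ⁻¹` at `U X`, the only coherence that a `ℤ/2`-action requires.
-/

open CategoryTheory MonoidalCategory Limits

noncomputable section

namespace Premodular

universe w v u

set_option linter.unusedSectionVars false

/-! ### Half-braidings as families of crossings, and strands passing over strands -/

section Crossings

variable {A : Type u} [Category.{v} A] [MonoidalCategory A]

/-- The strands `R` and `P` cross `V` one after the other, first `P` and then `R`. -/
def stack {V R P : A} (x : R ⊗ V ⟶ V ⊗ R) (y : P ⊗ V ⟶ V ⊗ P) :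
    (R ⊗ P) ⊗ V ⟶ V ⊗ (R ⊗ P) :=
  (α_ R P V).hom ≫ R ◁ y ≫ (α_ R V P).inv ≫ x ▷ P ≫ (α_ V R P).hom

/-- The defining properties of a half-braiding, for a family of morphisms. -/
structure IsCrossing {V : A} (x : ∀ B : A, B ⊗ V ⟶ V ⊗ B) : Prop where
  unit : x (𝟙_ A) = (λ_ V).hom ≫ (ρ_ V).inv
  tensor : ∀ B C : A, x (B ⊗ C) = stack (x B) (x C)
  naturality : ∀ {B C : A} (f : B ⟶ C), f ▷ V ≫ x C = x B ≫ V ◁ f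

/-- The tensor product of two families of crossings. -/
def tens {V W : A} (x : ∀ B : A, B ⊗ V ⟶ V ⊗ B) (y : ∀ B : A, B ⊗ W ⟶ W ⊗ B) (B : A) :
    B ⊗ (V ⊗ W) ⟶ (V ⊗ W) ⊗ B :=
  (α_ B V W).inv ≫ x B ▷ W ≫ (α_ V B W).hom ≫ V ◁ y B ≫ (α_ V W B).inv

theorem stack_naturality {V R P R' P' : A} {x : R ⊗ V ⟶ V ⊗ R} {y : P ⊗ V ⟶ V ⊗ P}
    {x' : R' ⊗ V ⟶ V ⊗ R'} {y' : P' ⊗ V ⟶ V ⊗ P'} {f : R ⟶ R'} {g : P ⟶ P'}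
    (hf : f ▷ V ≫ x' = x ≫ V ◁ f) (hg : g ▷ V ≫ y' = y ≫ V ◁ g) :
    (f ⊗ₘ g) ▷ V ≫ stack x' y' = stack x y ≫ V ◁ (f ⊗ₘ g) := by
  unfold stack
  calc
    _ = 𝟙 _ ⊗≫ f ▷ (P ⊗ V) ⊗≫ R' ◁ (g ▷ V ≫ y') ⊗≫ x' ▷ P' ⊗≫ 𝟙 _ := by
      rw [MonoidalCategory.tensorHom_def]; monoidal
    _ = 𝟙 _ ⊗≫ (f ▷ (P ⊗ V) ≫ R' ◁ y) ⊗≫ ((R' ⊗ V) ◁ g ≫ x' ▷ P') ⊗≫ 𝟙 _ := by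
      rw [hg]; monoidal
    _ = 𝟙 _ ⊗≫ R ◁ y ⊗≫ (f ▷ V ≫ x') ▷ P ⊗≫ V ◁ R' ◁ g ⊗≫ 𝟙 _ := by
      rw [← whisker_exchange f y, whisker_exchange x' g]; monoidal
    _ = _ := by rw [hf, MonoidalCategory.tensorHom_def]; monoidal

variable {V W : A} {x : ∀ B : A, B ⊗ V ⟶ V ⊗ B} {y : ∀ B : A, B ⊗ W ⟶ W ⊗ B}

theorem IsCrossing.tens (hx : IsCrossing x) (hy : IsCrossing y) :
    IsCrossing (Premodular.tens x y) where
  unit := by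
    simp only [Premodular.tens, hx.unit, hy.unit]
    monoidal
  tensor B C := by
    simp only [Premodular.tens, hx.tensor, hy.tensor, stack]
    calc
      _ = 𝟙 _ ⊗≫ B ◁ x C ▷ W ⊗≫ (x B ▷ (C ⊗ W) ≫ (V ⊗ B) ◁ y C) ⊗≫ V ◁ y B ▷ C ⊗≫ 𝟙 _ := by
        monoidal
      _ = _ := by rw [← whisker_exchange]; monoidal
  naturality {B C} f := by
    simp only [Premodular.tens]
    calc
      _ = 𝟙 _ ⊗≫ (f ▷ V ≫ x C) ▷ W ⊗≫ V ◁ y C ⊗≫ 𝟙 _ := by monoidal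
      _ = 𝟙 _ ⊗≫ x B ▷ W ⊗≫ V ◁ (f ▷ W ≫ y C) ⊗≫ 𝟙 _ := by rw [hx.naturality]; monoidal
      _ = _ := by rw [hy.naturality]; monoidal

theorem isCrossing_hb {X : A} (b : HalfBraiding X) : IsCrossing fun B => (b.β B).inv where
  unit := by
    rw [← cancel_epi (b.β (𝟙_ A)).hom, Iso.hom_inv_id, hb_unit]
    simp
  tensor B C := hb_inv_tensor b B C
  naturality f := hb_inv_naturality b f

theorem isCrossing_halfBraiding (X : ZCenter A) : IsCrossing (halfBraiding X) :=
  isCrossing_hb (Sigma.snd X)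

theorem tens_assoc {V₁ V₂ V₃ : A} (x : ∀ B : A, B ⊗ V₁ ⟶ V₁ ⊗ B) (y : ∀ B : A, B ⊗ V₂ ⟶ V₂ ⊗ B)
    (z : ∀ B : A, B ⊗ V₃ ⟶ V₃ ⊗ B) (B : A) :
    tens (tens x y) z B ≫ (α_ V₁ V₂ V₃).hom ▷ B = B ◁ (α_ V₁ V₂ V₃).hom ≫ tens x (tens y z) B := by
  unfold tens
  monoidal

/-- A morphism commutes with two families of crossings. -/
def Intertwines {V W : A} (f : V ⟶ W) (x : ∀ B : A, B ⊗ V ⟶ V ⊗ B)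
    (y : ∀ B : A, B ⊗ W ⟶ W ⊗ B) : Prop :=
  ∀ B, B ◁ f ≫ y B = x B ≫ f ▷ B

/-- Two families of crossings agree after a morphism into their object. -/
def Equalizes {V W : A} (f : W ⟶ V) (x y : ∀ B : A, B ⊗ V ⟶ V ⊗ B) : Prop :=
  ∀ B, B ◁ f ≫ x B = B ◁ f ≫ y B

theorem Intertwines.tens {V V' W W' : A} {f : V ⟶ V'} {g : W ⟶ W'}
    {x : ∀ B : A, B ⊗ V ⟶ V ⊗ B} {x' : ∀ B : A, B ⊗ V' ⟶ V' ⊗ B}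
    {y : ∀ B : A, B ⊗ W ⟶ W ⊗ B} {y' : ∀ B : A, B ⊗ W' ⟶ W' ⊗ B}
    (hf : Intertwines f x x') (hg : Intertwines g y y') :
    Intertwines (f ⊗ₘ g) (Premodular.tens x y) (Premodular.tens x' y') := by
  intro B
  have hf := hf B
  have hg := hg B
  unfold Premodular.tens
  calc
    _ = 𝟙 _ ⊗≫ ((B ⊗ V) ◁ g) ⊗≫ (B ◁ f ≫ x' B) ▷ W' ⊗≫ V' ◁ y' B ⊗≫ 𝟙 _ := by
      rw [MonoidalCategory.tensorHom_def']; monoidal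
    _ = 𝟙 _ ⊗≫ ((B ⊗ V) ◁ g ≫ x B ▷ W') ⊗≫ (f ▷ (B ⊗ W') ≫ V' ◁ y' B) ⊗≫ 𝟙 _ := by
      rw [hf]; monoidal
    _ = 𝟙 _ ⊗≫ x B ▷ W ⊗≫ V ◁ (B ◁ g ≫ y' B) ⊗≫ f ▷ (W' ⊗ B) ⊗≫ 𝟙 _ := by
      rw [whisker_exchange (x B) g, ← whisker_exchange f (y' B)]; monoidal
    _ = _ := by rw [hg, MonoidalCategory.tensorHom_def']; monoidal

theorem Intertwines.comp {V₁ V₂ V₃ : A} {f : V₁ ⟶ V₂} {g : V₂ ⟶ V₃}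
    {x : ∀ B : A, B ⊗ V₁ ⟶ V₁ ⊗ B} {y : ∀ B : A, B ⊗ V₂ ⟶ V₂ ⊗ B}
    {z : ∀ B : A, B ⊗ V₃ ⟶ V₃ ⊗ B} (hf : Intertwines f x y) (hg : Intertwines g y z) :
    Intertwines (f ≫ g) x z := fun B => by
  rw [MonoidalCategory.whiskerLeft_comp, Category.assoc, hg B, reassoc_of% hf B,
    comp_whiskerRight]

theorem Intertwines.id {V : A} (x : ∀ B : A, B ⊗ V ⟶ V ⊗ B) : Intertwines (𝟙 V) x x :=
  fun B => by simp

variable [BraidedCategory A]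

/-- The strand `B` crosses `V` by the braiding. -/
def overcross (V B : A) : B ⊗ V ⟶ V ⊗ B := (β_ B V).hom

/-- The strand `B` crosses `V` by the inverse braiding. -/
def undercross (V B : A) : B ⊗ V ⟶ V ⊗ B := (β_ V B).inv

theorem isCrossing_overcross (V : A) : IsCrossing (overcross V) where
  unit := by simp [overcross]
  tensor B C := by simp [overcross, stack]
  naturality f := by simp [overcross]

theorem isCrossing_undercross (V : A) : IsCrossing (undercross V) where
  unit := by simp [undercross, braiding_inv_tensorUnit_right]
  tensor B C := by simp [undercross, stack]
  naturality f := BraidedCategory.braiding_inv_naturality_left _ _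

theorem overcross_tensor (V W B : A) : overcross (V ⊗ W) B = tens (overcross V) (overcross W) B := by
  simp [overcross, tens]

theorem undercross_tensor (V W B : A) : undercross (V ⊗ W) B = tens (undercross V) (undercross W) B := by
  simp [undercross, tens]

theorem intertwines_overcross {V W : A} (f : V ⟶ W) : Intertwines f (overcross V) (overcross W) := fun B => by
  simp [overcross]

theorem intertwines_undercross {V W : A} (f : V ⟶ W) : Intertwines f (undercross V) (undercross W) := fun _ =>
  BraidedCategory.braiding_inv_naturality_right _ _

theorem upper_eq (X Y : ZCenter A) :
    upper X Y = tens (overcross ((F A).obj X)) (halfBraiding Y) := rfl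

theorem lower_eq (X Y : ZCenter A) :
    lower X Y = tens (halfBraiding X) (undercross ((F A).obj Y)) := rfl

/-- The strand with crossing `x` can be pulled over the strand with crossing `y`. -/
def Braids {V R P : A} (x : R ⊗ V ⟶ V ⊗ R) (y : P ⊗ V ⟶ V ⊗ P) : Prop :=
  stack x y ≫ V ◁ (β_ R P).hom = (β_ R P).hom ▷ V ≫ stack y x

/-- A half-braiding is natural for `β_ R P` in particular; together with multiplicativity this is
the braid relation of the crossing with itself. -/
theorem IsCrossing.braids (hx : IsCrossing x) (R P : A) : Braids (x R) (x P) := by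
  unfold Braids
  rw [← hx.tensor, ← hx.tensor, hx.naturality]

/-- Pulling a strand over two strands one after the other; it is applied to the two arcs of a loop.
-/
theorem Braids.stack_right {V R P S : A} {x : R ⊗ V ⟶ V ⊗ R} {y : P ⊗ V ⟶ V ⊗ P}
    {z : S ⊗ V ⟶ V ⊗ S} (hy : Braids x y) (hz : Braids x z) : Braids x (stack y z) := by
  simp only [Braids, stack, Category.assoc] at *
  rw [BraidedCategory.braiding_tensor_right_hom]
  calc
    _ = 𝟙 _ ⊗≫ (R ⊗ P) ◁ z ⊗≫ ((α_ R P V).hom ≫ R ◁ y ≫ (α_ R V P).inv ≫ x ▷ P ≫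
        (α_ V R P).hom ≫ V ◁ (β_ R P).hom) ▷ S ⊗≫ V ◁ P ◁ (β_ R S).hom ⊗≫ 𝟙 _ := by monoidal
    _ = 𝟙 _ ⊗≫ ((R ⊗ P) ◁ z ≫ (β_ R P).hom ▷ (V ⊗ S)) ⊗≫ P ◁ x ▷ S ⊗≫ (y ▷ (R ⊗ S) ≫
        (V ⊗ P) ◁ (β_ R S).hom) ⊗≫ 𝟙 _ := by rw [hy]; monoidal
    _ = 𝟙 _ ⊗≫ (β_ R P).hom ▷ (S ⊗ V) ⊗≫ P ◁ ((α_ R S V).hom ≫ R ◁ z ≫ (α_ R V S).inv ≫ x ▷ S ≫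
        (α_ V R S).hom ≫ V ◁ (β_ R S).hom) ⊗≫ y ▷ (S ⊗ R) ⊗≫ 𝟙 _ := by
      rw [whisker_exchange (β_ R P).hom z, ← whisker_exchange y (β_ R S).hom]; monoidal
    _ = _ := by rw [hz]; monoidal

/-- Naturality of the braiding with `R` at the morphism `y`. The strand `R` lies above the whole
picture, so nothing is required of `y`. -/
theorem braids_overcross_left (V : A) {R P : A} (y : P ⊗ V ⟶ V ⊗ P) : Braids (overcross V R) y := by
  have h := BraidedCategory.braiding_naturality_right R y
  rw [BraidedCategory.braiding_tensor_right_hom, BraidedCategory.braiding_tensor_right_hom] at h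
  unfold Braids overcross stack
  rw [← cancel_epi (α_ R P V).inv, ← cancel_mono (α_ V P R).inv]
  simpa using h

/-- The mirror image: naturality of the braiding with `P` at `x`, since the strand `P` lies below
the whole picture. -/
theorem braids_undercross_right (V : A) {R P : A} (x : R ⊗ V ⟶ V ⊗ R) : Braids x (undercross V P) := by
  have h := BraidedCategory.braiding_naturality_left x P
  rw [BraidedCategory.braiding_tensor_left_hom, BraidedCategory.braiding_tensor_left_hom] at h
  unfold Braids undercross stack
  apply (cancel_epi ((α_ R V P).hom ≫ R ◁ (β_ V P).hom ≫ (α_ R P V).inv)).1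
  apply (cancel_mono ((α_ V P R).inv ≫ (β_ V P).hom ▷ R ≫ (α_ P V R).hom)).1
  simpa using h

theorem Braids.tens {V W R P : A} {x : ∀ B : A, B ⊗ V ⟶ V ⊗ B} {y : ∀ B : A, B ⊗ W ⟶ W ⊗ B}
    {x' : ∀ B : A, B ⊗ V ⟶ V ⊗ B} {y' : ∀ B : A, B ⊗ W ⟶ W ⊗ B}
    (hx : Braids (x R) (x' P)) (hy : Braids (y R) (y' P)) :
    Braids (Premodular.tens x y R) (Premodular.tens x' y' P) := by
  simp only [Braids, stack, Premodular.tens, Category.assoc] at *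
  calc
    _ = 𝟙 _ ⊗≫ R ◁ x' P ▷ W ⊗≫ ((R ⊗ V) ◁ y' P ≫ x R ▷ (W ⊗ P)) ⊗≫ V ◁ y R ▷ P ⊗≫
        (V ⊗ W) ◁ (β_ R P).hom ⊗≫ 𝟙 _ := by monoidal
    _ = 𝟙 _ ⊗≫ R ◁ x' P ▷ W ⊗≫ x R ▷ (P ⊗ W) ⊗≫ V ◁ ((α_ R P W).hom ≫ R ◁ y' P ≫
        (α_ R W P).inv ≫ y R ▷ P ≫ (α_ W R P).hom ≫ W ◁ (β_ R P).hom) ⊗≫ 𝟙 _ := by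
      rw [whisker_exchange]; monoidal
    _ = 𝟙 _ ⊗≫ ((α_ R P V).hom ≫ R ◁ x' P ≫ (α_ R V P).inv ≫ x R ▷ P ≫ (α_ V R P).hom ≫
        V ◁ (β_ R P).hom) ▷ W ⊗≫ V ◁ P ◁ y R ⊗≫ V ◁ y' P ▷ R ⊗≫ 𝟙 _ := by
      rw [hy]; monoidal
    _ = 𝟙 _ ⊗≫ (β_ R P).hom ▷ (V ⊗ W) ⊗≫ P ◁ x R ▷ W ⊗≫ (x' P ▷ (R ⊗ W) ≫ (V ⊗ P) ◁ y R) ⊗≫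
        V ◁ y' P ▷ R ⊗≫ 𝟙 _ := by
      rw [hx]; monoidal
    _ = _ := by rw [← whisker_exchange]; monoidal

/-- Factor by factor: at `X` the upper strand crosses by the braiding, at `Y` the lower strand
crosses by the inverse braiding, and either condition alone suffices. -/
theorem braids_upper_lower (X Y : ZCenter A) (R P : A) :
    Braids (upper X Y R) (lower X Y P) :=
  Braids.tens (braids_overcross_left _ _) (braids_undercross_right _ _)

end Crossings

/-! ### Loops around an object, and how strands and morphisms move through them -/

section Enclosures

variable {A : Type u} [Category.{v} A] [MonoidalCategory A]

/-- A strand `P` is created on the left of `V`, crosses it by `z` and disappears on the right. -/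
def encl {V P : A} (n : 𝟙_ A ⟶ P) (z : P ⊗ V ⟶ V ⊗ P) (e : P ⟶ 𝟙_ A) : V ⟶ V :=
  (λ_ V).inv ≫ n ▷ V ≫ z ≫ V ◁ e ≫ (ρ_ V).hom

/-- `tube` for two arbitrary families of crossings of one object. -/
def tubeOf {V : A} (x y : ∀ B : A, B ⊗ V ⟶ V ⊗ B) {B B' P R : A} (φ : B ⟶ P ⊗ R)
    (ψ : P ⊗ R ⟶ B') : B ⊗ V ⟶ V ⊗ B' :=
  φ ▷ V ≫ stack (y P) (x R) ≫ V ◁ ψ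

/-- Morphisms placed on the two strands slide through `V` from left to right, by naturality of both
crossings. -/
theorem tubeOf_dinatural {V : A} {x y : ∀ B : A, B ⊗ V ⟶ V ⊗ B} (hx : IsCrossing x)
    (hy : IsCrossing y) {B B' P R P' R' : A} (φ : B ⟶ P ⊗ R) (f : P ⟶ P') (g : R ⟶ R')
    (ψ : P' ⊗ R' ⟶ B') :
    tubeOf x y (φ ≫ (f ⊗ₘ g)) ψ = tubeOf x y φ ((f ⊗ₘ g) ≫ ψ) := by
  unfold tubeOf
  rw [comp_whiskerRight, Category.assoc,
    reassoc_of% stack_naturality (hy.naturality f) (hx.naturality g),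
    MonoidalCategory.whiskerLeft_comp]

theorem crossing_encl_right {V B P R : A} (b : B ⊗ V ⟶ V ⊗ B) (n : 𝟙_ A ⟶ P ⊗ R)
    (x : R ⊗ V ⟶ V ⊗ R) (y : P ⊗ V ⟶ V ⊗ P) (e : P ⊗ R ⟶ 𝟙_ A) :
    b ≫ encl n (stack y x) e ▷ B =
      ((λ_ B).inv ≫ n ▷ B ≫ (α_ P R B).hom) ▷ V ≫ stack y (stack x b) ≫
        V ◁ ((α_ P R B).inv ≫ e ▷ B ≫ (λ_ B).hom) := by
  unfold encl stack
  calc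
    _ = 𝟙 _ ⊗≫ ((𝟙_ A) ◁ b ≫ n ▷ (V ⊗ B)) ⊗≫ P ◁ x ▷ B ⊗≫ y ▷ (R ⊗ B) ⊗≫ V ◁ e ▷ B ⊗≫ 𝟙 _ := by
      monoidal
    _ = _ := by rw [whisker_exchange]; monoidal

theorem encl_left_crossing {V B P R : A} (b : B ⊗ V ⟶ V ⊗ B) (n : 𝟙_ A ⟶ P ⊗ R)
    (x : R ⊗ V ⟶ V ⊗ R) (y : P ⊗ V ⟶ V ⊗ P) (e : P ⊗ R ⟶ 𝟙_ A) :
    B ◁ encl n (stack y x) e ≫ b =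
      ((ρ_ B).inv ≫ B ◁ n ≫ (α_ B P R).inv) ▷ V ≫ stack (stack b y) x ≫
        V ◁ ((α_ B P R).hom ≫ B ◁ e ≫ (ρ_ B).hom) := by
  unfold encl stack
  calc
    _ = 𝟙 _ ⊗≫ B ◁ n ▷ V ⊗≫ (B ⊗ P) ◁ x ⊗≫ B ◁ y ▷ R ⊗≫ ((B ⊗ V) ◁ e ≫ b ▷ (𝟙_ A)) ⊗≫ 𝟙 _ := by
      monoidal
    _ = _ := by rw [whisker_exchange]; monoidal

/-- The strand `B` runs parallel to the arc `R`, and multiplicativity of `x` merges the two into one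
strand `R ⊗ B`. In `tubeOf_right_encl` it merges with the arc `P` instead. -/
theorem tubeOf_left_encl {V : A} {x y : ∀ B : A, B ⊗ V ⟶ V ⊗ B} (hx : IsCrossing x) {B P R : A}
    (n : 𝟙_ A ⟶ P ⊗ R) (e : P ⊗ R ⟶ 𝟙_ A) :
    x B ≫ encl n (stack (y P) (x R)) e ▷ B =
      tubeOf x y ((λ_ B).inv ≫ n ▷ B ≫ (α_ P R B).hom) ((α_ P R B).inv ≫ e ▷ B ≫ (λ_ B).hom) := by
  rw [tubeOf, hx.tensor, crossing_encl_right]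

theorem tubeOf_right_encl {V : A} {x y : ∀ B : A, B ⊗ V ⟶ V ⊗ B} (hy : IsCrossing y) {B P R : A}
    (n : 𝟙_ A ⟶ P ⊗ R) (e : P ⊗ R ⟶ 𝟙_ A) :
    B ◁ encl n (stack (y P) (x R)) e ≫ y B =
      tubeOf x y ((ρ_ B).inv ≫ B ◁ n ≫ (α_ B P R).inv) ((α_ B P R).hom ≫ B ◁ e ≫ (ρ_ B).hom) := by
  rw [tubeOf, hy.tensor, encl_left_crossing]

theorem encl_comp {V W P : A} {n : 𝟙_ A ⟶ P} {z : P ⊗ V ⟶ V ⊗ P} {z' : P ⊗ W ⟶ W ⊗ P}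
    {e : P ⟶ 𝟙_ A} {f : V ⟶ W} (h : P ◁ f ≫ z' = z ≫ f ▷ P) :
    encl n z e ≫ f = f ≫ encl n z' e := by
  unfold encl
  calc
    _ = (λ_ V).inv ≫ n ▷ V ≫ z ≫ (V ◁ e ≫ f ▷ (𝟙_ A)) ≫ (ρ_ W).hom := by monoidal
    _ = (λ_ V).inv ≫ (n ▷ V ≫ P ◁ f) ≫ z' ≫ W ◁ e ≫ (ρ_ W).hom := by
      rw [whisker_exchange]; simp only [Category.assoc]; rw [reassoc_of% h]
    _ = _ := by rw [← whisker_exchange]; monoidal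

/-- Naturality of a half-braiding moves the end of the loop back to its beginning, so the loop
slides off `V` and becomes a closed diagram. -/
theorem encl_crossing {V : A} {x : ∀ B : A, B ⊗ V ⟶ V ⊗ B} (hx : IsCrossing x) {P : A}
    (n : 𝟙_ A ⟶ P) (e : P ⟶ 𝟙_ A) :
    encl n (x P) e = (λ_ V).inv ≫ (n ≫ e) ▷ V ≫ (λ_ V).hom := by
  unfold encl
  rw [← reassoc_of% hx.naturality e, hx.unit]
  simp

theorem stack_intertwines {V W R P : A} {x : R ⊗ V ⟶ V ⊗ R} {y : P ⊗ V ⟶ V ⊗ P}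
    {x' : R ⊗ W ⟶ W ⊗ R} {y' : P ⊗ W ⟶ W ⊗ P} {f : V ⟶ W}
    (hx : R ◁ f ≫ x' = x ≫ f ▷ R) (hy : P ◁ f ≫ y' = y ≫ f ▷ P) :
    (R ⊗ P) ◁ f ≫ stack x' y' = stack x y ≫ f ▷ (R ⊗ P) := by
  unfold stack
  calc
    _ = 𝟙 _ ⊗≫ R ◁ (P ◁ f ≫ y') ⊗≫ x' ▷ P ⊗≫ 𝟙 _ := by monoidal
    _ = 𝟙 _ ⊗≫ R ◁ y ⊗≫ (R ◁ f ≫ x') ▷ P ⊗≫ 𝟙 _ := by rw [hy]; monoidal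
    _ = _ := by rw [hx]; monoidal

/-- The arc `R` is the first to meet the image of `f`, so its crossing `x` may be exchanged for `y`.
Afterwards the whole loop crosses by the single half-braiding `y`, and `encl_crossing` applies. -/
theorem Equalizes.comp_encl {V W : A} {f : W ⟶ V} {x y : ∀ B : A, B ⊗ V ⟶ V ⊗ B}
    (h : Equalizes f x y) (hy : IsCrossing y) {P R : A} (n : 𝟙_ A ⟶ P ⊗ R) (e : P ⊗ R ⟶ 𝟙_ A) :
    f ≫ encl n (stack (y P) (x R)) e = f ≫ encl n (y (P ⊗ R)) e := by
  have key : (P ⊗ R) ◁ f ≫ stack (y P) (x R) = (P ⊗ R) ◁ f ≫ stack (y P) (y R) := by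
    unfold stack
    calc
      _ = 𝟙 _ ⊗≫ P ◁ (R ◁ f ≫ x R) ⊗≫ y P ▷ R ⊗≫ 𝟙 _ := by monoidal
      _ = _ := by rw [h R]; monoidal
  rw [hy.tensor]
  unfold encl
  rw [leftUnitor_inv_naturality_assoc, leftUnitor_inv_naturality_assoc,
    whisker_exchange_assoc, whisker_exchange_assoc, reassoc_of% key]

theorem stack_tens {V W P R : A} {x x' : ∀ B : A, B ⊗ V ⟶ V ⊗ B} {y y' : ∀ B : A, B ⊗ W ⟶ W ⊗ B} :
    stack (tens x y P) (tens x' y' R) = (α_ (P ⊗ R) V W).inv ≫ stack (x P) (x' R) ▷ W ≫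
      (α_ V (P ⊗ R) W).hom ≫ V ◁ stack (y P) (y' R) ≫ (α_ V W (P ⊗ R)).inv := by
  simp only [tens, stack]
  calc
    _ = 𝟙 _ ⊗≫ P ◁ x' R ▷ W ⊗≫ ((P ⊗ V) ◁ y' R ≫ x P ▷ (W ⊗ R)) ⊗≫ V ◁ y P ▷ R ⊗≫ 𝟙 _ := by
      monoidal
    _ = _ := by rw [whisker_exchange]; monoidal

variable [BraidedCategory A]

/-- A strand above the whole loop passes over its creation, its crossing and its end in turn; the
first and the last of these are naturality of the braiding at `n` and at `e`. -/
theorem Braids.encl_left {V R P : A} {x : R ⊗ V ⟶ V ⊗ R} {z : P ⊗ V ⟶ V ⊗ P} (h : Braids x z)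
    (n : 𝟙_ A ⟶ P) (e : P ⟶ 𝟙_ A) : R ◁ encl n z e ≫ x = x ≫ encl n z e ▷ R := by
  have h1 := BraidedCategory.braiding_naturality_right R n
  have h2 := BraidedCategory.braiding_naturality_right R e
  simp only [braiding_tensorUnit_right] at h1 h2
  have h3 : (β_ R P).hom ≫ e ▷ R ≫ (λ_ R).hom = R ◁ e ≫ (ρ_ R).hom := by
    rw [← reassoc_of% h2]; simp
  have h4 : (ρ_ R).inv ≫ R ◁ n ≫ (β_ R P).hom = (λ_ R).inv ≫ n ▷ R := by
    rw [h1]; simp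
  calc
    _ = 𝟙 _ ⊗≫ R ◁ n ▷ V ⊗≫ R ◁ z ⊗≫ ((R ⊗ V) ◁ e ≫ x ▷ (𝟙_ A)) ⊗≫ 𝟙 _ := by
      unfold encl; monoidal
    _ = ((ρ_ R).inv ≫ R ◁ n) ▷ V ≫ stack x z ≫ V ◁ (R ◁ e ≫ (ρ_ R).hom) := by
      rw [whisker_exchange]; unfold stack; monoidal
    _ = ((ρ_ R).inv ≫ R ◁ n) ▷ V ≫ (stack x z ≫ V ◁ (β_ R P).hom) ≫ V ◁ (e ▷ R ≫ (λ_ R).hom) := by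
      rw [← h3]; simp
    _ = ((ρ_ R).inv ≫ R ◁ n ≫ (β_ R P).hom) ▷ V ≫ stack z x ≫ V ◁ (e ▷ R ≫ (λ_ R).hom) := by
      rw [h]; simp only [comp_whiskerRight, Category.assoc]
    _ = 𝟙 _ ⊗≫ (n ▷ (R ⊗ V) ≫ P ◁ x) ⊗≫ z ▷ R ⊗≫ V ◁ e ▷ R ⊗≫ 𝟙 _ := by
      rw [h4]; unfold stack; monoidal
    _ = _ := by rw [← whisker_exchange]; unfold encl; monoidal

/-- Both arcs cross `X` by the braiding, so the creation of the loop can be moved past `X` and the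
loop no longer meets it. In `encl_tens_undercross` it is the end of the loop that is moved across
`Z`. -/
theorem encl_tens_overcross {X V P R : A} {x y : ∀ B : A, B ⊗ V ⟶ V ⊗ B} (n : 𝟙_ A ⟶ P ⊗ R)
    (e : P ⊗ R ⟶ 𝟙_ A) :
    encl n (stack (tens (overcross X) y P) (tens (overcross X) x R)) e =
      X ◁ encl n (stack (y P) (x R)) e := by
  have h : n ▷ X ≫ overcross X (P ⊗ R) = (λ_ X).hom ≫ (ρ_ X).inv ≫ X ◁ n := by
    rw [(isCrossing_overcross X).naturality, (isCrossing_overcross X).unit]; simp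
  rw [stack_tens, ← (isCrossing_overcross X).tensor]
  unfold encl
  generalize stack (y P) (x R) = z
  calc
    _ = 𝟙 _ ⊗≫ (n ▷ X ≫ overcross X (P ⊗ R)) ▷ V ⊗≫ X ◁ z ⊗≫ X ◁ V ◁ e ⊗≫ 𝟙 _ := by monoidal
    _ = _ := by rw [h]; monoidal

theorem encl_tens_undercross {Z V P R : A} {x y : ∀ B : A, B ⊗ V ⟶ V ⊗ B} (n : 𝟙_ A ⟶ P ⊗ R)
    (e : P ⊗ R ⟶ 𝟙_ A) :
    encl n (stack (tens y (undercross Z) P) (tens x (undercross Z) R)) e =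
      encl n (stack (y P) (x R)) e ▷ Z := by
  have h : undercross Z (P ⊗ R) ≫ Z ◁ e = e ▷ Z ≫ (λ_ Z).hom ≫ (ρ_ Z).inv := by
    rw [← (isCrossing_undercross Z).naturality, (isCrossing_undercross Z).unit]
  rw [stack_tens, ← (isCrossing_undercross Z).tensor]
  unfold encl
  generalize stack (y P) (x R) = z
  calc
    _ = 𝟙 _ ⊗≫ n ▷ (V ⊗ Z) ⊗≫ z ▷ Z ⊗≫ V ◁ (undercross Z (P ⊗ R) ≫ Z ◁ e) ⊗≫ 𝟙 _ := by monoidal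
    _ = _ := by rw [h]; monoidal

end Enclosures

/-! ### Traces in a ribbon category: cyclicity, partial traces and sphericality -/

section Closure

variable {A : Type u} [Category.{v} A] [MonoidalCategory A] [BraidedCategory A]
  [RigidCategory A] [RibbonCategory A]

/-- The right-handed evaluation `X ⊗ W ⟶ 𝟙_` of a dual `W` of `X`. -/
def rightEv (X W : A) [ExactPairing X W] : X ⊗ W ⟶ 𝟙_ A :=
  (RibbonCategory.twist X).hom ▷ W ≫ (β_ X W).hom ≫ ε_ X W

/-- The closure of an endomorphism of `X`, formed with a dual `W` of `X`. -/
def closure {X : A} (W : A) [ExactPairing X W] (f : X ⟶ X) : 𝟙_ A ⟶ 𝟙_ A :=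
  η_ X W ≫ f ▷ W ≫ rightEv X W

theorem closure_comm {X Y : A} (W W' : A) [ExactPairing X W] [ExactPairing Y W'] (f : X ⟶ Y)
    (g : Y ⟶ X) : closure W (f ≫ g) = closure W' (g ≫ f) := by
  -- `m` is the mate of `f`; it carries `f` around the loop, through the braiding, and back as `f`
  -- in front of the evaluation.
  obtain ⟨m, h1, h2⟩ : ∃ m : W' ⟶ W, η_ Y W' ≫ Y ◁ m = η_ X W ≫ f ▷ W ∧
      m ▷ X ≫ ε_ X W = W' ◁ f ≫ ε_ Y W' := by
    let _ : HasRightDual X := ⟨W⟩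
    let _ : HasRightDual Y := ⟨W'⟩
    exact ⟨rightAdjointMate f, coevaluation_comp_rightAdjointMate f,
      rightAdjointMate_comp_evaluation f⟩
  unfold closure rightEv
  calc
    _ = η_ X W ≫ f ▷ W ≫ (g ≫ (RibbonCategory.twist X).hom) ▷ W ≫ (β_ X W).hom ≫ ε_ X W := by simp
    _ = η_ Y W' ≫ (Y ◁ m ≫ (g ≫ (RibbonCategory.twist X).hom) ▷ W) ≫ (β_ X W).hom ≫ ε_ X W := by
      rw [← reassoc_of% h1, Category.assoc]
    _ = η_ Y W' ≫ (g ≫ (RibbonCategory.twist X).hom) ▷ W' ≫ (β_ X W').hom ≫ m ▷ X ≫ ε_ X W := by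
      rw [whisker_exchange, Category.assoc, BraidedCategory.braiding_naturality_right_assoc]
    _ = η_ Y W' ≫ (g ≫ (RibbonCategory.twist X).hom ≫ f) ▷ W' ≫ (β_ Y W').hom ≫ ε_ Y W' := by
      rw [h2, ← BraidedCategory.braiding_naturality_left_assoc]; simp
    _ = _ := by rw [← RibbonCategory.twist_naturality]; simp

theorem closure_eq_closure {X : A} (W W' : A) [ExactPairing X W] [ExactPairing X W'] (f : X ⟶ X) :
    closure W f = closure W' f := by
  simpa using closure_comm W W' f (𝟙 X)

/-- Nested evaluations. Apart from the twists, the two sides differ by a double crossing of `B` and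
`X`, and that is what the twist of `B ⊗ X` contributes beyond the twists of the factors. -/
theorem rightEv_tensor (B X W W' : A) [ExactPairing B W] [ExactPairing X W'] :
    rightEv (B ⊗ X) (W' ⊗ W) = 𝟙 _ ⊗≫ B ◁ rightEv X W' ▷ W ⊗≫ rightEv B W := by
  -- Naturality of the braiding at `e`: a strand `T` can be moved from one side of a cap to the
  -- other.
  have cross : ∀ (S Z : A) (e : S ⊗ Z ⟶ 𝟙_ A) (T : A),
      T ◁ e ⊗≫ 𝟙 T = 𝟙 _ ⊗≫ (β_ T S).hom ▷ Z ⊗≫ S ◁ (β_ T Z).hom ⊗≫ e ▷ T ⊗≫ 𝟙 T := by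
    intro S Z e T
    have h := BraidedCategory.braiding_naturality_right T e
    rw [BraidedCategory.braiding_tensor_right_hom, braiding_tensorUnit_right] at h
    calc
      _ = (T ◁ e ≫ (ρ_ T).hom ≫ (λ_ T).inv) ⊗≫ 𝟙 T := by monoidal
      _ = _ := by rw [h]; monoidal
  -- Without the twists: untangling the caps leaves the inverse of the double braiding, which
  -- cancels against `twist_tensor`.
  have main : (β_ (B ⊗ X) (W' ⊗ W)).hom ≫ ε_ (B ⊗ X) (W' ⊗ W) =
      𝟙 _ ⊗≫ ((β_ X B).inv ≫ (β_ B X).inv) ▷ (W' ⊗ W) ⊗≫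
        B ◁ ((β_ X W').hom ≫ ε_ X W') ▷ W ⊗≫ (β_ B W).hom ≫ ε_ B W := by
    have c1 := cross B W ((β_ B W).hom ≫ ε_ B W) X
    have c2 := cross X W' ((β_ X W').hom ≫ ε_ X W') B
    have s1 : 𝟙 (B ⊗ X ⊗ W) ⊗≫ B ◁ (β_ X W).hom ⊗≫ ((β_ B W).hom ≫ ε_ B W) ▷ X ⊗≫ 𝟙 X =
        𝟙 (B ⊗ X ⊗ W) ⊗≫ (β_ X B).inv ▷ W ⊗≫ X ◁ ((β_ B W).hom ≫ ε_ B W) ⊗≫ 𝟙 X := by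
      calc
        _ = 𝟙 _ ⊗≫ (β_ X B).inv ▷ W ⊗≫ (𝟙 (X ⊗ B ⊗ W) ⊗≫ (β_ X B).hom ▷ W ⊗≫ B ◁ (β_ X W).hom ⊗≫
            ((β_ B W).hom ≫ ε_ B W) ▷ X ⊗≫ 𝟙 X) := by
          have : (β_ X B).inv ▷ W ≫ (β_ X B).hom ▷ W = 𝟙 _ := by simp
          calc
            _ = 𝟙 _ ⊗≫ ((β_ X B).inv ▷ W ≫ (β_ X B).hom ▷ W) ⊗≫ B ◁ (β_ X W).hom ⊗≫
              ((β_ B W).hom ≫ ε_ B W) ▷ X ⊗≫ 𝟙 X := by rw [this]; monoidal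
            _ = _ := by monoidal
        _ = _ := by rw [← c1]
    have s2 : 𝟙 (X ⊗ B ⊗ W') ⊗≫ X ◁ (β_ B W').hom ⊗≫ ((β_ X W').hom ≫ ε_ X W') ▷ B ⊗≫ 𝟙 B =
        𝟙 (X ⊗ B ⊗ W') ⊗≫ (β_ B X).inv ▷ W' ⊗≫ B ◁ ((β_ X W').hom ≫ ε_ X W') ⊗≫ 𝟙 B := by
      calc
        _ = 𝟙 _ ⊗≫ (β_ B X).inv ▷ W' ⊗≫ (𝟙 (B ⊗ X ⊗ W') ⊗≫ (β_ B X).hom ▷ W' ⊗≫ X ◁ (β_ B W').hom ⊗≫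
            ((β_ X W').hom ≫ ε_ X W') ▷ B ⊗≫ 𝟙 B) := by
          have : (β_ B X).inv ▷ W' ≫ (β_ B X).hom ▷ W' = 𝟙 _ := by simp
          calc
            _ = 𝟙 _ ⊗≫ ((β_ B X).inv ▷ W' ≫ (β_ B X).hom ▷ W') ⊗≫ X ◁ (β_ B W').hom ⊗≫
              ((β_ X W').hom ≫ ε_ X W') ▷ B ⊗≫ 𝟙 B := by rw [this]; monoidal
            _ = _ := by monoidal
        _ = _ := by rw [← c2]
    rw [ExactPairing.tensor_evaluation, BraidedCategory.braiding_tensor_right_hom]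
    calc
      _ = 𝟙 _ ⊗≫ (β_ (B ⊗ X) W').hom ▷ W ⊗≫ W' ◁ (𝟙 (B ⊗ X ⊗ W) ⊗≫ B ◁ (β_ X W).hom ⊗≫
          ((β_ B W).hom ≫ ε_ B W) ▷ X ⊗≫ 𝟙 X) ⊗≫ ε_ X W' := by
        rw [BraidedCategory.braiding_tensor_left_hom B X W]; monoidal
      _ = 𝟙 _ ⊗≫ ((β_ (B ⊗ X) W').hom ≫ W' ◁ (β_ X B).inv) ▷ W ⊗≫
          ((W' ⊗ X) ◁ ((β_ B W).hom ≫ ε_ B W) ≫ ε_ X W' ▷ (𝟙_ A)) ⊗≫ 𝟙 _ := by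
        rw [s1]; monoidal
      _ = 𝟙 _ ⊗≫ (β_ X B).inv ▷ (W' ⊗ W) ⊗≫ (𝟙 (X ⊗ B ⊗ W') ⊗≫ X ◁ (β_ B W').hom ⊗≫
          ((β_ X W').hom ≫ ε_ X W') ▷ B ⊗≫ 𝟙 B) ▷ W ⊗≫ (β_ B W).hom ≫ ε_ B W := by
        rw [whisker_exchange, ← BraidedCategory.braiding_naturality_left,
          BraidedCategory.braiding_tensor_left_hom X B W']
        monoidal
      _ = _ := by rw [s2]; monoidal
  unfold rightEv
  rw [main, RibbonCategory.twist_tensor]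
  calc
    _ = ((RibbonCategory.twist B).hom ⊗ₘ (RibbonCategory.twist X).hom) ▷ (W' ⊗ W) ⊗≫
        ((β_ B X).hom ≫ ((β_ X B).hom ≫ (β_ X B).inv) ≫ (β_ B X).inv) ▷ (W' ⊗ W) ⊗≫
          B ◁ ((β_ X W').hom ≫ ε_ X W') ▷ W ⊗≫ (β_ B W).hom ≫ ε_ B W := by monoidal
    _ = 𝟙 _ ⊗≫ ((RibbonCategory.twist B).hom ▷ ((X ⊗ W') ⊗ W) ≫
        B ◁ (((RibbonCategory.twist X).hom ▷ W' ≫ (β_ X W').hom ≫ ε_ X W') ▷ W)) ⊗≫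
          (β_ B W).hom ≫ ε_ B W := by
      rw [Iso.hom_inv_id, Category.id_comp, Iso.hom_inv_id, MonoidalCategory.tensorHom_def]
      monoidal
    _ = _ := by rw [← whisker_exchange]; monoidal

/-- The partial closure of an endomorphism of `B ⊗ X` over the factor `X`. -/
def closureRight {B X : A} (W : A) [ExactPairing X W] (h : B ⊗ X ⟶ B ⊗ X) : B ⟶ B :=
  (ρ_ B).inv ≫ B ◁ η_ X W ≫ (α_ B X W).inv ≫ h ▷ W ≫ (α_ B X W).hom ≫ B ◁ rightEv X W ≫
    (ρ_ B).hom

theorem closure_tensor {B X : A} (V W W' : A) [ExactPairing B W] [ExactPairing X W']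
    [ExactPairing (B ⊗ X) V] (h : B ⊗ X ⟶ B ⊗ X) :
    closure V h = closure W (closureRight W' h) := by
  rw [closure_eq_closure V (W' ⊗ W)]
  unfold closure closureRight
  rw [rightEv_tensor, ExactPairing.tensor_coevaluation]
  monoidal

theorem twist_unit : (RibbonCategory.twist (𝟙_ A)).hom = 𝟙 _ := by
  have n := RibbonCategory.twist_naturality (λ_ (𝟙_ A)).hom
  have e : (β_ (𝟙_ A) (𝟙_ A)).hom = 𝟙 _ := by
    rw [braiding_tensorUnit_left, unitors_equal, Iso.hom_inv_id]
  rw [RibbonCategory.twist_tensor, e, Category.comp_id, Category.comp_id,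
    MonoidalCategory.tensorHom_def, Category.assoc, leftUnitor_naturality, unitors_equal,
    rightUnitor_naturality_assoc, cancel_epi] at n
  rw [← cancel_epi (RibbonCategory.twist (𝟙_ A)).hom, ← n, Category.comp_id]

theorem twist_comp_evaluation (X : A) : Xᘁ ◁ (RibbonCategory.twist X).hom ≫ ε_ X Xᘁ =
    (RibbonCategory.twist Xᘁ).hom ▷ X ≫ ε_ X Xᘁ := by
  rw [RibbonCategory.twist_dual, rightAdjointMate_comp_evaluation]

omit [RigidCategory A] [RibbonCategory A] in
theorem whiskerRight_comp_monodromy (X W : A) {f : W ⟶ W} :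
    f ▷ X ≫ (β_ W X).hom ≫ (β_ X W).hom = (β_ W X).hom ≫ (β_ X W).hom ≫ f ▷ X := by
  rw [BraidedCategory.braiding_naturality_left_assoc, BraidedCategory.braiding_naturality_right]

/-- Naturality of the twist at `ε_ X Xᘁ`, with trivial twist on the unit, makes the twists of `Xᘁ`
and `X` together cancel the double braiding under the evaluation. Hence a positive curl may be
replaced by the opposite crossing with the inverse twist. -/
theorem rightEv_eq (X : A) : rightEv X Xᘁ =
    (β_ Xᘁ X).inv ≫ Xᘁ ◁ (RibbonCategory.twist X).inv ≫ ε_ X Xᘁ := by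
  have h1 := RibbonCategory.twist_naturality (ε_ X Xᘁ)
  rw [twist_unit, Category.comp_id, RibbonCategory.twist_tensor,
    MonoidalCategory.tensorHom_def'] at h1
  rw [← cancel_epi (β_ Xᘁ X).hom, Iso.hom_inv_id_assoc,
    ← cancel_epi (Xᘁ ◁ (RibbonCategory.twist X).hom), whiskerLeft_hom_inv_assoc]
  conv_rhs => rw [h1]
  unfold rightEv
  simp only [Category.assoc]
  congr 1
  rw [BraidedCategory.braiding_naturality_left_assoc, twist_comp_evaluation,
    reassoc_of% whiskerRight_comp_monodromy]

/-- Sphericality: the trace on the dual is the trace of the original object closed on the other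
side. It gives equal dimensions to an object and its dual and allows partial traces over a left
factor. -/
theorem closure_dual {X : A} (V : A) [ExactPairing Xᘁ V] (h : Xᘁ ⟶ Xᘁ) :
    closure V h = η_ X Xᘁ ≫ X ◁ h ≫ rightEv X Xᘁ := by
  -- The closure does not depend on the dual, so `X` itself serves as the dual of `Xᘁ`, with the
  -- pairing twisted by the braiding.
  let _ := BraidedCategory.exactPairing_swap X Xᘁ
  rw [closure_eq_closure V X]
  have e : rightEv Xᘁ X = Xᘁ ◁ (RibbonCategory.twist X).inv ≫ ε_ X Xᘁ := by
    have h := rightEv_eq X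
    rw [← cancel_epi (β_ Xᘁ X).hom, Iso.hom_inv_id_assoc] at h
    rw [← h]
    change (RibbonCategory.twist Xᘁ).hom ▷ X ≫ (β_ Xᘁ X).hom ≫ (β_ X Xᘁ).hom ≫ ε_ X Xᘁ = _
    rw [reassoc_of% whiskerRight_comp_monodromy, ← twist_comp_evaluation]
    unfold rightEv
    rw [BraidedCategory.braiding_naturality_left_assoc]
  unfold closure
  rw [e, rightEv_eq]
  change (η_ X Xᘁ ≫ (β_ Xᘁ X).inv) ≫ _ = _
  rw [Category.assoc, BraidedCategory.braiding_inv_naturality_right_assoc]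

/-- The partial closure of an endomorphism of `X^* ⊗ B` over the factor `X^*`. -/
def closureLeft {X B : A} (h : Xᘁ ⊗ B ⟶ Xᘁ ⊗ B) : B ⟶ B :=
  (λ_ B).inv ≫ η_ X Xᘁ ▷ B ≫ (α_ X Xᘁ B).hom ≫ X ◁ h ≫ (α_ X Xᘁ B).inv ≫
    rightEv X Xᘁ ▷ B ≫ (λ_ B).hom

theorem closure_tensor_left {X B : A} (V W : A) [ExactPairing B W] [ExactPairing (Xᘁ ⊗ B) V]
    (h : Xᘁ ⊗ B ⟶ Xᘁ ⊗ B) : closure V h = closure W (closureLeft h) := by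
  let _ := BraidedCategory.exactPairing_swap X Xᘁ
  rw [closure_tensor V X W, closure_dual]
  unfold closure closureLeft closureRight
  calc
    _ = 𝟙 _ ⊗≫ (η_ X Xᘁ ▷ (𝟙_ A) ≫ (X ⊗ Xᘁ) ◁ η_ B W) ⊗≫ X ◁ h ▷ W ⊗≫
        ((X ⊗ Xᘁ) ◁ rightEv B W ≫ rightEv X Xᘁ ▷ (𝟙_ A)) ⊗≫ 𝟙 _ := by monoidal
    _ = _ := by rw [whisker_exchange, ← whisker_exchange]; monoidal

end Closure

/-! ### Nondegeneracy of the trace pairing and the resolution of the identity -/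

section Semisimple

variable (k : Type w) [Field k] {A : Type u} [Category.{v} A] [Abelian A]
  [Linear k A] [MonoidalCategory A] [IsFusion k A]

include k in
theorem exists_simple_decomposition (W : A) : ∃ (n : ℕ) (S : Fin n → A) (p : ∀ i, W ⟶ S i)
    (s : ∀ i, S i ⟶ W), (∀ i, Simple (S i)) ∧ (∀ i, s i ≫ p i = 𝟙 _) ∧ ∑ i, p i ≫ s i = 𝟙 W := by
  obtain ⟨n, S, hS, b, ⟨hb⟩, ⟨e⟩⟩ := IsFusion.semisimple (k := k) W
  refine ⟨n, S, fun i => e.hom ≫ b.π i, fun i => b.ι i ≫ e.inv, hS, fun i => by simp, ?_⟩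
  have h := IsBilimit.total hb
  calc
    _ = e.hom ≫ (∑ i, b.π i ≫ b.ι i) ≫ e.inv := by
      simp [Preadditive.comp_sum, Preadditive.sum_comp]
    _ = _ := by rw [h]; simp

include k in
theorem exists_retraction {S W : A} [Simple S] {f : S ⟶ W} (hf : f ≠ 0) : ∃ r, f ≫ r = 𝟙 S := by
  obtain ⟨n, T, p, s, hT, -, hid⟩ := exists_simple_decomposition k W
  have : ∃ i, f ≫ p i ≠ 0 := by
    by_contra! h
    apply hf
    rw [← Category.comp_id f, ← hid, Preadditive.comp_sum]
    exact Finset.sum_eq_zero fun i _ => by rw [reassoc_of% h i, zero_comp]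
  obtain ⟨i, hi⟩ := this
  have := hT i
  have := isIso_of_hom_simple hi
  exact ⟨p i ≫ inv (f ≫ p i), by rw [← Category.assoc, IsIso.hom_inv_id]⟩

/-- Some summand of a decomposition gives a nonzero idempotent, which must be the identity because
all endomorphisms are scalars. This criterion transports simplicity to duals, where only dimensions
of morphism spaces are compared. -/
theorem simple_of_finrank_end_eq_one {W : A} (h : Module.finrank k (W ⟶ W) = 1) : Simple W := by
  have hne : 𝟙 W ≠ 0 := by
    intro h0
    have : Subsingleton (W ⟶ W) :=
      ⟨fun f g => by rw [← Category.comp_id f, ← Category.comp_id g, h0, comp_zero, comp_zero]⟩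
    rw [Module.finrank_zero_of_subsingleton] at h
    exact zero_ne_one h
  have hsc := (finrank_eq_one_iff_of_nonzero' (𝟙 W) hne).1 h
  obtain ⟨n, T, p, s, hT, hsp, hid⟩ := exists_simple_decomposition k W
  have : ∃ i, p i ≫ s i ≠ 0 := by
    by_contra! h0
    exact hne (by rw [← hid]; exact Finset.sum_eq_zero fun i _ => h0 i)
  obtain ⟨i, hi⟩ := this
  obtain ⟨c, hc⟩ := hsc (p i ≫ s i)
  have hcc : c • p i = p i := by
    have : (p i ≫ s i) ≫ p i = p i := by rw [Category.assoc, hsp, Category.comp_id]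
    rwa [← hc, Linear.smul_comp, Category.id_comp] at this
  have hid' : p i ≫ s i = 𝟙 W := by
    have h2 : c • (p i ≫ s i) = p i ≫ s i := by rw [← Linear.smul_comp, hcc]
    have h3 : (c - 1) • (p i ≫ s i) = 0 := by rw [sub_smul, h2, one_smul, sub_self]
    rcases smul_eq_zero.1 h3 with h4 | h4
    · rw [← hc, sub_eq_zero.1 h4, one_smul]
    · exact absurd h4 hi
  have := hT i
  exact Simple.of_iso ⟨p i, s i, hid', hsp i⟩

/-- A family of pairwise non-isomorphic simple objects that contains all of them up to
isomorphism. -/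
structure IsSimpleFamily {ι : Type*} (S : ι → A) : Prop where
  simple : ∀ i, Simple (S i)
  hom_eq_zero : ∀ {i j}, i ≠ j → ∀ f : S i ⟶ S j, f = 0
  exists_iso : ∀ X : A, Simple X → ∃ i, Nonempty (X ≅ S i)

omit [MonoidalCategory A] in
theorem isSimpleFamily_rep : IsSimpleFamily (Irr.rep (A := A)) where
  simple i := i.2
  hom_eq_zero {i j} hij f := by
    by_contra h
    have : Simple i.rep := i.2
    have : Simple j.rep := j.2
    apply hij
    apply Subtype.ext
    rw [← Quotient.out_eq i.1, ← Quotient.out_eq j.1]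
    have := isIso_of_hom_simple h
    exact Quotient.sound ⟨@asIso _ _ _ _ f this⟩
  exists_iso X hX := by
    obtain ⟨e⟩ : IsIsomorphic (Quotient.mk (isIsomorphicSetoid A) X).out X :=
      @Quotient.mk_out A (isIsomorphicSetoid A) X
    exact ⟨⟨Quotient.mk _ X, Simple.of_iso e⟩, ⟨e.symm⟩⟩

theorem mem_irrFinset (i : Irr A) : i ∈ irrFinset k A := by
  simp [irrFinset]

variable [IsAlgClosed k]

theorem scalar_smul (f : 𝟙_ A ⟶ 𝟙_ A) : scalar k f • 𝟙 (𝟙_ A) = f := (exists_scalar k f).choose_spec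

theorem smul_id_unit_injective : Function.Injective fun r : k => r • 𝟙 (𝟙_ A) := by
  have : Simple (𝟙_ A) := IsFusion.simple_unit k
  exact smul_left_injective k (id_nonzero (𝟙_ A))

variable [BraidedCategory A] [RigidCategory A] [RibbonCategory A]

theorem trace_smul_id {X : A} (f : X ⟶ X) : trace k f • 𝟙 (𝟙_ A) = closure Xᘁ f :=
  scalar_smul k _

theorem trace_eq_of_closure {X Y : A} {f : X ⟶ X} {g : Y ⟶ Y} (h : closure Xᘁ f = closure Yᘁ g) :
    trace k f = trace k g :=
  smul_id_unit_injective k (A := A) (by simp only [trace_smul_id, h])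

theorem trace_comp_comm {X Y : A} (f : X ⟶ Y) (g : Y ⟶ X) : trace k (f ≫ g) = trace k (g ≫ f) :=
  trace_eq_of_closure k (closure_comm _ _ f g)

theorem trace_closureRight {B X : A} (h : B ⊗ X ⟶ B ⊗ X) :
    trace k (closureRight Xᘁ h) = trace k h :=
  trace_eq_of_closure k (closure_tensor _ _ _ h).symm

theorem trace_closureLeft {X B : A} (h : Xᘁ ⊗ B ⟶ Xᘁ ⊗ B) :
    trace k (closureLeft h) = trace k h :=
  trace_eq_of_closure k (closure_tensor_left _ _ h).symm

theorem trace_id_dual (X : A) : trace k (𝟙 Xᘁ) = trace k (𝟙 X) :=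
  trace_eq_of_closure k (by rw [closure_dual]; simp [closure])

variable [MonoidalPreadditive A] [MonoidalLinear k A]

theorem closure_add {X W : A} [ExactPairing X W] (f g : X ⟶ X) :
    closure W (f + g) = closure W f + closure W g := by
  simp [closure, MonoidalPreadditive.add_whiskerRight]

theorem closure_smul {X W : A} [ExactPairing X W] (r : k) (f : X ⟶ X) :
    closure W (r • f) = r • closure W f := by
  simp [closure, MonoidalLinear.smul_whiskerRight]

/-- The trace as a linear map. -/
def traceLinear (X : A) : (X ⟶ X) →ₗ[k] k where
  toFun := trace k
  map_add' f g := smul_id_unit_injective k (A := A) (by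
    simp only [add_smul, trace_smul_id, closure_add])
  map_smul' r f := smul_id_unit_injective k (A := A) (by
    simp only [RingHom.id_apply, smul_assoc, trace_smul_id, closure_smul])

theorem trace_smul {X : A} (r : k) (f : X ⟶ X) : trace k (r • f) = r * trace k f :=
  (traceLinear k X).map_smul r f

/-- `tensorLeftHomEquiv` as a linear equivalence. -/
def tensorLeftHomLinearEquiv (X Y Y' Z : A) [ExactPairing Y Y'] :
    (Y' ⊗ X ⟶ Z) ≃ₗ[k] (X ⟶ Y ⊗ Z) where
  __ := tensorLeftHomEquiv X Y Y' Z
  map_add' f g := by simp [tensorLeftHomEquiv, MonoidalPreadditive.whiskerLeft_add]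
  map_smul' r f := by simp [tensorLeftHomEquiv]

/-- `tensorRightHomEquiv` as a linear equivalence. -/
def tensorRightHomLinearEquiv (X Y Y' Z : A) [ExactPairing Y Y'] :
    (X ⊗ Y ⟶ Z) ≃ₗ[k] (X ⟶ Z ⊗ Y') where
  __ := tensorRightHomEquiv X Y Y' Z
  map_add' f g := by simp [tensorRightHomEquiv, MonoidalPreadditive.add_whiskerRight]
  map_smul' r f := by simp [tensorRightHomEquiv]

/-- The isomorphism of morphism spaces given by an isomorphism of the sources. -/
def homCongrLeft {X X' : A} (e : X ≅ X') (Z : A) : (X ⟶ Z) ≃ₗ[k] (X' ⟶ Z) where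
  toFun f := e.inv ≫ f
  invFun f := e.hom ≫ f
  left_inv f := by simp
  right_inv f := by simp
  map_add' f g := by simp
  map_smul' r f := by simp

theorem finrank_hom_dual (X Y X' Y' : A) [ExactPairing X X'] [ExactPairing Y Y'] :
    Module.finrank k (X' ⟶ Y') = Module.finrank k (Y ⟶ X) := by
  have e1 := (homCongrLeft k (ρ_ X').symm Y').finrank_eq
  have e2 := (tensorLeftHomLinearEquiv k (𝟙_ A) X X' Y').finrank_eq
  have e3 := (tensorRightHomLinearEquiv k (𝟙_ A) Y Y' X).finrank_eq
  have e4 := (homCongrLeft k (λ_ Y) X).finrank_eq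
  rw [e1, e2, ← e3, e4]

include k in
-- Dualizing preserves dimensions of morphism spaces, which decide simplicity and orthogonality; the
-- family is exhaustive because every `X` is the dual of `ᘁX`.
theorem isSimpleFamily_rep_dual : IsSimpleFamily fun i : Irr A => (i.rep)ᘁ where
  simple i := by
    have : Simple i.rep := i.2
    apply simple_of_finrank_end_eq_one k
    rw [finrank_hom_dual k i.rep i.rep]
    exact finrank_endomorphism_simple_eq_one k _
  hom_eq_zero {i j} hij f := by
    have h : Module.finrank k ((i.rep)ᘁ ⟶ (j.rep)ᘁ) = 0 := by
      rw [finrank_hom_dual k i.rep j.rep]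
      have : Subsingleton (j.rep ⟶ i.rep) :=
        ⟨fun f g => by rw [isSimpleFamily_rep.hom_eq_zero hij.symm f,
          isSimpleFamily_rep.hom_eq_zero hij.symm g]⟩
      exact Module.finrank_zero_of_subsingleton
    have := Module.finrank_zero_iff.1 h
    exact Subsingleton.elim _ _
  exists_iso X hX := by
    have hX' : Simple (ᘁX : A) := by
      apply simple_of_finrank_end_eq_one k
      rw [← finrank_hom_dual k (ᘁX : A) (ᘁX : A) X X]
      exact finrank_endomorphism_simple_eq_one k X
    obtain ⟨i, ⟨e⟩⟩ := isSimpleFamily_rep.exists_iso _ hX'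
    have h1 : Module.finrank k (i.rep ⟶ (ᘁX : A)) ≠ 0 := by
      intro h
      have := Module.finrank_zero_iff.1 h
      have h0 : e.inv = 0 := Subsingleton.elim _ _
      apply id_nonzero (ᘁX : A)
      rw [← e.hom_inv_id, h0, comp_zero]
    rw [← finrank_hom_dual k (ᘁX : A) i.rep X (i.rep)ᘁ] at h1
    have h2 : ∃ f : X ⟶ (i.rep)ᘁ, f ≠ 0 := by
      by_contra! h
      have : Subsingleton (X ⟶ (i.rep)ᘁ) := ⟨fun f g => by rw [h f, h g]⟩
      exact h1 Module.finrank_zero_of_subsingleton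
    obtain ⟨f, hf⟩ := h2
    have : Simple (i.rep)ᘁ := by
      have : Simple i.rep := i.2
      apply simple_of_finrank_end_eq_one k
      rw [finrank_hom_dual k i.rep i.rep]
      exact finrank_endomorphism_simple_eq_one k _
    have := isIso_of_hom_simple hf
    exact ⟨i, ⟨asIso f⟩⟩

/-- The coevaluation splits because the unit is simple, and its retraction is a multiple of
`evRight` because morphisms `X ⊗ Xᘁ ⟶ 𝟙_` form a line. So `evRight` cannot annihilate the
coevaluation. -/
theorem trace_id_ne_zero (X : A) [Simple X] : trace k (𝟙 X) ≠ 0 := by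
  intro h0
  have : Simple (𝟙_ A) := IsFusion.simple_unit k
  have hη : η_ X Xᘁ ≠ 0 := by
    intro h
    have := ExactPairing.evaluation_coevaluation X Xᘁ
    rw [h, MonoidalPreadditive.zero_whiskerRight, zero_comp] at this
    have h2 : (λ_ X).inv ≫ (0 : 𝟙_ A ⊗ X ⟶ X ⊗ 𝟙_ A) ≫ (ρ_ X).hom = 𝟙 X := by rw [this]; simp
    rw [zero_comp, comp_zero] at h2
    exact id_nonzero X h2.symm
  have hev : evRight X ≠ 0 := by
    intro h
    have hε : ε_ X Xᘁ = 0 := by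
      have : (β_ X Xᘁ).inv ≫ (RibbonCategory.twist X).inv ▷ Xᘁ ≫ evRight X = ε_ X Xᘁ := by
        simp [evRight]
      rw [← this, h, comp_zero, comp_zero]
    have := ExactPairing.evaluation_coevaluation X Xᘁ
    rw [hε, MonoidalPreadditive.whiskerLeft_zero, comp_zero, comp_zero] at this
    have h2 : (λ_ X).inv ≫ (0 : 𝟙_ A ⊗ X ⟶ X ⊗ 𝟙_ A) ≫ (ρ_ X).hom = 𝟙 X := by rw [this]; simp
    rw [zero_comp, comp_zero] at h2
    exact id_nonzero X h2.symm
  obtain ⟨r, hr⟩ := exists_retraction k hη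
  let _ := BraidedCategory.exactPairing_swap X Xᘁ
  have h1 : Module.finrank k (X ⊗ Xᘁ ⟶ 𝟙_ A) = 1 := by
    rw [(tensorRightHomLinearEquiv k X Xᘁ X (𝟙_ A)).finrank_eq,
      (⟨⟨⟨fun f => f ≫ (λ_ X).hom, fun f g => by simp⟩, fun r f => by simp⟩,
        fun f => f ≫ (λ_ X).inv, fun f => by simp, fun f => by simp⟩ :
        (X ⟶ 𝟙_ A ⊗ X) ≃ₗ[k] (X ⟶ X)).finrank_eq]
    exact finrank_endomorphism_simple_eq_one k X
  obtain ⟨c, hc⟩ := (finrank_eq_one_iff_of_nonzero' (evRight X) hev).1 h1 r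
  have h2 : η_ X Xᘁ ≫ evRight X = 0 := by
    have := trace_smul_id k (𝟙 X)
    rw [h0, zero_smul] at this
    have h3 : closure Xᘁ (𝟙 X) = η_ X Xᘁ ≫ evRight X := by
      simp [closure, rightEv, evRight]
    rw [← h3, ← this]
  rw [← hc, Linear.comp_smul, h2, smul_zero] at hr
  exact id_nonzero _ hr.symm

/-- On some simple summand of `B` the morphism `φ` is nonzero, hence split; with the retraction as
`ψ`, the trace is the dimension of that summand. -/
theorem exists_trace_ne_zero {B W : A} {φ : B ⟶ W} (hφ : φ ≠ 0) :
    ∃ ψ : W ⟶ B, trace k (φ ≫ ψ) ≠ 0 := by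
  obtain ⟨n, T, p, s, hT, -, hid⟩ := exists_simple_decomposition k B
  have : ∃ i, s i ≫ φ ≠ 0 := by
    by_contra! h
    apply hφ
    rw [← Category.id_comp φ, ← hid, Preadditive.sum_comp]
    exact Finset.sum_eq_zero fun i _ => by rw [Category.assoc, h i, comp_zero]
  obtain ⟨i, hi⟩ := this
  have := hT i
  obtain ⟨r, hr⟩ := exists_retraction k hi
  refine ⟨r ≫ s i, ?_⟩
  rw [← Category.assoc, trace_comp_comm, ← Category.assoc, hr]
  exact trace_id_ne_zero k (T i)

/-- The trace pairing. -/
def tracePairing (B W : A) : (B ⟶ W) →ₗ[k] (W ⟶ B) →ₗ[k] k :=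
  LinearMap.mk₂ k (fun φ ψ => traceLinear k B (φ ≫ ψ)) (by simp) (by simp) (by simp) (by simp)

theorem tracePairing_apply {B W : A} (φ : B ⟶ W) (ψ : W ⟶ B) :
    tracePairing k B W φ ψ = trace k (φ ≫ ψ) := rfl

theorem tracePairing_injective (B W : A) : Function.Injective (tracePairing k B W) := by
  rw [injective_iff_map_eq_zero]
  intro φ h
  by_contra hφ
  obtain ⟨ψ, hψ⟩ := exists_trace_ne_zero k hφ
  exact hψ (by rw [← tracePairing_apply, h]; rfl)

theorem tracePairing_flip_injective (B W : A) :
    Function.Injective (tracePairing k B W).flip := by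
  have : (tracePairing k B W).flip = tracePairing k W B := by
    ext ψ φ
    exact trace_comp_comm k φ ψ
  rw [this]
  exact tracePairing_injective k W B

theorem finrank_hom_comm (B W : A) : Module.finrank k (B ⟶ W) = Module.finrank k (W ⟶ B) := by
  apply le_antisymm
  · have := LinearMap.finrank_le_finrank_of_injective (tracePairing_injective k B W)
    rwa [Subspace.dual_finrank_eq] at this
  · have := LinearMap.finrank_le_finrank_of_injective (tracePairing_flip_injective k B W)
    rwa [Subspace.dual_finrank_eq] at this

/-- The pairing is perfect, so a dual basis exists and the `Classical.epsilon` defining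
`homDualBasis` does pick one. -/
theorem trace_homDualBasis (B W : A) (a b : Fin (Module.finrank k (B ⟶ W))) :
    trace k (homBasis k B W b ≫ homDualBasis k B W a) = if b = a then 1 else 0 := by
  have hs : Function.Surjective (tracePairing k B W).flip := by
    rw [← LinearMap.injective_iff_surjective_of_finrank_eq_finrank]
    · exact tracePairing_flip_injective k B W
    · rw [Subspace.dual_finrank_eq, finrank_hom_comm]
  obtain ⟨ψ, hψ⟩ := hs ((homBasis k B W).coord a)
  have h : ∃ ψ : W ⟶ B, ∀ b, trace k (homBasis k B W b ≫ ψ) = if b = a then 1 else 0 :=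
    ⟨ψ, fun b => by
      have := congrArg (fun l => l (homBasis k B W b)) hψ
      simp only [LinearMap.flip_apply, tracePairing_apply, Module.Basis.coord_apply,
        Module.Basis.repr_self, Finsupp.single_apply] at this
      exact this⟩
  exact Classical.epsilon_spec h b

theorem sum_trace_smul_homBasis {B W : A} (φ : B ⟶ W) :
    ∑ a, trace k (φ ≫ homDualBasis k B W a) • homBasis k B W a = φ := by
  conv_rhs => rw [← (homBasis k B W).sum_repr φ]
  refine Finset.sum_congr rfl fun a _ => ?_
  congr 1
  conv_lhs => rw [← (homBasis k B W).sum_repr φ]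
  change tracePairing k B W _ _ = _
  rw [map_sum, LinearMap.sum_apply]
  simp [tracePairing_apply, trace_homDualBasis]

theorem sum_trace_smul_homDualBasis {B W : A} (ψ : W ⟶ B) :
    ∑ a, trace k (homBasis k B W a ≫ ψ) • homDualBasis k B W a = ψ := by
  apply tracePairing_flip_injective k B W
  apply (homBasis k B W).ext
  intro b
  simp [tracePairing_apply, trace_homDualBasis]

/-- The canonical element of the trace pairing does not depend on the choice of bases. -/
theorem sum_dual_bases_eq {M : Type*} [AddCommGroup M] [Module k M] {B W : A}
    (T : (B ⟶ W) →ₗ[k] (W ⟶ B) →ₗ[k] M) {ι : Type*} (s : Finset ι) (φ : ι → (B ⟶ W))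
    (ψ : ι → (W ⟶ B)) (h : ∀ f : B ⟶ W, ∑ a ∈ s, trace k (f ≫ ψ a) • φ a = f) :
    ∑ a ∈ s, T (φ a) (ψ a) = ∑ a, T (homBasis k B W a) (homDualBasis k B W a) := by
  have h1 : ∀ a, T (φ a) (ψ a) =
      ∑ b, trace k (φ a ≫ homDualBasis k B W b) • T (homBasis k B W b) (ψ a) := fun a => by
    conv_lhs => rw [← sum_trace_smul_homBasis k (φ a)]
    simp
  have h2 : ∀ b, ∑ a ∈ s, trace k (φ a ≫ homDualBasis k B W b) • ψ a = homDualBasis k B W b := by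
    intro b
    apply tracePairing_flip_injective k B W
    ext f
    rw [map_sum, LinearMap.sum_apply]
    simp only [map_smul, LinearMap.smul_apply, LinearMap.flip_apply, tracePairing_apply, smul_eq_mul]
    conv_rhs => rw [← h f, Preadditive.sum_comp]
    change _ = traceLinear k B _
    rw [map_sum]
    refine Finset.sum_congr rfl fun a _ => ?_
    rw [Linear.smul_comp, map_smul, smul_eq_mul, mul_comm]
    rfl
  simp_rw [h1]
  rw [Finset.sum_comm]
  refine Finset.sum_congr rfl fun b _ => ?_
  conv_rhs => rw [← h2 b]
  simp

theorem simple_endo_eq {X : A} [Simple X] (f : X ⟶ X) : trace k (𝟙 X) • f = trace k f • 𝟙 X := by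
  obtain ⟨c, hc⟩ := endomorphism_simple_eq_smul_id k f
  rw [← hc, trace_smul, smul_smul, mul_comm]

/-- By Schur's lemma the right side acts as the identity on every map from a member of the family,
the factor `trace (𝟙 (S i))` normalizing dual bases; and such maps cover `W`. -/
theorem id_eq_sum {ι : Type*} {S : ι → A} (hS : IsSimpleFamily S) (s : Finset ι) (hs : ∀ i, i ∈ s)
    (W : A) : 𝟙 W = ∑ i ∈ s, trace k (𝟙 (S i)) •
      ∑ a, homBasis k W (S i) a ≫ homDualBasis k W (S i) a := by
  have key : ∀ j (t : S j ⟶ W), t ≫ (∑ i ∈ s, trace k (𝟙 (S i)) •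
      ∑ a, homBasis k W (S i) a ≫ homDualBasis k W (S i) a) = t := by
    intro j t
    rw [Preadditive.comp_sum, Finset.sum_eq_single j]
    · have := hS.simple j
      conv_rhs => rw [← sum_trace_smul_homDualBasis k t]
      rw [Linear.comp_smul, Preadditive.comp_sum, Finset.smul_sum]
      refine Finset.sum_congr rfl fun a _ => ?_
      rw [← Category.assoc, ← Linear.smul_comp, simple_endo_eq, trace_comp_comm, Linear.smul_comp,
        Category.id_comp]
    · intro i _ hij
      rw [Linear.comp_smul, Preadditive.comp_sum, Finset.sum_eq_zero, smul_zero]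
      intro a _
      rw [← Category.assoc, hS.hom_eq_zero hij.symm (t ≫ _), zero_comp]
    · exact fun h => absurd (hs j) h
  obtain ⟨n, T, p, t, hT, -, hid⟩ := exists_simple_decomposition k W
  conv_rhs => rw [← Category.id_comp (∑ i ∈ s, _)]
  conv_lhs => rw [← hid]
  rw [← hid, Preadditive.sum_comp]
  refine Finset.sum_congr rfl fun l _ => ?_
  obtain ⟨j, ⟨e⟩⟩ := hS.exists_iso (T l) (hT l)
  rw [Category.assoc]
  congr 1
  have := key j (e.inv ≫ t l)
  rw [Category.assoc, cancel_epi] at this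
  exact this.symm

end Semisimple

/-! ### Nonvanishing of the global dimension -/

section Dimensions

variable (k : Type w) [Field k] [IsAlgClosed k] {A : Type u} [Category.{v} A] [Abelian A]
  [Linear k A] [MonoidalCategory A] [MonoidalPreadditive A] [MonoidalLinear k A]
  [BraidedCategory A] [RigidCategory A] [RibbonCategory A] [IsFusion k A]

theorem trace_id_eq_sum (W : A) : trace k (𝟙 W) =
    ∑ i ∈ irrFinset k A, Module.finrank k (W ⟶ i.rep) * i.dim k := by
  have h := congrArg (traceLinear k W)
    (id_eq_sum k (isSimpleFamily_rep (A := A)) (irrFinset k A) (mem_irrFinset k) W)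
  rw [map_sum] at h
  refine h.trans (Finset.sum_congr rfl fun i _ => ?_)
  rw [map_smul, map_sum, smul_eq_mul, mul_comm]
  congr 1
  have : ∀ a, traceLinear k W (homBasis k W i.rep a ≫ homDualBasis k W i.rep a) = 1 := fun a =>
    (trace_homDualBasis k W i.rep a a).trans (if_pos rfl)
  simp [this]

theorem trace_id_tensor (B X : A) : trace k (𝟙 (B ⊗ X)) = trace k (𝟙 B) * trace k (𝟙 X) := by
  rw [← trace_closureRight, mul_comm, ← trace_smul]
  congr 1
  have h : η_ X Xᘁ ≫ rightEv X Xᘁ = trace k (𝟙 X) • 𝟙 _ := by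
    rw [trace_smul_id]; simp [closure]
  unfold closureRight
  rw [id_whiskerRight, Category.id_comp, Iso.inv_hom_id_assoc,
    ← MonoidalCategory.whiskerLeft_comp_assoc, h]
  simp

/-- The dimension vector is an eigenvector, with eigenvalue `𝒟`, of the integer matrix `M j l = ∑ N
i j m * N i l m` built from fusion multiplicities. If `𝒟` vanished, `M` would be singular over `k`,
hence over `ℤ` as the characteristic is `0`, hence over `ℝ`. But over `ℝ` it is a sum of Gram
matrices, and the summand of the unit object is the identity matrix. No positivity of the dimensions
themselves is used. -/
theorem globalDim_ne_zero [CharZero k] : globalDim k A ≠ 0 := by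
  intro hD
  have : Finite (Irr A) := IsFusion.finite_irr k
  let _ : Fintype (Irr A) := Fintype.ofFinite _
  classical
  have huniv : irrFinset k A = Finset.univ := by ext; simp [mem_irrFinset]
  have hsimple : ∀ i : Irr A, Simple i.rep := fun i => i.2
  let N (i j m : Irr A) : ℕ := Module.finrank k (i.rep ⊗ j.rep ⟶ m.rep)
  have h1 : ∀ i j, i.dim k * j.dim k = ∑ m, (N i j m : k) * m.dim k := fun i j => by
    rw [← huniv, ← trace_id_eq_sum, trace_id_tensor]; rfl
  -- The transposed eigenvector equation: decompose `(i.rep)ᘁ ⊗ j.rep`, move the dual to the other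
  -- side, and use that dual objects have equal dimension.
  have h2 : ∀ i j, i.dim k * j.dim k = ∑ m, (N i m j : k) * m.dim k := fun i j => by
    have h := trace_id_eq_sum k ((i.rep)ᘁ ⊗ j.rep)
    rw [trace_id_tensor, trace_id_dual, huniv] at h
    refine h.trans (Finset.sum_congr rfl fun m _ => ?_)
    rw [(tensorLeftHomLinearEquiv k j.rep i.rep (i.rep)ᘁ m.rep).finrank_eq, finrank_hom_comm]
  obtain ⟨M, hMdef⟩ : ∃ M : Matrix (Irr A) (Irr A) ℤ,
      ∀ j l, M j l = ∑ i, ∑ m, (N i j m : ℤ) * N i l m :=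
    ⟨Matrix.of fun j l => ∑ i, ∑ m, (N i j m : ℤ) * N i l m, fun _ _ => rfl⟩
  have hM : (M.map (Int.cast : ℤ → k)).mulVec (fun i => i.dim k) = 0 := by
    ext j
    have : ∑ l, (∑ i, ∑ m, (N i j m : k) * N i l m) * l.dim k =
        (∑ i : Irr A, i.dim k ^ 2) * j.dim k := by
      simp_rw [Finset.sum_mul]
      rw [Finset.sum_comm]
      refine Finset.sum_congr rfl fun i _ => ?_
      rw [Finset.sum_comm, sq, mul_assoc, h1 i j, Finset.mul_sum]
      refine Finset.sum_congr rfl fun m _ => ?_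
      rw [mul_left_comm, h2 i m, Finset.mul_sum]
      exact Finset.sum_congr rfl fun l _ => by ring
    simp only [Matrix.mulVec, dotProduct, Matrix.map_apply, Pi.zero_apply, hMdef]
    push_cast
    rw [this, ← huniv]
    exact (congrArg (· * j.dim k) hD).trans (zero_mul _)
  have hunit : Simple (𝟙_ A) := IsFusion.simple_unit k
  obtain ⟨o, ⟨e⟩⟩ := isSimpleFamily_rep.exists_iso (𝟙_ A) hunit
  have hdim : (fun i : Irr A => i.dim k) ≠ 0 := fun h =>
    trace_id_ne_zero k o.rep (congrFun h o)
  have hdet : M.det = 0 := by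
    have h := Matrix.exists_mulVec_eq_zero_iff.1 ⟨_, hdim, hM⟩
    have h' : ((M.det : ℤ) : k) = 0 := by
      rw [← h]
      exact (Int.castRingHom k).map_det M
    exact_mod_cast h'
  have hdetR : (M.map (Int.cast : ℤ → ℝ)).det = 0 := by
    have h := (Int.castRingHom ℝ).map_det M
    rw [hdet, map_zero] at h
    exact h.symm
  obtain ⟨x, hx, hMx⟩ := Matrix.exists_mulVec_eq_zero_iff.2 hdetR
  -- The quadratic form of `M` at the real null vector `x`, written as a sum of squares.
  have hsum : ∑ i, ∑ m, (∑ j, (N i j m : ℝ) * x j) ^ 2 = 0 := by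
    have h : ∑ j, x j * ((M.map (Int.cast : ℤ → ℝ)).mulVec x) j = 0 := by simp [hMx]
    rw [← h]
    simp only [Matrix.mulVec, dotProduct, Matrix.map_apply, hMdef]
    push_cast
    simp_rw [Finset.sum_mul, Finset.mul_sum, sq, Finset.sum_mul_sum]
    calc
      _ = ∑ i, ∑ j, ∑ m, ∑ l, (N i j m : ℝ) * x j * (N i l m * x l) :=
        Finset.sum_congr rfl fun i _ => Finset.sum_comm
      _ = ∑ j, ∑ i, ∑ m, ∑ l, (N i j m : ℝ) * x j * (N i l m * x l) := Finset.sum_comm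
      _ = ∑ j, ∑ i, ∑ l, ∑ m, (N i j m : ℝ) * x j * (N i l m * x l) :=
        Finset.sum_congr rfl fun j _ => Finset.sum_congr rfl fun i _ => Finset.sum_comm
      _ = ∑ j, ∑ l, ∑ i, ∑ m, (N i j m : ℝ) * x j * (N i l m * x l) :=
        Finset.sum_congr rfl fun j _ => Finset.sum_comm
      _ = _ := by
        refine Finset.sum_congr rfl fun j _ => Finset.sum_congr rfl fun l _ =>
          Finset.sum_congr rfl fun i _ => Finset.sum_congr rfl fun m _ => by ring
  apply hx
  ext m
  have hz := (Finset.sum_eq_zero_iff_of_nonneg fun i _ =>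
    Finset.sum_nonneg fun m _ => sq_nonneg _).1 hsum o (Finset.mem_univ o)
  have hz' := (Finset.sum_eq_zero_iff_of_nonneg fun m _ => sq_nonneg _).1 hz m (Finset.mem_univ m)
  -- Fusion with the unit `o` is the identity, so the squares with `i = o` are the squares of the
  -- coordinates of `x`.
  have hN : ∀ j, N o j m = if j = m then 1 else 0 := by
    intro j
    have hiso : N o j m = Module.finrank k (j.rep ⟶ m.rep) :=
      (homCongrLeft k (whiskerRightIso e.symm j.rep ≪≫ λ_ j.rep) m.rep).finrank_eq
    rw [hiso]
    split_ifs with h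
    · subst h
      exact finrank_endomorphism_simple_eq_one k _
    · have : Subsingleton (j.rep ⟶ m.rep) :=
        ⟨fun f g => by rw [isSimpleFamily_rep.hom_eq_zero h f, isSimpleFamily_rep.hom_eq_zero h g]⟩
      exact Module.finrank_zero_of_subsingleton
  simp only [hN] at hz'
  simpa using hz'

end Dimensions

/-- Two half-braidings on `V` such that strands of the first can be pulled over strands of the
second. -/
structure IsCrossingPair {A : Type u} [Category.{v} A] [MonoidalCategory A] [BraidedCategory A]
    {V : A} (x y : ∀ B : A, B ⊗ V ⟶ V ⊗ B) : Prop where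
  left : IsCrossing x
  right : IsCrossing y
  braids : ∀ R P, Braids (x R) (y P)

/-! ### The averaged loop projects to the part where two crossings agree -/

section Average

variable (k : Type w) [Field k] [IsAlgClosed k] {A : Type u} [Category.{v} A] [Abelian A]
  [Linear k A] [MonoidalCategory A]
  [BraidedCategory A] [RigidCategory A] [RibbonCategory A] [IsFusion k A]

theorem isCrossingPair_upper_lower (X Y : ZCenter A) : IsCrossingPair (upper X Y) (lower X Y) where
  left := (isCrossing_overcross _).tens (isCrossing_halfBraiding Y)
  right := (isCrossing_halfBraiding X).tens (isCrossing_undercross _)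
  braids := braids_upper_lower X Y

/-- The endomorphism `Q` for two arbitrary families of crossings of one object. -/
def average {V : A} (x y : ∀ B : A, B ⊗ V ⟶ V ⊗ B) : V ⟶ V :=
  (globalDim k A)⁻¹ • ∑ i ∈ irrFinset k A, i.dim k •
    encl (η_ i.rep (i.rep)ᘁ) (stack (y i.rep) (x (i.rep)ᘁ)) (evRight i.rep)

/-- `reducedHalfBraiding` for two arbitrary families of crossings of one object. -/
def averageCrossing {V : A} (x y : ∀ B : A, B ⊗ V ⟶ V ⊗ B) (B : A) : B ⊗ V ⟶ V ⊗ B :=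
  (globalDim k A)⁻¹ • ∑ i ∈ irrFinset k A, ∑ j ∈ irrFinset k A, (i.dim k * j.dim k) •
    ∑ a, tubeOf x y (homBasis k B (j.rep ⊗ i.repᘁ) a) (homDualBasis k B (j.rep ⊗ i.repᘁ) a)

theorem tube_eq_tubeOf (X Y : ZCenter A) {B B' P R : A} (φ : B ⟶ P ⊗ R) (ψ : P ⊗ R ⟶ B') :
    tube X Y φ ψ = tubeOf (upper X Y) (lower X Y) φ ψ := by
  simp only [tube, tubeOf, stack, Category.assoc]

theorem Q_eq_average (X Y : ZCenter A) : Q k X Y = average k (upper X Y) (lower X Y) := by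
  simp only [Q, loop, tube_eq_tubeOf, average, encl, tubeOf, Category.assoc]

theorem reducedHalfBraiding_eq_averageCrossing (X Y : ZCenter A) (B : A) :
    reducedHalfBraiding k X Y B = averageCrossing k (upper X Y) (lower X Y) B := by
  simp only [reducedHalfBraiding, tube_eq_tubeOf, averageCrossing]

variable [MonoidalPreadditive A] [MonoidalLinear k A]

/-- `tubeOf` as a bilinear map. -/
def tubeOfBilinear {V : A} (x y : ∀ B : A, B ⊗ V ⟶ V ⊗ B) (B B' P R : A) :
    (B ⟶ P ⊗ R) →ₗ[k] (P ⊗ R ⟶ B') →ₗ[k] (B ⊗ V ⟶ V ⊗ B') :=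
  LinearMap.mk₂ k (fun φ ψ => tubeOf x y φ ψ)
    (by simp [tubeOf, MonoidalPreadditive.add_whiskerRight]) (by simp [tubeOf])
    (by simp [tubeOf, MonoidalPreadditive.whiskerLeft_add]) (by simp [tubeOf])

variable {k}
variable {V : A} {x y : ∀ B : A, B ⊗ V ⟶ V ⊗ B}

/-- The two parallel strands `(j.rep)ᘁ` and `B` are fused: the identity of their product is resolved
into duals of simple objects, and one half of each term slides through the tube. By adjunction the
terms become dual bases for `B` and `j.rep ⊗ (i.rep)ᘁ`. -/
theorem sum_tubeOf_left (hx : IsCrossing x) (hy : IsCrossing y) (j : Irr A) (B : A) :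
    tubeOf x y ((λ_ B).inv ≫ η_ j.rep (j.rep)ᘁ ▷ B ≫ (α_ _ _ B).hom)
      ((α_ _ _ B).inv ≫ evRight j.rep ▷ B ≫ (λ_ B).hom) =
    ∑ i ∈ irrFinset k A, i.dim k • ∑ a, tubeOf x y (homBasis k B (j.rep ⊗ i.repᘁ) a)
      (homDualBasis k B (j.rep ⊗ i.repᘁ) a) := by
  set n := (λ_ B).inv ≫ η_ j.rep (j.rep)ᘁ ▷ B ≫ (α_ _ _ B).hom with hn
  set e := (α_ _ _ B).inv ≫ evRight j.rep ▷ B ≫ (λ_ B).hom with he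
  have hid := id_eq_sum k (isSimpleFamily_rep_dual k (A := A)) (irrFinset k A) (mem_irrFinset k)
    ((j.rep)ᘁ ⊗ B)
  have h1 : tubeOf x y n e = tubeOfBilinear k x y B B _ _ n
      (j.rep ◁ 𝟙 ((j.rep)ᘁ ⊗ B) ≫ e) := by
    rw [MonoidalCategory.whiskerLeft_id, Category.id_comp]
    rfl
  rw [h1, hid, CategoryTheory.whiskerLeft_sum, Preadditive.sum_comp, map_sum]
  refine Finset.sum_congr rfl fun i _ => ?_
  rw [MonoidalLinear.whiskerLeft_smul, CategoryTheory.whiskerLeft_sum, Linear.smul_comp,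
    Preadditive.sum_comp, map_smul, map_sum, trace_id_dual]
  congr 1
  have h2 : ∀ a, tubeOfBilinear k x y B B _ _ n (j.rep ◁ (homBasis k ((j.rep)ᘁ ⊗ B) (i.rep)ᘁ a ≫
      homDualBasis k ((j.rep)ᘁ ⊗ B) (i.rep)ᘁ a) ≫ e) =
      tubeOfBilinear k x y B B _ _ (n ≫ j.rep ◁ homBasis k ((j.rep)ᘁ ⊗ B) (i.rep)ᘁ a)
        (j.rep ◁ homDualBasis k ((j.rep)ᘁ ⊗ B) (i.rep)ᘁ a ≫ e) := fun a => by
    change tubeOf _ _ _ _ = tubeOf _ _ _ _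
    rw [← id_tensorHom, ← id_tensorHom, tubeOf_dinatural hx hy, id_tensorHom, id_tensorHom,
      MonoidalCategory.whiskerLeft_comp, Category.assoc]
  simp_rw [h2]
  refine (sum_dual_bases_eq k (tubeOfBilinear k x y B B j.rep (i.rep)ᘁ) Finset.univ _ _ ?_).trans ?_
  · intro f
    obtain ⟨g, rfl⟩ := (tensorLeftHomLinearEquiv k B j.rep (j.rep)ᘁ (i.rep)ᘁ).surjective f
    have hg : tensorLeftHomLinearEquiv k B j.rep (j.rep)ᘁ (i.rep)ᘁ g = n ≫ j.rep ◁ g := by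
      simp [tensorLeftHomLinearEquiv, tensorLeftHomEquiv, hn]
    rw [hg]
    -- Duality of the transported families: the trace on `B` is a partial closure over `(j.rep)ᘁ`,
    -- and partial closure preserves the trace.
    have htr : ∀ a, trace k ((n ≫ j.rep ◁ g) ≫
        j.rep ◁ homDualBasis k ((j.rep)ᘁ ⊗ B) (i.rep)ᘁ a ≫ e) =
        trace k (g ≫ homDualBasis k ((j.rep)ᘁ ⊗ B) (i.rep)ᘁ a) := fun a => by
      rw [← trace_closureLeft]
      congr 1
      simp [closureLeft, hn, he, rightEv, evRight]
    simp_rw [htr, ← Linear.comp_smul]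
    rw [← Preadditive.comp_sum]
    congr 1
    simp_rw [← MonoidalLinear.whiskerLeft_smul]
    rw [← CategoryTheory.whiskerLeft_sum, sum_trace_smul_homBasis]
  · rfl

theorem sum_tubeOf_right (hx : IsCrossing x) (hy : IsCrossing y) (i : Irr A) (B : A) :
    tubeOf x y ((ρ_ B).inv ≫ B ◁ η_ i.rep (i.rep)ᘁ ≫ (α_ B _ _).inv)
      ((α_ B _ _).hom ≫ B ◁ evRight i.rep ≫ (ρ_ B).hom) =
    ∑ j ∈ irrFinset k A, j.dim k • ∑ a, tubeOf x y (homBasis k B (j.rep ⊗ i.repᘁ) a)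
      (homDualBasis k B (j.rep ⊗ i.repᘁ) a) := by
  set n := (ρ_ B).inv ≫ B ◁ η_ i.rep (i.rep)ᘁ ≫ (α_ B _ _).inv with hn
  set e := (α_ B _ _).hom ≫ B ◁ evRight i.rep ≫ (ρ_ B).hom with he
  have hid := id_eq_sum k (isSimpleFamily_rep (A := A)) (irrFinset k A) (mem_irrFinset k)
    (B ⊗ i.rep)
  have h1 : tubeOf x y n e = tubeOfBilinear k x y B B _ _ n
      (𝟙 (B ⊗ i.rep) ▷ (i.rep)ᘁ ≫ e) := by
    rw [id_whiskerRight, Category.id_comp]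
    rfl
  rw [h1, hid, CategoryTheory.sum_whiskerRight, Preadditive.sum_comp, map_sum]
  refine Finset.sum_congr rfl fun j _ => ?_
  rw [MonoidalLinear.smul_whiskerRight, CategoryTheory.sum_whiskerRight, Linear.smul_comp,
    Preadditive.sum_comp, map_smul, map_sum]
  change j.dim k • _ = _
  congr 1
  have h2 : ∀ a, tubeOfBilinear k x y B B _ _ n ((homBasis k (B ⊗ i.rep) j.rep a ≫
      homDualBasis k (B ⊗ i.rep) j.rep a) ▷ (i.rep)ᘁ ≫ e) =
      tubeOfBilinear k x y B B _ _ (n ≫ homBasis k (B ⊗ i.rep) j.rep a ▷ (i.rep)ᘁ)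
        (homDualBasis k (B ⊗ i.rep) j.rep a ▷ (i.rep)ᘁ ≫ e) := fun a => by
    change tubeOf _ _ _ _ = tubeOf _ _ _ _
    rw [← tensorHom_id, ← tensorHom_id, tubeOf_dinatural hx hy, tensorHom_id, tensorHom_id,
      comp_whiskerRight, Category.assoc]
  simp_rw [h2]
  refine (sum_dual_bases_eq k (tubeOfBilinear k x y B B j.rep (i.rep)ᘁ) Finset.univ _ _ ?_).trans ?_
  · intro f
    obtain ⟨g, rfl⟩ := (tensorRightHomLinearEquiv k B i.rep (i.rep)ᘁ j.rep).surjective f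
    have hg : tensorRightHomLinearEquiv k B i.rep (i.rep)ᘁ j.rep g = n ≫ g ▷ (i.rep)ᘁ := by
      simp [tensorRightHomLinearEquiv, tensorRightHomEquiv, hn]
    rw [hg]
    -- The same duality, now with the partial closure over the right factor `i.rep`.
    have htr : ∀ a, trace k ((n ≫ g ▷ (i.rep)ᘁ) ≫
        homDualBasis k (B ⊗ i.rep) j.rep a ▷ (i.rep)ᘁ ≫ e) =
        trace k (g ≫ homDualBasis k (B ⊗ i.rep) j.rep a) := fun a => by
      rw [← trace_closureRight]
      congr 1
      simp [closureRight, hn, he, rightEv, evRight]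
    simp_rw [htr, ← Linear.comp_smul]
    rw [← Preadditive.comp_sum]
    congr 1
    simp_rw [← MonoidalLinear.smul_whiskerRight]
    rw [← CategoryTheory.sum_whiskerRight, sum_trace_smul_homBasis]
  · rfl

/-- Here `B` is absorbed by the arc crossing by `x`, and in `whiskerLeft_average_comp` by the arc
crossing by `y`. The outcome is symmetric in the two colors, so it is the same double sum. -/
theorem comp_average_whiskerRight (hx : IsCrossing x) (hy : IsCrossing y) (B : A) :
    x B ≫ average k x y ▷ B = averageCrossing k x y B := by
  unfold average averageCrossing
  rw [MonoidalLinear.smul_whiskerRight, CategoryTheory.sum_whiskerRight, Linear.comp_smul,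
    Preadditive.comp_sum]
  congr 1
  rw [Finset.sum_comm]
  refine Finset.sum_congr rfl fun j _ => ?_
  rw [MonoidalLinear.smul_whiskerRight, Linear.comp_smul, tubeOf_left_encl hx,
    sum_tubeOf_left (k := k) hx hy, Finset.smul_sum]
  exact Finset.sum_congr rfl fun i _ => by rw [smul_smul, mul_comm]

theorem whiskerLeft_average_comp (hx : IsCrossing x) (hy : IsCrossing y) (B : A) :
    B ◁ average k x y ≫ y B = averageCrossing k x y B := by
  unfold average averageCrossing
  rw [MonoidalLinear.whiskerLeft_smul, CategoryTheory.whiskerLeft_sum, Linear.smul_comp,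
    Preadditive.sum_comp]
  congr 1
  refine Finset.sum_congr rfl fun i _ => ?_
  rw [MonoidalLinear.whiskerLeft_smul, Linear.smul_comp, tubeOf_right_encl hy,
    sum_tubeOf_right (k := k) hx hy, Finset.smul_sum]
  exact Finset.sum_congr rfl fun i _ => by rw [smul_smul]

theorem average_comp {V' : A} {x' y' : ∀ B : A, B ⊗ V' ⟶ V' ⊗ B} {f : V ⟶ V'}
    (hx : Intertwines f x x') (hy : Intertwines f y y') :
    average k x y ≫ f = f ≫ average k x' y' := by
  unfold average
  rw [Linear.smul_comp, Linear.comp_smul, Preadditive.sum_comp, Preadditive.comp_sum]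
  congr 1
  refine Finset.sum_congr rfl fun i _ => ?_
  rw [Linear.smul_comp, Linear.comp_smul, encl_comp (stack_intertwines (hy _) (hx _))]

variable (k) in
-- A strand crossing by `x` can be pulled over both arcs of the loop: over the one with `x` because
-- `x` is a half-braiding, over the one with `y` by assumption.
theorem IsCrossingPair.intertwines_left (h : IsCrossingPair x y) :
    Intertwines (average k x y) x x := fun B => by
  unfold average
  rw [MonoidalLinear.whiskerLeft_smul, CategoryTheory.whiskerLeft_sum, Linear.smul_comp,
    Preadditive.sum_comp, MonoidalLinear.smul_whiskerRight, CategoryTheory.sum_whiskerRight,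
    Linear.comp_smul, Preadditive.comp_sum]
  congr 1
  refine Finset.sum_congr rfl fun i _ => ?_
  rw [MonoidalLinear.whiskerLeft_smul, Linear.smul_comp, MonoidalLinear.smul_whiskerRight,
    Linear.comp_smul, Braids.encl_left ((h.braids _ _).stack_right (h.left.braids _ _))]

variable (k) in
-- The loop followed by `x` is `x` followed by the loop, hence `averageCrossing`, hence the loop
-- followed by `y`.
theorem IsCrossingPair.equalizes_average (h : IsCrossingPair x y) :
    Equalizes (average k x y) x y := fun B => by
  rw [h.intertwines_left k B, comp_average_whiskerRight h.left h.right,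
    whiskerLeft_average_comp h.left h.right]

variable (k) in
theorem encl_crossing_evRight (hx : IsCrossing x) (B : A) :
    encl (η_ B Bᘁ) (x (B ⊗ Bᘁ)) (evRight B) = trace k (𝟙 B) • 𝟙 V := by
  have h : η_ B Bᘁ ≫ evRight B = trace k (𝟙 B) • 𝟙 _ := by
    rw [trace_smul_id]; simp [closure, rightEv, evRight]
  rw [encl_crossing hx, h]
  simp

variable (k) [CharZero k]

theorem inv_globalDim_smul_sum {W : A} (f : V ⟶ W) :
    (globalDim k A)⁻¹ • ∑ i ∈ irrFinset k A, i.dim k • i.dim k • f = f := by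
  simp_rw [smul_smul]
  rw [← Finset.sum_smul, smul_smul]
  simp_rw [← sq]
  change ((globalDim k A)⁻¹ * globalDim k A) • f = f
  rw [inv_mul_cancel₀ (globalDim_ne_zero k), one_smul]

/-- Where the crossings agree, the loop of color `i` contracts to `d_i`, and its weight `d_i / 𝒟`
makes the total `1`. -/
theorem Equalizes.comp_average {W : A} {f : W ⟶ V} (h : Equalizes f x y) (hy : IsCrossing y) :
    f ≫ average k x y = f := by
  conv_rhs => rw [← inv_globalDim_smul_sum k f]
  unfold average
  rw [Linear.comp_smul, Preadditive.comp_sum]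
  congr 1
  refine Finset.sum_congr rfl fun i _ => ?_
  rw [Linear.comp_smul, h.comp_encl hy, encl_crossing_evRight k hy, Linear.comp_smul,
    Category.comp_id]
  rfl

theorem IsCrossingPair.average_idem (h : IsCrossingPair x y) :
    average k x y ≫ average k x y = average k x y :=
  (h.equalizes_average k).comp_average k h.right

theorem average_tens_overcross {X : A} :
    average k (tens (overcross X) x) (tens (overcross X) y) = X ◁ average k x y := by
  unfold average
  rw [MonoidalLinear.whiskerLeft_smul, CategoryTheory.whiskerLeft_sum]
  congr 1
  exact Finset.sum_congr rfl fun i _ => by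
    rw [MonoidalLinear.whiskerLeft_smul, encl_tens_overcross]

theorem average_tens_undercross {Z : A} :
    average k (tens x (undercross Z)) (tens y (undercross Z)) = average k x y ▷ Z := by
  unfold average
  rw [MonoidalLinear.smul_whiskerRight, CategoryTheory.sum_whiskerRight]
  congr 1
  exact Finset.sum_congr rfl fun i _ => by
    rw [MonoidalLinear.smul_whiskerRight, encl_tens_undercross]

end Average

/-! ### Objects and morphisms of the center from families of crossings -/

section CenterObjects

variable {A : Type u} [Category.{v} A] [MonoidalCategory A]

theorem halfBraiding_comm {X Y : A} (b : HalfBraiding X) (b' : HalfBraiding Y) {f : X ⟶ Y} {B : A}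
    (h : B ◁ f ≫ (b'.β B).inv = (b.β B).inv ≫ f ▷ B) :
    f ▷ B ≫ (b'.β B).hom = (b.β B).hom ≫ B ◁ f := by
  rw [← Iso.inv_comp_eq, ← Category.assoc, ← h, Category.assoc, Iso.inv_hom_id, Category.comp_id]

/-- A morphism of the center from a morphism that commutes with the half-braidings. -/
def centerHom {X Y : ZCenter A} (f : (F A).obj X ⟶ (F A).obj Y)
    (hf : Intertwines f (halfBraiding X) (halfBraiding Y)) : X ⟶ Y where
  f := f
  comm B := halfBraiding_comm (Sigma.snd X) (Sigma.snd Y) (hf B)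

theorem intertwines_map {X Y : ZCenter A} (f : X ⟶ Y) :
    Intertwines ((F A).map f) (halfBraiding X) (halfBraiding Y) := fun B => by
  have h := Center.Hom.comm f B
  change B ◁ Center.Hom.f f ≫ ((Sigma.snd Y).β B).inv =
    ((Sigma.snd X).β B).inv ≫ Center.Hom.f f ▷ B
  rw [Iso.comp_inv_eq, Category.assoc, h, Iso.inv_hom_id_assoc]

instance : (F A).Faithful where
  map_injective h := Center.ext _ _ h

/-- An isomorphism of the center from an isomorphism that commutes with the half-braidings. -/
def centerIso {X Y : ZCenter A} (f : (F A).obj X ≅ (F A).obj Y)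
    (hf : Intertwines f.hom (halfBraiding X) (halfBraiding Y)) : X ≅ Y where
  hom := centerHom f.hom hf
  inv := centerHom f.inv fun B => by
    rw [← cancel_epi (B ◁ f.hom), ← MonoidalCategory.whiskerLeft_comp_assoc, f.hom_inv_id,
      reassoc_of% hf B, ← comp_whiskerRight, f.hom_inv_id]
    simp
  hom_inv_id := (F A).map_injective f.hom_inv_id
  inv_hom_id := (F A).map_injective f.inv_hom_id

/-- An object of the center from an invertible half-braiding. -/
def centerObj {V : A} (x : ∀ B : A, B ⊗ V ≅ V ⊗ B) (hx : IsCrossing fun B => (x B).hom) :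
    ZCenter A :=
  ⟨V, { β := fun B => (x B).symm
        monoidal := fun B C => by
          have h : (x (B ⊗ C)).hom = _ := hx.tensor B C
          rw [Iso.symm_hom, ← cancel_epi (x (B ⊗ C)).hom, Iso.hom_inv_id, h]
          simp [stack]
        naturality := fun {B C} f => by
          have h : f ▷ V ≫ (x C).hom = (x B).hom ≫ V ◁ f := hx.naturality f
          rw [Iso.symm_hom, Iso.symm_hom, Iso.comp_inv_eq, Category.assoc, h,
            Iso.inv_hom_id_assoc] }⟩

/-- The half-braiding induced on a retract by an idempotent that commutes with a half-braiding. -/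
theorem IsCrossing.retract {V W : A} {x : ∀ B : A, B ⊗ V ⟶ V ⊗ B} (hx : IsCrossing x)
    {i : W ⟶ V} {e : V ⟶ W} (hie : i ≫ e = 𝟙 W) (h : Intertwines (e ≫ i) x x) :
    IsCrossing fun B => B ◁ i ≫ x B ≫ e ▷ B where
  unit := by
    rw [hx.unit]
    calc
      _ = (λ_ W).hom ≫ (i ≫ e) ≫ (ρ_ W).inv := by monoidal
      _ = _ := by rw [hie, Category.id_comp]
  tensor B C := by
    have h1 : C ◁ i ≫ x C ≫ (e ≫ i) ▷ C = C ◁ i ≫ x C := by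
      rw [← h C, ← MonoidalCategory.whiskerLeft_comp_assoc, reassoc_of% hie]
    rw [hx.tensor]
    unfold stack
    calc
      _ = 𝟙 _ ⊗≫ B ◁ (C ◁ i ≫ x C) ⊗≫ x B ▷ C ⊗≫ e ▷ (B ⊗ C) ⊗≫ 𝟙 _ := by monoidal
      _ = _ := by rw [← h1]; monoidal
  naturality {B C} f := by
    rw [← whisker_exchange_assoc, reassoc_of% hx.naturality f, Category.assoc, Category.assoc,
      whisker_exchange]

/-- An object of the center from a retract of an object with an invertible half-braiding. -/
def centerRetract {V W : A} (x : ∀ B : A, B ⊗ V ≅ V ⊗ B) (hx : IsCrossing fun B => (x B).hom)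
    {i : W ⟶ V} {e : V ⟶ W} (hie : i ≫ e = 𝟙 W)
    (h : Intertwines (e ≫ i) (fun B => (x B).hom) (fun B => (x B).hom)) : ZCenter A :=
  centerObj (V := W)
    (fun B =>
      { hom := B ◁ i ≫ (x B).hom ≫ e ▷ B
        inv := i ▷ B ≫ (x B).inv ≫ B ◁ e
        hom_inv_id := by
          have h1 : (x B).hom ≫ (e ≫ i) ▷ B = B ◁ (e ≫ i) ≫ (x B).hom := (h B).symm
          simp only [Category.assoc]
          rw [← comp_whiskerRight_assoc, reassoc_of% h1, Iso.hom_inv_id_assoc,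
            ← MonoidalCategory.whiskerLeft_comp, ← MonoidalCategory.whiskerLeft_comp,
            Category.assoc, hie, Category.comp_id, hie, MonoidalCategory.whiskerLeft_id]
        inv_hom_id := by
          have h1 : B ◁ (e ≫ i) ≫ (x B).hom = (x B).hom ≫ (e ≫ i) ▷ B := h B
          simp only [Category.assoc]
          rw [← MonoidalCategory.whiskerLeft_comp_assoc, reassoc_of% h1, Iso.inv_hom_id_assoc,
            ← comp_whiskerRight, ← comp_whiskerRight,
            Category.assoc, hie, Category.comp_id, hie, id_whiskerRight] })
    (hx.retract hie h)

end CenterObjects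

/-! ### Images of the projections and functoriality of the reduced tensor product -/

section Images

variable (k : Type w) [Field k] [IsAlgClosed k] (A : Type u) [Category.{v} A] [Abelian A]
  [Linear k A] [MonoidalCategory A] [BraidedCategory A] [RigidCategory A] [RibbonCategory A]
  [IsFusion k A]

/-- A choice of images of the projections `Q_{γ,μ}`, with the induced half-braidings. -/
structure ReducedImages where
  /-- The image of `Q_{γ,μ}`, as an object of the center. -/
  obj : ZCenter A → ZCenter A → ZCenter A
  /-- The inclusion of the image. -/
  incl : ∀ X Y : ZCenter A, (F A).obj (obj X Y) ⟶ (F A).obj X ⊗ (F A).obj Y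
  /-- The projection to the image. -/
  proj : ∀ X Y : ZCenter A, (F A).obj X ⊗ (F A).obj Y ⟶ (F A).obj (obj X Y)
  incl_proj : ∀ X Y, incl X Y ≫ proj X Y = 𝟙 _
  proj_incl : ∀ X Y, proj X Y ≫ incl X Y = Q k X Y
  halfBraiding_eq : ∀ X Y B, halfBraiding (obj X Y) B =
    B ◁ incl X Y ≫ reducedHalfBraiding k X Y B ≫ proj X Y ▷ B

variable {k A}
variable [MonoidalPreadditive A] [MonoidalLinear k A] [CharZero k]

theorem Q_idem (X Y : ZCenter A) : Q k X Y ≫ Q k X Y = Q k X Y := by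
  rw [Q_eq_average]
  exact (isCrossingPair_upper_lower X Y).average_idem k

/-- `upper X Y` as a family of isomorphisms. -/
def upperIso (X Y : ZCenter A) (B : A) :
    B ⊗ ((F A).obj X ⊗ (F A).obj Y) ≅ ((F A).obj X ⊗ (F A).obj Y) ⊗ B :=
  (α_ B ((F A).obj X) ((F A).obj Y)).symm ≪≫ whiskerRightIso (β_ B ((F A).obj X)) ((F A).obj Y) ≪≫
    α_ ((F A).obj X) B ((F A).obj Y) ≪≫ whiskerLeftIso ((F A).obj X) (halfBraidingIso Y B) ≪≫
    (α_ ((F A).obj X) ((F A).obj Y) B).symm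

theorem intertwines_Q_upper (X Y : ZCenter A) : Intertwines (Q k X Y) (upper X Y) (upper X Y) := by
  rw [Q_eq_average]
  exact (isCrossingPair_upper_lower X Y).intertwines_left k

theorem upper_comp_Q (X Y : ZCenter A) (B : A) :
    upper X Y B ≫ Q k X Y ▷ B = reducedHalfBraiding k X Y B := by
  rw [Q_eq_average, reducedHalfBraiding_eq_averageCrossing]
  exact comp_average_whiskerRight (isCrossingPair_upper_lower X Y).left
    (isCrossingPair_upper_lower X Y).right B

/-- An abelian category splits idempotents, and `Q` commutes with `upper`, so the image carries the
retract of that half-braiding. -/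
theorem exists_image (X Y : ZCenter A) :
    ∃ (T : ZCenter A) (i : (F A).obj T ⟶ (F A).obj X ⊗ (F A).obj Y)
      (e : (F A).obj X ⊗ (F A).obj Y ⟶ (F A).obj T), i ≫ e = 𝟙 _ ∧ e ≫ i = Q k X Y ∧
      ∀ B, halfBraiding T B = B ◁ i ≫ reducedHalfBraiding k X Y B ≫ e ▷ B := by
  obtain ⟨W, i, e, h1, h2⟩ := IsIdempotentComplete.idempotents_split _ _ (Q_idem (k := k) X Y)
  have hq : Intertwines (e ≫ i) (fun B => (upperIso X Y B).hom) (fun B => (upperIso X Y B).hom) := by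
    rw [h2]
    exact intertwines_Q_upper X Y
  -- On the image, `upper` and the reduced half-braiding agree, because they differ by a factor `Q`
  -- absorbed by `e`.
  have key : ∀ B, B ◁ i ≫ upper X Y B ≫ e ▷ B =
      B ◁ i ≫ reducedHalfBraiding k X Y B ≫ e ▷ B := fun B => by
    rw [← upper_comp_Q, ← h2, Category.assoc, ← comp_whiskerRight, Category.assoc, h1,
      Category.comp_id]
  exact ⟨centerRetract (upperIso X Y) (isCrossingPair_upper_lower X Y).left h1 hq, i, e, h1, h2, key⟩

theorem nonempty_reducedImages : Nonempty (ReducedImages k A) := by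
  choose T i e h1 h2 h3 using exists_image (k := k) (A := A)
  exact ⟨⟨T, i, e, h1, h2, h3⟩⟩

namespace ReducedImages

variable (T : ReducedImages k A)

theorem incl_Q (X Y : ZCenter A) : T.incl X Y ≫ Q k X Y = T.incl X Y := by
  rw [← T.proj_incl, reassoc_of% T.incl_proj]

theorem Q_proj (X Y : ZCenter A) : Q k X Y ≫ T.proj X Y = T.proj X Y := by
  rw [← T.proj_incl, Category.assoc, T.incl_proj, Category.comp_id]

instance (X Y : ZCenter A) : IsSplitMono (T.incl X Y) := ⟨⟨T.proj X Y, T.incl_proj X Y⟩⟩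

theorem halfBraiding_eq_upper (X Y : ZCenter A) (B : A) :
    halfBraiding (T.obj X Y) B = B ◁ T.incl X Y ≫ upper X Y B ≫ T.proj X Y ▷ B := by
  rw [T.halfBraiding_eq, ← upper_comp_Q, Category.assoc, ← comp_whiskerRight, T.Q_proj]

theorem equalizes_incl (X Y : ZCenter A) : Equalizes (T.incl X Y) (upper X Y) (lower X Y) := fun B => by
  have h := (isCrossingPair_upper_lower X Y).equalizes_average k B
  rw [← Q_eq_average] at h
  rw [← T.incl_Q, MonoidalCategory.whiskerLeft_comp, Category.assoc, h, Category.assoc]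

theorem intertwines_incl_upper (X Y : ZCenter A) :
    Intertwines (T.incl X Y) (halfBraiding (T.obj X Y)) (upper X Y) := fun B => by
  rw [T.halfBraiding_eq_upper, Category.assoc, Category.assoc, ← comp_whiskerRight, T.proj_incl,
    ← intertwines_Q_upper X Y B, ← MonoidalCategory.whiskerLeft_comp_assoc, T.incl_Q]

theorem intertwines_incl_lower (X Y : ZCenter A) :
    Intertwines (T.incl X Y) (halfBraiding (T.obj X Y)) (lower X Y) := fun B => by
  rw [← T.equalizes_incl, T.intertwines_incl_upper]

theorem intertwines_proj_upper (X Y : ZCenter A) :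
    Intertwines (T.proj X Y) (upper X Y) (halfBraiding (T.obj X Y)) := fun B => by
  rw [T.halfBraiding_eq_upper, ← MonoidalCategory.whiskerLeft_comp_assoc, T.proj_incl,
    reassoc_of% intertwines_Q_upper X Y B, ← comp_whiskerRight, T.Q_proj]

theorem Q_comp_tensorHom {X X' Y Y' : ZCenter A} (f : X ⟶ X') (g : Y ⟶ Y') :
    Q k X Y ≫ ((F A).map f ⊗ₘ (F A).map g) = ((F A).map f ⊗ₘ (F A).map g) ≫ Q k X' Y' := by
  rw [Q_eq_average, Q_eq_average]
  exact average_comp ((intertwines_overcross _).tens (intertwines_map g))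
    ((intertwines_map f).tens (intertwines_undercross _))

/-- The reduced tensor product of morphisms. -/
def map {X X' Y Y' : ZCenter A} (f : X ⟶ X') (g : Y ⟶ Y') : T.obj X Y ⟶ T.obj X' Y' :=
  centerHom (T.incl X Y ≫ ((F A).map f ⊗ₘ (F A).map g) ≫ T.proj X' Y')
    ((T.intertwines_incl_upper X Y).comp
      (((intertwines_overcross _).tens (intertwines_map g)).comp (T.intertwines_proj_upper X' Y')))

theorem F_map_map {X X' Y Y' : ZCenter A} (f : X ⟶ X') (g : Y ⟶ Y') :
    (F A).map (T.map f g) = T.incl X Y ≫ ((F A).map f ⊗ₘ (F A).map g) ≫ T.proj X' Y' := rfl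

theorem map_incl {X X' Y Y' : ZCenter A} (f : X ⟶ X') (g : Y ⟶ Y') :
    (F A).map (T.map f g) ≫ T.incl X' Y' = T.incl X Y ≫ ((F A).map f ⊗ₘ (F A).map g) := by
  rw [F_map_map, Category.assoc, Category.assoc, T.proj_incl, ← Q_comp_tensorHom, reassoc_of% T.incl_Q]

theorem hom_ext {W X Y : ZCenter A} {f g : W ⟶ T.obj X Y}
    (h : (F A).map f ≫ T.incl X Y = (F A).map g ≫ T.incl X Y) : f = g :=
  (F A).map_injective ((cancel_mono (T.incl X Y)).1 h)

theorem map_id (X Y : ZCenter A) : T.map (𝟙 X) (𝟙 Y) = 𝟙 _ :=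
  T.hom_ext (by rw [map_incl]; simp)

theorem map_comp {X X' X'' Y Y' Y'' : ZCenter A} (f : X ⟶ X') (f' : X' ⟶ X'') (g : Y ⟶ Y')
    (g' : Y' ⟶ Y'') : T.map (f ≫ f') (g ≫ g') = T.map f g ≫ T.map f' g' :=
  T.hom_ext (by
    rw [map_incl, (F A).map_comp (T.map f g), Category.assoc, map_incl,
      reassoc_of% T.map_incl f g, Functor.map_comp, Functor.map_comp,
      MonoidalCategory.tensorHom_comp_tensorHom])

end ReducedImages

end Images

/-! ### Intertwiners under whiskering, associators and composition -/

section

variable {A : Type u} [Category.{v} A] [MonoidalCategory A]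

theorem Intertwines.whiskerLeft {V W W' : A} (x : ∀ B : A, B ⊗ V ⟶ V ⊗ B)
    {y : ∀ B : A, B ⊗ W ⟶ W ⊗ B} {y' : ∀ B : A, B ⊗ W' ⟶ W' ⊗ B} {g : W ⟶ W'}
    (hg : Intertwines g y y') : Intertwines (V ◁ g) (Premodular.tens x y) (Premodular.tens x y') := by
  have h := (Intertwines.id x).tens hg
  rwa [id_tensorHom] at h

theorem Intertwines.whiskerRight {V V' W : A} {x : ∀ B : A, B ⊗ V ⟶ V ⊗ B}
    {x' : ∀ B : A, B ⊗ V' ⟶ V' ⊗ B} {f : V ⟶ V'} (hf : Intertwines f x x')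
    (y : ∀ B : A, B ⊗ W ⟶ W ⊗ B) :
    Intertwines (f ▷ W) (Premodular.tens x y) (Premodular.tens x' y) := by
  have h := hf.tens (Intertwines.id y)
  rwa [tensorHom_id] at h

theorem intertwines_associator {V₁ V₂ V₃ : A} (x : ∀ B : A, B ⊗ V₁ ⟶ V₁ ⊗ B)
    (y : ∀ B : A, B ⊗ V₂ ⟶ V₂ ⊗ B) (z : ∀ B : A, B ⊗ V₃ ⟶ V₃ ⊗ B) :
    Intertwines (α_ V₁ V₂ V₃).hom (tens (tens x y) z) (tens x (tens y z)) :=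
  fun B => (tens_assoc x y z B).symm

theorem Intertwines.inv {V W : A} {x : ∀ B : A, B ⊗ V ⟶ V ⊗ B} {y : ∀ B : A, B ⊗ W ⟶ W ⊗ B}
    {f : V ≅ W} (hf : Intertwines f.hom x y) : Intertwines f.inv y x := fun B => by
  rw [← cancel_epi (B ◁ f.hom), ← MonoidalCategory.whiskerLeft_comp_assoc, f.hom_inv_id,
    reassoc_of% hf B, ← comp_whiskerRight, f.hom_inv_id]
  simp

theorem Equalizes.of_intertwines {W V V' : A} {f : W ⟶ V} {g : V ⟶ V'}
    {x y : ∀ B : A, B ⊗ V ⟶ V ⊗ B} {x' y' : ∀ B : A, B ⊗ V' ⟶ V' ⊗ B} (h : Equalizes f x y)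
    (hx : Intertwines g x x') (hy : Intertwines g y y') : Equalizes (f ≫ g) x' y' := fun B => by
  rw [MonoidalCategory.whiskerLeft_comp, Category.assoc, Category.assoc, hx B, hy B,
    reassoc_of% h B]

end

section

variable {A : Type u} [Category.{v} A] [MonoidalCategory A]

instance (X : A) {Y Z : A} (f : Y ⟶ Z) [IsSplitMono f] : IsSplitMono (X ◁ f) :=
  ⟨⟨X ◁ retraction f, by
    rw [← MonoidalCategory.whiskerLeft_comp, IsSplitMono.id, MonoidalCategory.whiskerLeft_id]⟩⟩

instance (X : A) {Y Z : A} (f : Y ⟶ Z) [IsSplitMono f] : IsSplitMono (f ▷ X) :=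
  ⟨⟨retraction f ▷ X, by rw [← comp_whiskerRight, IsSplitMono.id, id_whiskerRight]⟩⟩

variable [BraidedCategory A]

theorem tens_overcross (V W : A) : overcross (V ⊗ W) = tens (overcross V) (overcross W) :=
  funext (overcross_tensor V W)

theorem tens_undercross (V W : A) : undercross (V ⊗ W) = tens (undercross V) (undercross W) :=
  funext (undercross_tensor V W)

end

/-! ### The associator and the pentagon -/

namespace ReducedImages

variable {k : Type w} [Field k] [IsAlgClosed k] {A : Type u} [Category.{v} A] [Abelian A]
  [Linear k A] [MonoidalCategory A] [BraidedCategory A] [RigidCategory A] [RibbonCategory A]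
  [IsFusion k A] [MonoidalPreadditive A] [MonoidalLinear k A] [CharZero k] (T : ReducedImages k A)
  (X Y Z : ZCenter A)

/-- The inclusion of `(X ⊗̄ Y) ⊗̄ Z` in `X ⊗ (Y ⊗ Z)`. -/
def inclLeft : (F A).obj (T.obj (T.obj X Y) Z) ⟶ (F A).obj X ⊗ (F A).obj Y ⊗ (F A).obj Z :=
  T.incl (T.obj X Y) Z ≫ T.incl X Y ▷ (F A).obj Z ≫ (α_ _ _ _).hom

/-- The inclusion of `X ⊗̄ (Y ⊗̄ Z)` in `(X ⊗ Y) ⊗ Z`. -/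
def inclRight : (F A).obj (T.obj X (T.obj Y Z)) ⟶ ((F A).obj X ⊗ (F A).obj Y) ⊗ (F A).obj Z :=
  T.incl X (T.obj Y Z) ≫ (F A).obj X ◁ T.incl Y Z ≫ (α_ _ _ _).inv

/-- The projection of `(X ⊗ Y) ⊗ Z` to `(X ⊗̄ Y) ⊗̄ Z`. -/
def projLeft : ((F A).obj X ⊗ (F A).obj Y) ⊗ (F A).obj Z ⟶ (F A).obj (T.obj (T.obj X Y) Z) :=
  T.proj X Y ▷ (F A).obj Z ≫ T.proj (T.obj X Y) Z

/-- The projection of `X ⊗ (Y ⊗ Z)` to `X ⊗̄ (Y ⊗̄ Z)`. -/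
def projRight : (F A).obj X ⊗ (F A).obj Y ⊗ (F A).obj Z ⟶ (F A).obj (T.obj X (T.obj Y Z)) :=
  (F A).obj X ◁ T.proj Y Z ≫ T.proj X (T.obj Y Z)

instance : Mono (T.inclLeft X Y Z) := by
  unfold inclLeft
  infer_instance

instance : Mono (T.inclRight X Y Z) := by
  unfold inclRight
  infer_instance

/-- On the left bracketing three crossings of `X ⊗ Y ⊗ Z` agree: those using the half-braiding of
`X`, of `Y` or of `Z`, with overcrossings before it and undercrossings after it. This subobject is
therefore fixed by the projections that define the right bracketing. -/
theorem inclLeft_projRight_inclRight :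
    T.inclLeft X Y Z ≫ T.projRight X Y Z ≫ T.inclRight X Y Z ≫ (α_ _ _ _).hom =
      T.inclLeft X Y Z := by
  -- `hd`, `hb` and `ha` compare with the crossings that use the half-braiding of `Z`, `Y` and `X`;
  -- the last two both start from `lower (T.obj X Y) Z`, because the half-braiding of the image is
  -- both `upper X Y` and `lower X Y`.
  have hd : Intertwines (T.incl X Y ▷ (F A).obj Z ≫ (α_ _ _ _).hom) (upper (T.obj X Y) Z)
      (tens (overcross _) (upper Y Z)) := by
    refine Intertwines.comp ?_ (intertwines_associator _ _ _)
    change Intertwines _ _ (tens (tens (overcross _) (overcross _)) _)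
    rw [← tens_overcross]
    exact (intertwines_overcross _).whiskerRight _
  have hb : Intertwines (T.incl X Y ▷ (F A).obj Z ≫ (α_ _ _ _).hom) (lower (T.obj X Y) Z)
      (tens (overcross _) (lower Y Z)) :=
    ((T.intertwines_incl_upper X Y).whiskerRight _).comp (intertwines_associator _ _ _)
  have ha : Intertwines (T.incl X Y ▷ (F A).obj Z ≫ (α_ _ _ _).hom) (lower (T.obj X Y) Z)
      (tens (halfBraiding X) (undercross _)) := by
    rw [tens_undercross]
    exact ((T.intertwines_incl_lower X Y).whiskerRight _).comp (intertwines_associator _ _ _)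
  have h1 : T.inclLeft X Y Z ≫ (F A).obj X ◁ Q k Y Z = T.inclLeft X Y Z := by
    have h : Equalizes (T.inclLeft X Y Z) _ _ := (T.equalizes_incl (T.obj X Y) Z).of_intertwines hd hb
    rw [Q_eq_average, ← average_tens_overcross]
    exact h.comp_average k ((isCrossing_overcross _).tens (isCrossingPair_upper_lower Y Z).right)
  have h2 : T.inclLeft X Y Z ≫ average k (tens (overcross _) (upper Y Z))
      (tens (halfBraiding X) (undercross _)) = T.inclLeft X Y Z := by
    have h : Equalizes (T.inclLeft X Y Z) _ _ := (T.equalizes_incl (T.obj X Y) Z).of_intertwines hd ha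
    exact h.comp_average k ((isCrossing_halfBraiding _).tens (isCrossing_undercross _))
  -- Transports the outer projection from `Y ⊗̄ Z` to `Y ⊗ Z`, where it compares the half-braidings
  -- of `Z` and `X`.
  have h3 : Q k X (T.obj Y Z) ≫ (F A).obj X ◁ T.incl Y Z = (F A).obj X ◁ T.incl Y Z ≫
      average k (tens (overcross _) (upper Y Z)) (tens (halfBraiding X) (undercross _)) := by
    rw [Q_eq_average]
    exact average_comp ((T.intertwines_incl_upper Y Z).whiskerLeft _)
      ((intertwines_undercross _).whiskerLeft _)
  simp only [projRight, inclRight, Category.assoc, Iso.inv_hom_id, Category.comp_id]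
  rw [reassoc_of% T.proj_incl, h3, ← MonoidalCategory.whiskerLeft_comp_assoc, T.proj_incl,
    reassoc_of% h1, h2]

theorem inclRight_projLeft_inclLeft :
    T.inclRight X Y Z ≫ T.projLeft X Y Z ≫ T.inclLeft X Y Z ≫ (α_ _ _ _).inv =
      T.inclRight X Y Z := by
  have ha : Intertwines ((F A).obj X ◁ T.incl Y Z ≫ (α_ _ _ _).inv) (lower X (T.obj Y Z))
      (tens (lower X Y) (undercross _)) := by
    refine Intertwines.comp ?_ (intertwines_associator _ _ _).inv
    change Intertwines _ _ (tens _ (tens (undercross _) (undercross _)))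
    rw [← tens_undercross]
    exact (intertwines_undercross _).whiskerLeft _
  have hb : Intertwines ((F A).obj X ◁ T.incl Y Z ≫ (α_ _ _ _).inv) (upper X (T.obj Y Z))
      (tens (upper X Y) (undercross _)) :=
    ((T.intertwines_incl_lower Y Z).whiskerLeft _).comp (intertwines_associator _ _ _).inv
  have hd : Intertwines ((F A).obj X ◁ T.incl Y Z ≫ (α_ _ _ _).inv) (upper X (T.obj Y Z))
      (tens (overcross _) (halfBraiding Z)) := by
    rw [tens_overcross]
    exact ((T.intertwines_incl_upper Y Z).whiskerLeft _).comp (intertwines_associator _ _ _).inv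
  have h1 : T.inclRight X Y Z ≫ Q k X Y ▷ (F A).obj Z = T.inclRight X Y Z := by
    have h : Equalizes (T.inclRight X Y Z) _ _ := (T.equalizes_incl X (T.obj Y Z)).of_intertwines hb ha
    rw [Q_eq_average, ← average_tens_undercross]
    exact h.comp_average k ((isCrossingPair_upper_lower X Y).right.tens (isCrossing_undercross _))
  have h2 : T.inclRight X Y Z ≫ average k (tens (overcross _) (halfBraiding Z))
      (tens (lower X Y) (undercross _)) = T.inclRight X Y Z := by
    have h : Equalizes (T.inclRight X Y Z) _ _ := (T.equalizes_incl X (T.obj Y Z)).of_intertwines hd ha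
    exact h.comp_average k ((isCrossingPair_upper_lower X Y).right.tens (isCrossing_undercross _))
  have h3 : Q k (T.obj X Y) Z ≫ T.incl X Y ▷ (F A).obj Z = T.incl X Y ▷ (F A).obj Z ≫
      average k (tens (overcross _) (halfBraiding Z)) (tens (lower X Y) (undercross _)) := by
    rw [Q_eq_average]
    exact average_comp ((intertwines_overcross _).whiskerRight _)
      ((T.intertwines_incl_lower X Y).whiskerRight _)
  simp only [projLeft, inclLeft, Category.assoc, Iso.hom_inv_id, Category.comp_id]
  rw [reassoc_of% T.proj_incl, h3, ← comp_whiskerRight_assoc, T.proj_incl,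
    reassoc_of% h1, h2]

/-- The associativity constraint of the reduced tensor product. -/
def associator : T.obj (T.obj X Y) Z ≅ T.obj X (T.obj Y Z) :=
  centerIso
    { hom := T.inclLeft X Y Z ≫ T.projRight X Y Z
      inv := T.inclRight X Y Z ≫ T.projLeft X Y Z
      hom_inv_id := by
        rw [← cancel_mono (T.inclLeft X Y Z), ← cancel_mono (α_ _ _ _).inv]
        simp only [Category.assoc, Category.id_comp]
        rw [T.inclRight_projLeft_inclLeft]
        simpa using T.inclLeft_projRight_inclRight X Y Z =≫ (α_ _ _ _).inv
      inv_hom_id := by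
        rw [← cancel_mono (T.inclRight X Y Z), ← cancel_mono (α_ _ _ _).hom]
        simp only [Category.assoc, Category.id_comp]
        rw [T.inclLeft_projRight_inclRight]
        simpa using T.inclRight_projLeft_inclLeft X Y Z =≫ (α_ _ _ _).hom }
    (by
      refine ((T.intertwines_incl_upper _ Z).comp (y := upper (T.obj X Y) Z) ?_).comp
        (y := tens (overcross _) (upper Y Z)) ?_
      · refine Intertwines.comp ?_ (intertwines_associator _ _ _)
        change Intertwines _ _ (tens (tens (overcross _) (overcross _)) _)
        rw [← tens_overcross]
        exact (intertwines_overcross _).whiskerRight _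
      · exact ((T.intertwines_proj_upper Y Z).whiskerLeft _).comp (T.intertwines_proj_upper X _))

theorem F_map_associator_hom : (F A).map (T.associator X Y Z).hom =
    T.incl (T.obj X Y) Z ≫ T.incl X Y ▷ (F A).obj Z ≫ (α_ _ _ _).hom ≫
      (F A).obj X ◁ T.proj Y Z ≫ T.proj X (T.obj Y Z) := by
  change T.inclLeft X Y Z ≫ T.projRight X Y Z = _
  simp only [inclLeft, projRight, Category.assoc]

/-- Inside the triple tensor product the associator is that of `A`, with no projection left;
coherence can therefore be checked after the inclusions. -/
theorem associator_hom_incl : (F A).map (T.associator X Y Z).hom ≫ T.incl X (T.obj Y Z) ≫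
    (F A).obj X ◁ T.incl Y Z =
      T.incl (T.obj X Y) Z ≫ T.incl X Y ▷ (F A).obj Z ≫ (α_ _ _ _).hom := by
  have h := T.inclLeft_projRight_inclRight X Y Z
  simp only [inclRight, Category.assoc, Iso.inv_hom_id, Category.comp_id] at h
  change (T.inclLeft X Y Z ≫ T.projRight X Y Z) ≫ _ = _
  rw [Category.assoc, h, inclLeft]

theorem associator_naturality {X X' Y Y' Z Z' : ZCenter A} (f : X ⟶ X') (g : Y ⟶ Y') (h : Z ⟶ Z') :
    T.map (T.map f g) h ≫ (T.associator X' Y' Z').hom =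
      (T.associator X Y Z).hom ≫ T.map f (T.map g h) := by
  apply T.hom_ext
  rw [← cancel_mono ((F A).obj X' ◁ T.incl Y' Z')]
  simp only [Functor.map_comp, Category.assoc]
  rw [T.associator_hom_incl, reassoc_of% T.map_incl (T.map f g) h,
    reassoc_of% T.map_incl f (T.map g h)]
  have h1 : ((F A).map (T.map f g) ⊗ₘ (F A).map h) ≫ T.incl X' Y' ▷ (F A).obj Z' =
      T.incl X Y ▷ (F A).obj Z ≫ (((F A).map f ⊗ₘ (F A).map g) ⊗ₘ (F A).map h) := by
    rw [← tensorHom_id, MonoidalCategory.tensorHom_comp_tensorHom, T.map_incl, ← tensorHom_id,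
      MonoidalCategory.tensorHom_comp_tensorHom, Category.comp_id, Category.id_comp]
  have h2 : ((F A).map f ⊗ₘ (F A).map (T.map g h)) ≫ (F A).obj X' ◁ T.incl Y' Z' =
      (F A).obj X ◁ T.incl Y Z ≫ ((F A).map f ⊗ₘ ((F A).map g ⊗ₘ (F A).map h)) := by
    rw [← id_tensorHom, MonoidalCategory.tensorHom_comp_tensorHom, T.map_incl, ← id_tensorHom,
      MonoidalCategory.tensorHom_comp_tensorHom, Category.comp_id, Category.id_comp]
  rw [reassoc_of% h1, h2, reassoc_of% T.associator_hom_incl, MonoidalCategory.associator_naturality]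

/-- After composing with the inclusion in `W ⊗ X ⊗ Y ⊗ Z`, a monomorphism, both sides reduce to the
pentagon of `A`. -/
theorem pentagon (W X Y Z : ZCenter A) :
    T.map (T.associator W X Y).hom (𝟙 Z) ≫ (T.associator W (T.obj X Y) Z).hom ≫
      T.map (𝟙 W) (T.associator X Y Z).hom =
    (T.associator (T.obj W X) Y Z).hom ≫ (T.associator W X (T.obj Y Z)).hom := by
  apply T.hom_ext
  rw [← cancel_mono ((F A).obj W ◁ (T.incl X (T.obj Y Z) ≫ (F A).obj X ◁ T.incl Y Z))]
  simp only [Functor.map_comp, Category.assoc]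
  rw [reassoc_of% T.map_incl (𝟙 W) (T.associator X Y Z).hom, (F A).map_id, id_tensorHom,
    ← MonoidalCategory.whiskerLeft_comp, T.associator_hom_incl, MonoidalCategory.whiskerLeft_comp,
    reassoc_of% T.associator_hom_incl W (T.obj X Y) Z, MonoidalCategory.whiskerLeft_comp]
  have h1 : (F A).map (T.map (T.associator W X Y).hom (𝟙 Z)) ≫ T.incl (T.obj W (T.obj X Y)) Z ≫
      (T.incl W (T.obj X Y) ≫ (F A).obj W ◁ T.incl X Y) ▷ (F A).obj Z =
      T.incl (T.obj (T.obj W X) Y) Z ≫ (T.incl (T.obj W X) Y ≫ T.incl W X ▷ (F A).obj Y ≫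
        (α_ _ _ _).hom) ▷ (F A).obj Z := by
    rw [reassoc_of% T.map_incl (T.associator W X Y).hom (𝟙 Z), (F A).map_id, tensorHom_id,
      ← comp_whiskerRight, T.associator_hom_incl]
  have h2 : (F A).map (T.associator (T.obj W X) Y Z).hom ≫
      (F A).map (T.associator W X (T.obj Y Z)).hom ≫ T.incl W (T.obj X (T.obj Y Z)) ≫
      (F A).obj W ◁ T.incl X (T.obj Y Z) ≫ (F A).obj W ◁ (F A).obj X ◁ T.incl Y Z =
      (F A).map (T.associator (T.obj W X) Y Z).hom ≫ T.incl (T.obj W X) (T.obj Y Z) ≫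
        (F A).obj (T.obj W X) ◁ T.incl Y Z ≫ T.incl W X ▷ ((F A).obj Y ⊗ (F A).obj Z) ≫
          (α_ _ _ _).hom := by
    rw [reassoc_of% T.associator_hom_incl W X (T.obj Y Z), whisker_exchange_assoc,
      associator_naturality_right]
  rw [MonoidalCategory.whiskerLeft_comp _ (T.incl X (T.obj Y Z)), h2,
    reassoc_of% T.associator_hom_incl (T.obj W X) Y Z]
  have h3 := h1 =≫ ((α_ _ _ _).hom ≫ (F A).obj W ◁ (α_ _ _ _).hom)
  simp only [Category.assoc, comp_whiskerRight] at h3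
  calc
    _ = _ := by
      refine Eq.trans ?_ h3
      rw [associator_naturality_middle_assoc]
    _ = _ := by
      rw [MonoidalCategory.pentagon, associator_naturality_left_assoc]

end ReducedImages

/-! ### Natural families determined by their values on simple objects -/

section Extension

variable (k : Type w) [Field k] [IsAlgClosed k] {A : Type u} [Category.{v} A] [Abelian A]
  [Linear k A] [MonoidalCategory A] [BraidedCategory A] [RigidCategory A] [RibbonCategory A]
  [IsFusion k A] [MonoidalPreadditive A] [MonoidalLinear k A]

/-- The extension to all objects of a family of morphisms indexed by the simple objects. -/
def extend {W : A} (φ : ∀ i : Irr A, i.rep ⊗ W ⟶ i.rep) (C : A) : C ⊗ W ⟶ C :=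
  ∑ i ∈ irrFinset k A, i.dim k • ∑ a, homBasis k C i.rep a ▷ W ≫ φ i ≫ homDualBasis k C i.rep a

theorem id_eq_sum_rep (C : A) : 𝟙 C = ∑ i ∈ irrFinset k A, i.dim k •
    ∑ a, homBasis k C i.rep a ≫ homDualBasis k C i.rep a :=
  id_eq_sum k isSimpleFamily_rep (irrFinset k A) (mem_irrFinset k) C

/-- By Schur's lemma only the summand of `i` meets `t`, and its dual bases reassemble `t`.
Naturality in general follows by resolving the identity of the source. -/
theorem whiskerRight_extend {W : A} (φ : ∀ i : Irr A, i.rep ⊗ W ⟶ i.rep) {C : A} (i : Irr A)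
    (t : i.rep ⟶ C) : t ▷ W ≫ extend k φ C = φ i ≫ t := by
  unfold extend
  rw [Preadditive.comp_sum, Finset.sum_eq_single i]
  · have : Simple i.rep := i.2
    conv_rhs => rw [← sum_trace_smul_homDualBasis k t]
    rw [Linear.comp_smul, Preadditive.comp_sum, Finset.smul_sum, Preadditive.comp_sum]
    refine Finset.sum_congr rfl fun a _ => ?_
    rw [← comp_whiskerRight_assoc, ← Linear.smul_comp, ← MonoidalLinear.smul_whiskerRight]
    have h := simple_endo_eq k (t ≫ homBasis k C i.rep a)
    change i.dim k • _ = _ at h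
    rw [h, MonoidalLinear.smul_whiskerRight, id_whiskerRight, Linear.smul_comp, Category.id_comp,
      Linear.comp_smul, trace_comp_comm]
  · intro j _ hj
    rw [Linear.comp_smul, Preadditive.comp_sum]
    refine smul_eq_zero_of_right _ (Finset.sum_eq_zero fun a _ => ?_)
    rw [← comp_whiskerRight_assoc, isSimpleFamily_rep.hom_eq_zero hj.symm (t ≫ _),
      MonoidalPreadditive.zero_whiskerRight, zero_comp]
  · exact fun h => absurd (mem_irrFinset k i) h

theorem extend_naturality {W : A} (φ : ∀ i : Irr A, i.rep ⊗ W ⟶ i.rep) {C D : A} (f : C ⟶ D) :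
    f ▷ W ≫ extend k φ D = extend k φ C ≫ f := by
  conv_lhs => rw [← Category.id_comp f, id_eq_sum_rep k C]
  rw [Preadditive.sum_comp, CategoryTheory.sum_whiskerRight, Preadditive.sum_comp]
  conv_rhs => rw [extend, Preadditive.sum_comp]
  refine Finset.sum_congr rfl fun i _ => ?_
  rw [Linear.smul_comp, MonoidalLinear.smul_whiskerRight, Linear.smul_comp, Linear.smul_comp,
    Preadditive.sum_comp, CategoryTheory.sum_whiskerRight, Preadditive.sum_comp,
    Preadditive.sum_comp]
  congr 1
  refine Finset.sum_congr rfl fun a _ => ?_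
  rw [Category.assoc, comp_whiskerRight_assoc, whiskerRight_extend]
  simp only [Category.assoc]

theorem extend_rep {W : A} (φ : ∀ i : Irr A, i.rep ⊗ W ⟶ i.rep) (i : Irr A) :
    extend k φ i.rep = φ i := by
  have h := whiskerRight_extend k φ i (𝟙 i.rep)
  rwa [id_whiskerRight, Category.id_comp, Category.comp_id] at h

include k in
theorem natural_family_ext {W B : A} {φ ψ : ∀ C : A, C ⊗ W ⟶ C ⊗ B}
    (hφ : ∀ {C D : A} (f : C ⟶ D), f ▷ W ≫ φ D = φ C ≫ f ▷ B)
    (hψ : ∀ {C D : A} (f : C ⟶ D), f ▷ W ≫ ψ D = ψ C ≫ f ▷ B)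
    (h : ∀ i : Irr A, φ i.rep = ψ i.rep) (C : A) : φ C = ψ C := by
  rw [← Category.comp_id (φ C), ← Category.comp_id (ψ C), ← id_whiskerRight, id_eq_sum_rep k C,
    CategoryTheory.sum_whiskerRight, Preadditive.comp_sum, Preadditive.comp_sum]
  refine Finset.sum_congr rfl fun i _ => ?_
  rw [MonoidalLinear.smul_whiskerRight, Linear.comp_smul, Linear.comp_smul,
    CategoryTheory.sum_whiskerRight, Preadditive.comp_sum, Preadditive.comp_sum]
  congr 1
  refine Finset.sum_congr rfl fun a _ => ?_
  rw [comp_whiskerRight, ← reassoc_of% hφ, ← reassoc_of% hψ, h]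

end Extension

/-! ### The end of `ᘁC ⊗ C` and its universal property -/

section EndObject

variable (k : Type w) [Field k] [IsAlgClosed k] (A : Type u) [Category.{v} A] [Abelian A]
  [Linear k A] [MonoidalCategory A] [BraidedCategory A] [RigidCategory A] [RibbonCategory A]
  [IsFusion k A] [MonoidalPreadditive A] [MonoidalLinear k A]

include k in
theorem hasBiproduct_end : HasBiproduct fun i : Irr A => (ᘁ(i.rep)) ⊗ i.rep := by
  have : Finite (Irr A) := IsFusion.finite_irr k
  have := Abelian.hasFiniteBiproducts (C := A)
  infer_instance

/-- The end of `C ↦ ᘁC ⊗ C`. Morphisms `W ⟶ I` correspond to natural families `C ⊗ W ⟶ C`. -/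
def endObject : A :=
  haveI := hasBiproduct_end k A
  ⨁ fun i : Irr A => (ᘁ(i.rep)) ⊗ i.rep

/-- The projection of the end to one of its components. -/
def endProj (i : Irr A) : endObject k A ⟶ (ᘁ(i.rep)) ⊗ i.rep :=
  haveI := hasBiproduct_end k A
  biproduct.π (fun i : Irr A => (ᘁ(i.rep)) ⊗ i.rep) i

/-- The inclusion of a component in the end. -/
def endIncl (i : Irr A) : (ᘁ(i.rep)) ⊗ i.rep ⟶ endObject k A :=
  haveI := hasBiproduct_end k A
  biproduct.ι (fun i : Irr A => (ᘁ(i.rep)) ⊗ i.rep) i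

theorem endIncl_endProj (i : Irr A) : endIncl k A i ≫ endProj k A i = 𝟙 _ :=
  haveI := hasBiproduct_end k A
  biproduct.ι_π_self _ i

theorem endIncl_endProj_ne {i j : Irr A} (h : i ≠ j) : endIncl k A i ≫ endProj k A j = 0 :=
  haveI := hasBiproduct_end k A
  biproduct.ι_π_ne _ h

theorem sum_endProj_endIncl : ∑ i ∈ irrFinset k A, endProj k A i ≫ endIncl k A i = 𝟙 _ := by
  have := hasBiproduct_end k A
  refine biproduct.hom_ext (f := fun i : Irr A => (ᘁ(i.rep)) ⊗ i.rep) _ _ fun j => ?_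
  change _ ≫ endProj k A j = _ ≫ endProj k A j
  rw [Category.id_comp, Preadditive.sum_comp, Finset.sum_eq_single j]
  · rw [Category.assoc, endIncl_endProj, Category.comp_id]
  · intro i _ hi
    rw [Category.assoc, endIncl_endProj_ne k A hi, comp_zero]
  · exact fun h => absurd (mem_irrFinset k j) h

/-- The component at a simple object of the universal family. -/
def endActionRep (i : Irr A) : i.rep ⊗ endObject k A ⟶ i.rep :=
  i.rep ◁ endProj k A i ≫ (α_ _ _ _).inv ≫ ε_ (ᘁ(i.rep)) i.rep ▷ i.rep ≫ (λ_ _).hom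

/-- The universal natural family `C ⊗ I ⟶ C`. -/
def endAction (C : A) : C ⊗ endObject k A ⟶ C := extend k (endActionRep k A) C

variable {A}

theorem endAction_naturality {C D : A} (f : C ⟶ D) :
    f ▷ endObject k A ≫ endAction k A D = endAction k A C ≫ f :=
  extend_naturality k _ f

/-- The family `C ⊗ W ⟶ C ⊗ B` given by a morphism `W ⟶ I ⊗ B`. -/
def endTest {W B : A} (f : W ⟶ endObject k A ⊗ B) (C : A) : C ⊗ W ⟶ C ⊗ B :=
  C ◁ f ≫ (α_ _ _ _).inv ≫ endAction k A C ▷ B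

theorem endTest_naturality {W B : A} (f : W ⟶ endObject k A ⊗ B) {C D : A} (g : C ⟶ D) :
    g ▷ W ≫ endTest k f D = endTest k f C ≫ g ▷ B := by
  unfold endTest
  calc
    _ = C ◁ f ≫ (α_ _ _ _).inv ≫ (g ▷ endObject k A ≫ endAction k A D) ▷ B := by
      rw [← whisker_exchange_assoc]; monoidal
    _ = _ := by rw [endAction_naturality]; simp

theorem endTest_rep {W B : A} (f : W ⟶ endObject k A ⊗ B) (i : Irr A) :
    endTest k f i.rep = (tensorLeftHomEquiv W (ᘁ(i.rep)) i.rep (i.rep ⊗ B)).symm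
      (f ≫ endProj k A i ▷ B ≫ (α_ _ _ _).hom) := by
  unfold endTest endAction
  rw [extend_rep, tensorLeftHomEquiv]
  simp only [endActionRep, Equiv.coe_fn_symm_mk]
  monoidal

theorem endTest_injective {W B : A} {f g : W ⟶ endObject k A ⊗ B}
    (h : ∀ C, endTest k f C = endTest k g C) : f = g := by
  have h1 : ∀ i, f ≫ endProj k A i ▷ B = g ≫ endProj k A i ▷ B := fun i => by
    have h2 := h i.rep
    rw [endTest_rep, endTest_rep, EmbeddingLike.apply_eq_iff_eq] at h2
    simpa using h2 =≫ (α_ _ _ _).inv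
  rw [← Category.comp_id f, ← Category.comp_id g, ← id_whiskerRight, ← sum_endProj_endIncl,
    CategoryTheory.sum_whiskerRight, Preadditive.comp_sum, Preadditive.comp_sum]
  exact Finset.sum_congr rfl fun i _ => by rw [comp_whiskerRight, reassoc_of% h1]

/-- Existence half of the universal property: the value at each simple object is transposed to a
component of the biproduct. Uniqueness is `endTest_injective`. -/
theorem exists_endTest_eq {W B : A} {ψ : ∀ C : A, C ⊗ W ⟶ C ⊗ B}
    (hψ : ∀ {C D : A} (f : C ⟶ D), f ▷ W ≫ ψ D = ψ C ≫ f ▷ B) :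
    ∃ f : W ⟶ endObject k A ⊗ B, ∀ C, endTest k f C = ψ C := by
  refine ⟨∑ i ∈ irrFinset k A, tensorLeftHomEquiv W (ᘁ(i.rep)) i.rep (i.rep ⊗ B) (ψ i.rep) ≫
    (α_ _ _ _).inv ≫ endIncl k A i ▷ B, natural_family_ext k (endTest_naturality k _) hψ
    fun i => ?_⟩
  rw [endTest_rep, Equiv.symm_apply_eq, Preadditive.sum_comp, Finset.sum_eq_single i]
  · simp only [Category.assoc]
    rw [← comp_whiskerRight_assoc, endIncl_endProj]
    simp
  · intro j _ hj
    simp only [Category.assoc]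
    rw [← comp_whiskerRight_assoc, endIncl_endProj_ne k A hj]
    simp
  · exact fun h => absurd (mem_irrFinset k i) h

end EndObject

/-! ### Rigidity makes crossings invertible -/

section Invertible

variable {A : Type u} [Category.{v} A] [MonoidalCategory A] [RigidCategory A]

/-- Multiplicativity and naturality at the coevaluation of `B` let the crossings by `B` and `Bᘁ`
cancel; a zigzag remains. The other composite uses the evaluation. -/
theorem rotateVar_comp {V : A} {x : ∀ B : A, B ⊗ V ⟶ V ⊗ B} (hx : IsCrossing x) (B : A) :
    rotateVar x B ≫ x B = 𝟙 _ := by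
  have h : η_ B Bᘁ ▷ V ≫ (α_ B Bᘁ V).hom ≫ B ◁ x Bᘁ ≫ (α_ B V Bᘁ).inv ≫ x B ▷ Bᘁ ≫
      (α_ V B Bᘁ).hom = (λ_ V).hom ≫ (ρ_ V).inv ≫ V ◁ η_ B Bᘁ := by
    have h := hx.naturality (η_ B Bᘁ)
    rwa [hx.tensor, hx.unit, Category.assoc] at h
  unfold rotateVar
  calc
    _ = 𝟙 (V ⊗ B) ⊗≫ η_ B Bᘁ ▷ V ▷ B ⊗≫ B ◁ x Bᘁ ▷ B ⊗≫
        ((B ⊗ V) ◁ ε_ B Bᘁ ≫ x B ▷ (𝟙_ A)) ⊗≫ 𝟙 (V ⊗ B) := by monoidal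
    _ = 𝟙 (V ⊗ B) ⊗≫ (η_ B Bᘁ ▷ V ≫ (α_ B Bᘁ V).hom ≫ B ◁ x Bᘁ ≫ (α_ B V Bᘁ).inv ≫ x B ▷ Bᘁ ≫
      (α_ V B Bᘁ).hom) ▷ B ⊗≫ V ◁ B ◁ ε_ B Bᘁ ⊗≫ 𝟙 (V ⊗ B) := by
      rw [whisker_exchange]; monoidal
    _ = 𝟙 (V ⊗ B) ⊗≫ V ◁ (η_ B Bᘁ ▷ B ⊗≫ B ◁ ε_ B Bᘁ) ⊗≫ 𝟙 (V ⊗ B) := by rw [h]; monoidal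
    _ = _ := by rw [ExactPairing.evaluation_coevaluation'']; monoidal

theorem comp_rotateVar {V : A} {x : ∀ B : A, B ⊗ V ⟶ V ⊗ B} (hx : IsCrossing x) (B : A) :
    x B ≫ rotateVar x B = 𝟙 _ := by
  have h : (α_ Bᘁ B V).hom ≫ Bᘁ ◁ x B ≫ (α_ Bᘁ V B).inv ≫ x Bᘁ ▷ B ≫
      (α_ V Bᘁ B).hom ≫ V ◁ ε_ B Bᘁ = ε_ B Bᘁ ▷ V ≫ (λ_ V).hom ≫ (ρ_ V).inv := by
    have h := hx.naturality (ε_ B Bᘁ)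
    rw [hx.tensor, hx.unit] at h
    simpa [stack] using h.symm
  unfold rotateVar
  calc
    _ = 𝟙 (B ⊗ V) ⊗≫ ((𝟙_ A) ◁ x B ≫ η_ B Bᘁ ▷ (V ⊗ B)) ⊗≫ B ◁ x Bᘁ ▷ B ⊗≫
        (B ⊗ V) ◁ ε_ B Bᘁ ⊗≫ 𝟙 (B ⊗ V) := by monoidal
    _ = 𝟙 (B ⊗ V) ⊗≫ η_ B Bᘁ ▷ (B ⊗ V) ⊗≫ B ◁ ((α_ Bᘁ B V).hom ≫ Bᘁ ◁ x B ≫ (α_ Bᘁ V B).inv ≫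
        x Bᘁ ▷ B ≫ (α_ V Bᘁ B).hom ≫ V ◁ ε_ B Bᘁ) ⊗≫ 𝟙 (B ⊗ V) := by
      rw [whisker_exchange]; monoidal
    _ = 𝟙 (B ⊗ V) ⊗≫ (η_ B Bᘁ ▷ B ⊗≫ B ◁ ε_ B Bᘁ) ▷ V ⊗≫ 𝟙 (B ⊗ V) := by rw [h]; monoidal
    _ = _ := by rw [ExactPairing.evaluation_coevaluation'']; monoidal

/-- A half-braiding on an object of a rigid category is invertible. -/
def IsCrossing.toCenter {V : A} {x : ∀ B : A, B ⊗ V ⟶ V ⊗ B} (hx : IsCrossing x) : ZCenter A :=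
  centerObj (fun B => ⟨x B, rotateVar x B, comp_rotateVar hx B, rotateVar_comp hx B⟩) hx

end Invertible

/-! ### The half-braiding of the end -/

section EndCrossing

variable (k : Type w) [Field k] [IsAlgClosed k] (A : Type u) [Category.{v} A] [Abelian A]
  [Linear k A] [MonoidalCategory A] [BraidedCategory A] [RigidCategory A] [RibbonCategory A]
  [IsFusion k A] [MonoidalPreadditive A] [MonoidalLinear k A]

/-- The half-braiding is prescribed by its effect on the universal family: crossing `B` and then
acting on `C` is to act on `C ⊗ B`. -/
theorem exists_endCrossing (B : A) : ∃ f : B ⊗ endObject k A ⟶ endObject k A ⊗ B,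
    ∀ C, endTest k f C = (α_ C B (endObject k A)).inv ≫ endAction k A (C ⊗ B) :=
  exists_endTest_eq k fun {C D} f => by
    rw [Category.assoc, ← endAction_naturality]; simp

/-- The half-braiding of the end. -/
def endCrossing (B : A) : B ⊗ endObject k A ⟶ endObject k A ⊗ B := (exists_endCrossing k A B).choose

theorem endTest_endCrossing (B C : A) : endTest k (endCrossing k A B) C =
    (α_ C B (endObject k A)).inv ≫ endAction k A (C ⊗ B) :=
  (exists_endCrossing k A B).choose_spec C

variable {A}

theorem endTest_comp {W W' B : A} (g : W' ⟶ W) (f : W ⟶ endObject k A ⊗ B) (C : A) :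
    endTest k (g ≫ f) C = C ◁ g ≫ endTest k f C := by
  simp [endTest]

theorem endTest_comp_whiskerLeft {W B B' : A} (f : W ⟶ endObject k A ⊗ B) (g : B ⟶ B') (C : A) :
    endTest k (f ≫ endObject k A ◁ g) C = endTest k f C ≫ C ◁ g := by
  simp only [endTest, Category.assoc]
  rw [← whisker_exchange]
  simp

theorem endTest_whiskerRight {W B D : A} (f : W ⟶ endObject k A ⊗ B) (C : A) :
    endTest k (f ▷ D ≫ (α_ _ _ _).hom) C =
      (α_ _ _ _).inv ≫ endTest k f C ▷ D ≫ (α_ _ _ _).hom := by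
  unfold endTest
  monoidal

theorem isCrossing_endCrossing : IsCrossing (endCrossing k A) where
  unit := endTest_injective k fun C => by
    have h := endAction_naturality k (ρ_ C).hom
    rw [endTest_endCrossing, ← cancel_mono (ρ_ C).hom, Category.assoc, ← h, endTest]
    monoidal
  tensor B D := endTest_injective k fun C => by
    have h := endAction_naturality k (α_ C B D).hom
    have h1 := endTest_endCrossing k A B C
    have h2 := endTest_endCrossing k A D (C ⊗ B)
    rw [endTest_endCrossing, ← cancel_epi (α_ _ _ _).hom, Iso.hom_inv_id_assoc,
      ← cancel_epi ((α_ C B D).hom ▷ _), h]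
    unfold endTest at *
    unfold stack
    symm
    calc
      _ = 𝟙 _ ⊗≫ (C ⊗ B) ◁ endCrossing k A D ⊗≫ (C ◁ endCrossing k A B ≫ (α_ _ _ _).inv ≫
          endAction k A C ▷ B) ▷ D ⊗≫ 𝟙 _ := by monoidal
      _ = 𝟙 _ ⊗≫ ((C ⊗ B) ◁ endCrossing k A D ≫ (α_ _ _ _).inv ≫
          endAction k A (C ⊗ B) ▷ D) ⊗≫ 𝟙 _ := by rw [h1]; monoidal
      _ = _ := by rw [h2]; monoidal
  naturality {B D} f := endTest_injective k fun C => by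
    rw [endTest_comp, endTest_comp_whiskerLeft, endTest_endCrossing, endTest_endCrossing,
      Category.assoc, ← endAction_naturality]
    simp

variable (A) in
/-- The end, as an object of the center. -/
def endCenter : ZCenter A := (isCrossing_endCrossing k (A := A)).toCenter

variable (A) in
/-- The counit of the end. -/
def endCounit : endObject k A ⟶ 𝟙_ A := (λ_ _).inv ≫ endAction k A (𝟙_ A)

theorem comp_endCounit {W B : A} (f : W ⟶ endObject k A ⊗ B) :
    f ≫ endCounit k A ▷ B = (λ_ W).inv ≫ endTest k f (𝟙_ A) := by
  unfold endTest endCounit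
  monoidal

end EndCrossing

/-! ### Commutation of double crossings -/

section UnitObject

variable {A : Type u} [Category.{v} A] [MonoidalCategory A] [BraidedCategory A]

/-- The double crossing of `C` with `Y` commutes with the correction from braiding to half-braiding
on the strand `B`. It is the input for showing that `endSection` equalizes the two crossings. -/
theorem halfBraiding_comm_braiding (Y : ZCenter A) (C B : A) :
    C ◁ (β_ B ((F A).obj Y)).hom ≫ (α_ _ _ _).inv ≫
      (halfBraiding Y C ≫ (β_ ((F A).obj Y) C).hom) ▷ B ≫ (α_ _ _ _).hom ≫
        C ◁ ((β_ B ((F A).obj Y)).inv ≫ halfBraiding Y B) =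
    (α_ _ _ _).inv ≫ halfBraiding Y (C ⊗ B) ≫ (β_ ((F A).obj Y) (C ⊗ B)).hom ≫ (α_ _ _ _).hom ≫
      C ◁ (β_ ((F A).obj Y) B).inv := by
  -- This is `hb_comm` for the reversed braiding, which turns `c` into `c⁻¹`.
  have h : C ◁ ((β_ B ((F A).obj Y)).inv ≫ halfBraiding Y B) ≫ (α_ C _ B).inv ≫
      (halfBraiding Y C ≫ (β_ ((F A).obj Y) C).hom) ▷ B =
    (α_ C _ B).inv ≫ (halfBraiding Y C ≫ (β_ ((F A).obj Y) C).hom) ▷ B ≫ (α_ _ _ _).hom ≫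
      C ◁ ((β_ B ((F A).obj Y)).inv ≫ halfBraiding Y B) ≫ (α_ _ _ _).inv :=
    @hb_comm A _ _ (reverseBraiding A) _ (Sigma.snd Y) C B
  have h' := h =≫ (α_ _ _ _).hom
  simp only [Category.assoc, Iso.inv_hom_id, Category.comp_id] at h'
  rw [← h', (isCrossing_halfBraiding Y).tensor, stack]
  simp

end UnitObject

/-! ### The end is a left unit -/

section LeftUnit

variable (k : Type w) [Field k] [IsAlgClosed k] {A : Type u} [Category.{v} A] [Abelian A]
  [Linear k A] [MonoidalCategory A] [BraidedCategory A] [RigidCategory A] [RibbonCategory A]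
  [IsFusion k A] [MonoidalPreadditive A] [MonoidalLinear k A]

/-- `upper` for the end. -/
def endUpper (Y : ZCenter A) (B : A) :
    B ⊗ (endObject k A ⊗ (F A).obj Y) ⟶ (endObject k A ⊗ (F A).obj Y) ⊗ B :=
  tens (overcross _) (halfBraiding Y) B

/-- `lower` for the end. -/
def endLower (Y : ZCenter A) (B : A) :
    B ⊗ (endObject k A ⊗ (F A).obj Y) ⟶ (endObject k A ⊗ (F A).obj Y) ⊗ B :=
  tens (endCrossing k A) (undercross _) B

theorem endTest_endLower {W : A} (Y : ZCenter A) (f : W ⟶ endObject k A ⊗ (F A).obj Y) (B C : A) :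
    endTest k (B ◁ f ≫ endLower k Y B ≫ (α_ _ _ _).hom) C =
      (α_ _ _ _).inv ≫ endTest k f (C ⊗ B) ≫ (α_ _ _ _).hom ≫ C ◁ (β_ ((F A).obj Y) B).inv := by
  have h := endTest_endCrossing k A B C
  change endTest k (B ◁ f ≫ ((α_ _ _ _).inv ≫ endCrossing k A B ▷ (F A).obj Y ≫ (α_ _ _ _).hom ≫
    endObject k A ◁ (β_ ((F A).obj Y) B).inv ≫ (α_ _ _ _).inv) ≫ (α_ _ _ _).hom) C = _
  have h1 : B ◁ f ≫ ((α_ _ _ _).inv ≫ endCrossing k A B ▷ (F A).obj Y ≫ (α_ _ _ _).hom ≫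
      endObject k A ◁ (β_ ((F A).obj Y) B).inv ≫ (α_ _ _ _).inv) ≫ (α_ _ _ _).hom =
    (B ◁ f ≫ (α_ _ _ _).inv) ≫ (endCrossing k A B ▷ (F A).obj Y ≫ (α_ _ _ _).hom) ≫
      endObject k A ◁ (β_ ((F A).obj Y) B).inv := by simp
  rw [h1, endTest_comp, endTest_comp_whiskerLeft, endTest_whiskerRight, h]
  unfold endTest
  monoidal

/-- The strand `B` is first braided past everything, where naturality frees it from `f`, and then
corrected on `Y` alone. -/
theorem comp_endUpper {W : A} (Y : ZCenter A) (f : W ⟶ endObject k A ⊗ (F A).obj Y) (B : A) :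
    B ◁ f ≫ endUpper k Y B ≫ (α_ _ _ _).hom =
      B ◁ f ≫ (β_ B (endObject k A ⊗ (F A).obj Y)).hom ≫ (α_ _ _ _).hom ≫
        endObject k A ◁ ((β_ B ((F A).obj Y)).inv ≫ halfBraiding Y B) := by
  change B ◁ f ≫ ((α_ _ _ _).inv ≫ (β_ B (endObject k A)).hom ▷ (F A).obj Y ≫ (α_ _ _ _).hom ≫
    endObject k A ◁ halfBraiding Y B ≫ (α_ _ _ _).inv) ≫ (α_ _ _ _).hom = _
  simp

theorem endUpper_counit {W : A} (Y : ZCenter A) (f : W ⟶ endObject k A ⊗ (F A).obj Y) (B : A) :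
    B ◁ f ≫ endUpper k Y B ≫ (α_ _ _ _).hom ≫
      endCounit k A ▷ ((F A).obj Y ⊗ B) ≫ (λ_ _).hom =
    B ◁ (f ≫ endCounit k A ▷ (F A).obj Y ≫ (λ_ _).hom) ≫ halfBraiding Y B := by
  have h := intertwines_overcross (endCounit k A) B
  unfold overcross at h
  change B ◁ f ≫ ((α_ _ _ _).inv ≫ (β_ B (endObject k A)).hom ▷ (F A).obj Y ≫ (α_ _ _ _).hom ≫
    endObject k A ◁ halfBraiding Y B ≫ (α_ _ _ _).inv) ≫ (α_ _ _ _).hom ≫ _ = _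
  calc
    _ = B ◁ f ⊗≫ (β_ B (endObject k A)).hom ▷ (F A).obj Y ⊗≫
        (endObject k A ◁ halfBraiding Y B ≫ endCounit k A ▷ ((F A).obj Y ⊗ B)) ⊗≫
          𝟙 ((F A).obj Y ⊗ B) := by monoidal
    _ = B ◁ f ⊗≫ ((β_ B (endObject k A)).hom ≫ endCounit k A ▷ B) ▷ (F A).obj Y ⊗≫
        halfBraiding Y B ⊗≫ 𝟙 ((F A).obj Y ⊗ B) := by
      rw [whisker_exchange]; monoidal
    _ = _ := by rw [← h, braiding_tensorUnit_right]; monoidal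

variable {k}

/-- Apply the counit to both crossings by `B`. The lower one yields the test of `f` at `B`, since
the counit is the action on the unit object; in the upper one the strand passes over the end and
only the half-braiding of `Y` remains. Hence `f` is determined by its composite with the counit. -/
theorem endTest_eq_of_equalizes {W : A} {Y : ZCenter A} {f : W ⟶ endObject k A ⊗ (F A).obj Y}
    (hf : Equalizes f (endUpper k Y) (endLower k Y)) (B : A) :
    endTest k f B = B ◁ (f ≫ endCounit k A ▷ (F A).obj Y ≫ (λ_ _).hom) ≫ halfBraiding Y B ≫
      (β_ ((F A).obj Y) B).hom := by
  have h := endAction_naturality k (λ_ B).hom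
  have h1 := endTest_endLower k Y f B (𝟙_ A)
  have h2 := hf B
  have h3 := comp_endCounit k (B ◁ f ≫ endLower k Y B ≫ (α_ _ _ _).hom)
  have h4 := endTest_naturality k f (λ_ B).hom
  rw [← cancel_mono (β_ ((F A).obj Y) B).inv]
  simp only [Category.assoc, Iso.hom_inv_id, Category.comp_id]
  refine Eq.trans ?_ (endUpper_counit k Y f B)
  rw [reassoc_of% h2]
  rw [h1] at h3
  simp only [Category.assoc] at h3
  rw [reassoc_of% h3, MonoidalCategory.leftUnitor_naturality]
  have h5 : (λ_ (B ⊗ W)).inv ≫ (α_ (𝟙_ A) B W).inv = (λ_ B).inv ▷ W := by monoidal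
  have h6 : (α_ (𝟙_ A) B ((F A).obj Y)).hom ≫ (λ_ (B ⊗ (F A).obj Y)).hom =
    (λ_ B).hom ▷ (F A).obj Y := by monoidal
  rw [reassoc_of% h5, reassoc_of% h6, ← reassoc_of% h4, ← comp_whiskerRight_assoc]
  simp

variable (k)

/-- The family is dictated by `endTest_eq_of_equalizes` when the composite with the counit is the
identity. -/
theorem exists_endSection (Y : ZCenter A) : ∃ f : (F A).obj Y ⟶ endObject k A ⊗ (F A).obj Y,
    ∀ C, endTest k f C = halfBraiding Y C ≫ (β_ ((F A).obj Y) C).hom :=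
  exists_endTest_eq k fun {C D} f => by
    rw [reassoc_of% (isCrossing_halfBraiding Y).naturality f, BraidedCategory.braiding_naturality_right,
      Category.assoc]

/-- The map `Y ⟶ I ⊗ Y` corresponding to the double crossing of `C` with `Y`. -/
def endSection (Y : ZCenter A) : (F A).obj Y ⟶ endObject k A ⊗ (F A).obj Y :=
  (exists_endSection k Y).choose

theorem endTest_endSection (Y : ZCenter A) (C : A) :
    endTest k (endSection k Y) C = halfBraiding Y C ≫ (β_ ((F A).obj Y) C).hom :=
  (exists_endSection k Y).choose_spec C

theorem endSection_counit (Y : ZCenter A) :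
    endSection k Y ≫ endCounit k A ▷ (F A).obj Y ≫ (λ_ _).hom = 𝟙 _ := by
  rw [← Category.assoc, comp_endCounit, endTest_endSection, (isCrossing_halfBraiding Y).unit]
  simp

theorem equalizes_endSection (Y : ZCenter A) :
    Equalizes (endSection k Y) (endUpper k Y) (endLower k Y) := fun B => by
  have h : B ◁ endSection k Y ≫ endUpper k Y B ≫
      (α_ (endObject k A) ((F A).obj Y) B).hom =
      B ◁ endSection k Y ≫ endLower k Y B ≫
        (α_ (endObject k A) ((F A).obj Y) B).hom := endTest_injective k fun C => by
    have h1 : (β_ B ((F A).obj Y)).hom ≫ (endSection k Y ▷ B ≫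
        (α_ (endObject k A) ((F A).obj Y) B).hom) ≫
        endObject k A ◁ ((β_ B ((F A).obj Y)).inv ≫ halfBraiding Y B) =
        B ◁ endSection k Y ≫ endUpper k Y B ≫ (α_ _ _ _).hom := by
      rw [comp_endUpper, BraidedCategory.braiding_naturality_right_assoc]
      simp
    rw [endTest_endLower, ← h1, endTest_comp, endTest_comp_whiskerLeft, endTest_whiskerRight,
      endTest_endSection, endTest_endSection]
    have h2 := halfBraiding_comm_braiding Y C B
    simp only [Category.assoc] at h2 ⊢
    exact h2
  simpa using h =≫ (α_ (endObject k A) ((F A).obj Y) B).inv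

variable [CharZero k]

/-- `endSection` as a map between objects underlying objects of the center. -/
def centerSection (Y : ZCenter A) : (F A).obj Y ⟶ (F A).obj (endCenter k A) ⊗ (F A).obj Y :=
  endSection k Y

/-- The counit of `endCenter`, tensored with `Y`. -/
def centerCounit (Y : ZCenter A) : (F A).obj (endCenter k A) ⊗ (F A).obj Y ⟶ (F A).obj Y :=
  endCounit k A ▷ (F A).obj Y ≫ (λ_ _).hom

theorem centerSection_counit (Y : ZCenter A) : centerSection k Y ≫ centerCounit k Y = 𝟙 _ :=
  endSection_counit k Y

theorem centerSection_Q (Y : ZCenter A) :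
    centerSection k Y ≫ Q k (endCenter k A) Y = centerSection k Y := by
  rw [Q_eq_average]
  exact (equalizes_endSection k Y).comp_average k (isCrossingPair_upper_lower (endCenter k A) Y).right

theorem intertwines_centerCounit (Y : ZCenter A) :
    Intertwines (centerCounit k Y) (upper (endCenter k A) Y) (halfBraiding Y) := fun B => by
  have h := endUpper_counit k Y (𝟙 _) B
  have h1 : (α_ _ _ _).hom ≫ endCounit k A ▷ ((F A).obj Y ⊗ B) ≫ (λ_ _).hom =
      (endCounit k A ▷ (F A).obj Y ≫ (λ_ _).hom) ▷ B := by monoidal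
  rw [h1, MonoidalCategory.whiskerLeft_id, Category.id_comp, Category.id_comp] at h
  exact h.symm

variable {k} (T : ReducedImages k A)

theorem ReducedImages.incl_centerCounit_centerSection (Y : ZCenter A) :
    T.incl (endCenter k A) Y ≫ centerCounit k Y ≫ centerSection k Y = T.incl (endCenter k A) Y := by
  have h : (T.incl (endCenter k A) Y ≫ endCounit k A ▷ (F A).obj Y ≫ (λ_ _).hom) ≫ endSection k Y =
      T.incl (endCenter k A) Y := endTest_injective k fun C => by
    rw [endTest_comp, endTest_endSection]
    exact (endTest_eq_of_equalizes (T.equalizes_incl (endCenter k A) Y) C).symm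
  rw [Category.assoc] at h
  exact h

/-- The left unit constraint of the reduced tensor product. -/
def ReducedImages.leftUnitor (Y : ZCenter A) : T.obj (endCenter k A) Y ≅ Y :=
  centerIso
    { hom := T.incl (endCenter k A) Y ≫ centerCounit k Y
      inv := centerSection k Y ≫ T.proj (endCenter k A) Y
      hom_inv_id := by
        rw [← cancel_mono (T.incl (endCenter k A) Y)]
        simp only [Category.assoc, Category.id_comp]
        rw [T.proj_incl, centerSection_Q, T.incl_centerCounit_centerSection]
      inv_hom_id := by
        simp only [Category.assoc]
        rw [reassoc_of% T.proj_incl, reassoc_of% centerSection_Q, centerSection_counit] }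
    ((T.intertwines_incl_upper _ Y).comp (intertwines_centerCounit k Y))

theorem ReducedImages.F_map_leftUnitor_hom (Y : ZCenter A) : (F A).map (T.leftUnitor Y).hom =
    T.incl (endCenter k A) Y ≫ centerCounit k Y := rfl

theorem ReducedImages.leftUnitor_naturality {Y Z : ZCenter A} (f : Y ⟶ Z) :
    T.map (𝟙 (endCenter k A)) f ≫ (T.leftUnitor Z).hom = (T.leftUnitor Y).hom ≫ f := by
  apply (F A).map_injective
  rw [Functor.map_comp, Functor.map_comp, F_map_leftUnitor_hom, F_map_leftUnitor_hom,
    reassoc_of% T.map_incl, (F A).map_id, id_tensorHom]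
  simp only [Category.assoc]
  refine congrArg (T.incl (endCenter k A) Y ≫ ·) ?_
  have h : endObject k A ◁ (F A).map f ≫ endCounit k A ▷ _ ≫ (λ_ _).hom =
      (endCounit k A ▷ _ ≫ (λ_ _).hom) ≫ (F A).map f := by
    rw [whisker_exchange_assoc, MonoidalCategory.leftUnitor_naturality, Category.assoc]
  exact h

end LeftUnit

/-! ### Flipped half-braidings and the exchange of upper and lower crossings -/

section Flip

variable {A : Type u} [Category.{v} A] [MonoidalCategory A] [BraidedCategory A]

/-- The conjugate `c⁻¹ h⁻¹ c` of an invertible family of crossings. -/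
def flip {V : A} (h : ∀ B : A, B ⊗ V ≅ V ⊗ B) (B : A) : B ⊗ V ≅ V ⊗ B :=
  β_ B V ≪≫ (h B).symm ≪≫ (β_ V B).symm

theorem Intertwines.flip {V W : A} {x : ∀ B : A, B ⊗ V ≅ V ⊗ B} {y : ∀ B : A, B ⊗ W ≅ W ⊗ B}
    {f : V ⟶ W} (hf : Intertwines f (fun B => (x B).hom) (fun B => (y B).hom)) :
    Intertwines f (fun B => (Premodular.flip x B).hom) (fun B => (Premodular.flip y B).hom) :=
  fun B => by
  have h : B ◁ f ≫ (y B).hom = (x B).hom ≫ f ▷ B := hf B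
  have h1 : f ▷ B ≫ (y B).inv = (x B).inv ≫ B ◁ f := by
    rw [Iso.comp_inv_eq, Category.assoc, h, Iso.inv_hom_id_assoc]
  simp only [Premodular.flip, Iso.trans_hom, Iso.symm_hom, Category.assoc]
  rw [BraidedCategory.braiding_naturality_right_assoc, reassoc_of% h1,
    BraidedCategory.braiding_inv_naturality_right]

theorem flip_reverse_flip {V : A} (h : ∀ B : A, B ⊗ V ≅ V ⊗ B) :
    @flip A _ _ (reverseBraiding A) V (flip h) = h := by
  funext B
  ext
  change (β_ V B).inv ≫ (flip h B).inv ≫ (β_ B V).hom = _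
  simp [flip]

/-- Flipping with the reversed braiding undoes a flip, so both `y` and `y'` become equal, after `f`,
to the same flip of `x`. -/
theorem Equalizes.of_intertwines_flip {V W : A} {x : ∀ B : A, B ⊗ V ≅ V ⊗ B}
    {y y' : ∀ B : A, B ⊗ W ≅ W ⊗ B} {f : V ⟶ W}
    (h : Intertwines f (fun B => (x B).hom) (fun B => (Premodular.flip y B).hom))
    (h' : Intertwines f (fun B => (x B).hom) (fun B => (Premodular.flip y' B).hom)) :
    Equalizes f (fun B => (y B).hom) (fun B => (y' B).hom) := fun B => by
  have h1 := @Intertwines.flip A _ _ (reverseBraiding A) _ _ _ _ _ h B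
  have h2 := @Intertwines.flip A _ _ (reverseBraiding A) _ _ _ _ _ h' B
  rw [flip_reverse_flip] at h1 h2
  exact h1.trans h2.symm

/-- `tens` for invertible families. -/
def tensIso {V W : A} (x : ∀ B : A, B ⊗ V ≅ V ⊗ B) (y : ∀ B : A, B ⊗ W ≅ W ⊗ B) (B : A) :
    B ⊗ (V ⊗ W) ≅ (V ⊗ W) ⊗ B :=
  (α_ B V W).symm ≪≫ whiskerRightIso (x B) W ≪≫ α_ V B W ≪≫ whiskerLeftIso V (y B) ≪≫
    (α_ V W B).symm

/-- Flipping inverts, so it reverses the order of the two crossings. The braiding restores the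
order: by naturality `x⁻¹` slides across `W`, and `y⁻¹` with its inverse braiding slides across `V`.
-/
theorem intertwines_braiding_flip {V W : A} (x : ∀ B : A, B ⊗ V ≅ V ⊗ B)
    (y : ∀ B : A, B ⊗ W ≅ W ⊗ B) :
    Intertwines (β_ W V).hom (fun B => (tensIso (flip y) (flip x) B).hom)
      (fun B => (flip (tensIso x y) B).hom) := fun B => by
  change B ◁ (β_ W V).hom ≫ (flip (tensIso x y) B).hom =
    (tensIso (flip y) (flip x) B).hom ≫ (β_ W V).hom ▷ B
  have h1 := BraidedCategory.braiding_naturality_right W (x B).inv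
  have h2 := BraidedCategory.braiding_naturality_left ((y B).inv ≫ (β_ W B).inv) V
  have h3 := BraidedCategory.braiding_naturality_right B (β_ W V).hom
  have h4 := BraidedCategory.braiding_naturality_left (β_ W V).hom B
  rw [← cancel_mono (β_ (V ⊗ W) B).hom, Category.assoc, Category.assoc, h4]
  have h5 : (flip (tensIso x y) B).hom ≫ (β_ (V ⊗ W) B).hom =
      (β_ B (V ⊗ W)).hom ≫ (tensIso x y B).inv := by simp [flip]
  rw [h5, reassoc_of% h3]
  simp only [flip, tensIso, Iso.trans_hom, Iso.symm_hom, Iso.trans_inv, Iso.symm_inv,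
    whiskerRightIso_inv, whiskerLeftIso_inv, whiskerRightIso_hom, whiskerLeftIso_hom]
  simp only [BraidedCategory.braiding_tensor_left_hom,
    BraidedCategory.braiding_tensor_right_hom] at h1 h2 ⊢
  symm
  calc
    _ = 𝟙 (B ⊗ W ⊗ V) ⊗≫ (β_ B W).hom ▷ V ⊗≫ (y B).inv ▷ V ⊗≫ (β_ W B).inv ▷ V ⊗≫
        W ◁ (β_ B V).hom ⊗≫ W ◁ (x B).inv ⊗≫ W ◁ ((β_ V B).inv ≫ (β_ V B).hom) ⊗≫
        (β_ W B).hom ▷ V ⊗≫ B ◁ (β_ W V).hom ⊗≫ 𝟙 (B ⊗ V ⊗ W) := by monoidal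
    _ = 𝟙 (B ⊗ W ⊗ V) ⊗≫ (β_ B W).hom ▷ V ⊗≫ (y B).inv ▷ V ⊗≫ (β_ W B).inv ▷ V ⊗≫
        W ◁ (β_ B V).hom ⊗≫ (W ◁ (x B).inv ≫ (α_ W B V).inv ≫ (β_ W B).hom ▷ V ≫ (α_ B W V).hom ≫
          B ◁ (β_ W V).hom ≫ (α_ B V W).inv) ⊗≫ 𝟙 (B ⊗ V ⊗ W) := by
      rw [Iso.inv_hom_id]; monoidal
    _ = 𝟙 (B ⊗ W ⊗ V) ⊗≫ (β_ B W).hom ▷ V ⊗≫ (((y B).inv ≫ (β_ W B).inv) ▷ V ≫ (α_ W B V).hom ≫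
        W ◁ (β_ B V).hom ≫ (α_ W V B).inv ≫ (β_ W V).hom ▷ B ≫ (α_ V W B).hom) ⊗≫
          V ◁ (β_ W B).hom ⊗≫ (x B).inv ▷ W ⊗≫ 𝟙 (B ⊗ V ⊗ W) := by
      rw [h1]; monoidal
    _ = 𝟙 (B ⊗ W ⊗ V) ⊗≫ (β_ B W).hom ▷ V ⊗≫ W ◁ (β_ B V).hom ⊗≫ (β_ W V).hom ▷ B ⊗≫
        V ◁ ((y B).inv ≫ (β_ W B).inv ≫ (β_ W B).hom) ⊗≫ (x B).inv ▷ W ⊗≫ 𝟙 (B ⊗ V ⊗ W) := by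
      rw [h2]; monoidal
    _ = _ := by rw [Iso.inv_hom_id]; monoidal

end Flip

/-! ### The braiding as a map between products of flipped objects -/

section

variable {A : Type u} [Category.{v} A] [MonoidalCategory A] [BraidedCategory A] [RigidCategory A]

theorem halfBraiding_U (X : ZCenter A) :
    halfBraiding ((U A).obj X) = fun B => (flip (halfBraidingIso X) B).hom :=
  funext fun B => vee_starDual X B

/-- `lower X Y` as a family of isomorphisms. -/
def lowerIso (X Y : ZCenter A) : ∀ B : A,
    B ⊗ ((F A).obj X ⊗ (F A).obj Y) ≅ ((F A).obj X ⊗ (F A).obj Y) ⊗ B :=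
  tensIso (halfBraidingIso X) fun B => (β_ ((F A).obj Y) B).symm

/-- The braiding `Y ⊗ X ⟶ X ⊗ Y`, seen as a morphism from the objects underlying `U Y`, `U X`. -/
def swap (X Y : ZCenter A) :
    (F A).obj ((U A).obj Y) ⊗ (F A).obj ((U A).obj X) ≅ (F A).obj X ⊗ (F A).obj Y :=
  β_ ((F A).obj Y) ((F A).obj X)

theorem flip_undercross (V : A) : (flip fun B => (β_ V B).symm) = fun B => β_ B V := by
  funext B
  ext
  simp [flip]

theorem flip_overcross (V : A) : (flip fun B => β_ B V) = fun B => (β_ V B).symm := by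
  funext B
  ext
  simp [flip]

/-- The braiding of `Z` with `V`, seen as a morphism from the object underlying `U Z`. -/
def swapLeft (Z : ZCenter A) (V : A) : (F A).obj ((U A).obj Z) ⊗ V ⟶ V ⊗ (F A).obj Z :=
  (β_ ((F A).obj Z) V).hom

/-- The braiding of `V` with `X`, seen as a morphism from the object underlying `U X`. -/
def swapRight (V : A) (X : ZCenter A) : V ⊗ (F A).obj ((U A).obj X) ⟶ (F A).obj X ⊗ V :=
  (β_ V ((F A).obj X)).hom

theorem swap_naturality {X X' Y Y' : ZCenter A} (f : X ⟶ X') (g : Y ⟶ Y') :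
    ((F A).map ((U A).map g) ⊗ₘ (F A).map ((U A).map f)) ≫ (swap X' Y').hom =
      (swap X Y).hom ≫ ((F A).map f ⊗ₘ (F A).map g) :=
  BraidedCategory.braiding_naturality ((F A).map g) ((F A).map f)

theorem swap_hexagon (X Y Z : ZCenter A) :
    (F A).obj ((U A).obj Z) ◁ (swap X Y).hom ≫
      swapLeft Z ((F A).obj X ⊗ (F A).obj Y) ≫ (α_ _ _ _).hom =
    (α_ _ _ _).inv ≫ (swap Y Z).hom ▷ (F A).obj ((U A).obj X) ≫
      swapRight ((F A).obj Y ⊗ (F A).obj Z) X := by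
  have h (P R S : A) : S ◁ (β_ R P).hom ≫ (β_ S (P ⊗ R)).hom ≫ (α_ _ _ _).hom =
      (α_ _ _ _).inv ≫ (β_ S R).hom ▷ P ≫ (β_ (R ⊗ S) P).hom := by
    rw [BraidedCategory.braiding_naturality_right_assoc]
    simp
  exact h _ _ _

/-- An overcrossing is the flip of an undercrossing, so the upper crossing of `U Y`, `U X` is a
product of flips of the factors of the lower crossing of `X`, `Y`. -/
theorem intertwines_swap_upper (X Y : ZCenter A) :
    Intertwines (swap X Y).hom (upper ((U A).obj Y) ((U A).obj X))
      (fun B => (flip (lowerIso X Y) B).hom) := by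
  have h := intertwines_braiding_flip (halfBraidingIso X) fun B => (β_ ((F A).obj Y) B).symm
  rw [flip_undercross] at h
  rw [upper_eq, halfBraiding_U]
  exact h

theorem intertwines_swap_lower (X Y : ZCenter A) :
    Intertwines (swap X Y).hom (lower ((U A).obj Y) ((U A).obj X))
      (fun B => (flip (upperIso X Y) B).hom) := by
  have h := intertwines_braiding_flip (fun B => β_ B ((F A).obj X)) (halfBraidingIso Y)
  rw [flip_overcross] at h
  rw [lower_eq, halfBraiding_U]
  exact h

end

/-! ### The tensor structure of `U` -/

namespace ReducedImages

variable {k : Type w} [Field k] [IsAlgClosed k] {A : Type u} [Category.{v} A] [Abelian A]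
  [Linear k A] [MonoidalCategory A] [BraidedCategory A] [RigidCategory A] [RibbonCategory A]
  [IsFusion k A] [MonoidalPreadditive A] [MonoidalLinear k A] [CharZero k] (T : ReducedImages k A)

/-- The swapped image equalizes the upper and lower crossings of `X`, `Y`, because it equalizes
their flips; so `Q` fixes it. -/
theorem incl_swap_Q (X Y : ZCenter A) :
    T.incl ((U A).obj Y) ((U A).obj X) ≫ (swap X Y).hom ≫ Q k X Y =
      T.incl ((U A).obj Y) ((U A).obj X) ≫ (swap X Y).hom := by
  have h1 := (T.intertwines_incl_upper ((U A).obj Y) ((U A).obj X)).comp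
    (intertwines_swap_upper X Y)
  have h2 := (T.intertwines_incl_lower ((U A).obj Y) ((U A).obj X)).comp
    (intertwines_swap_lower X Y)
  have h : Equalizes (T.incl ((U A).obj Y) ((U A).obj X) ≫ (swap X Y).hom) (upper X Y)
    (lower X Y) := Equalizes.of_intertwines_flip
      (x := halfBraidingIso (T.obj ((U A).obj Y) ((U A).obj X))) h2 h1
  rw [Q_eq_average]
  simpa using h.comp_average k (isCrossingPair_upper_lower X Y).right

theorem incl_swap_inv_Q (X Y : ZCenter A) :
    T.incl X Y ≫ (swap X Y).inv ≫ Q k ((U A).obj Y) ((U A).obj X) =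
      T.incl X Y ≫ (swap X Y).inv := by
  have h1 : Intertwines (T.incl X Y ≫ (swap X Y).inv)
      (fun B => (flip (halfBraidingIso (T.obj X Y)) B).hom) _ :=
    Intertwines.comp (Intertwines.flip (x := halfBraidingIso (T.obj X Y)) (y := upperIso X Y)
      (T.intertwines_incl_upper X Y)) (intertwines_swap_lower X Y).inv
  have h2 : Intertwines (T.incl X Y ≫ (swap X Y).inv)
      (fun B => (flip (halfBraidingIso (T.obj X Y)) B).hom) _ :=
    Intertwines.comp (Intertwines.flip (x := halfBraidingIso (T.obj X Y)) (y := lowerIso X Y)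
      (T.intertwines_incl_lower X Y)) (intertwines_swap_upper X Y).inv
  have h : Equalizes (T.incl X Y ≫ (swap X Y).inv) (upper ((U A).obj Y) ((U A).obj X))
    (lower ((U A).obj Y) ((U A).obj X)) := fun B => (h2 B).trans (h1 B).symm
  rw [Q_eq_average]
  simpa using h.comp_average k (isCrossingPair_upper_lower _ _).right

/-- The morphism underlying the tensor structure of `U`. -/
def tensUIso (X Y : ZCenter A) :
    (F A).obj (T.obj ((U A).obj Y) ((U A).obj X)) ≅ (F A).obj (T.obj X Y) where
  hom := T.incl _ _ ≫ (swap X Y).hom ≫ T.proj X Y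
  inv := T.incl X Y ≫ (swap X Y).inv ≫ T.proj _ _
  hom_inv_id := by
    simp only [Category.assoc]
    rw [reassoc_of% T.proj_incl, reassoc_of% T.incl_swap_Q]
    simp [T.incl_proj]
  inv_hom_id := by
    simp only [Category.assoc]
    rw [reassoc_of% T.proj_incl, reassoc_of% T.incl_swap_inv_Q]
    simp [T.incl_proj]

theorem tensUIso_incl (X Y : ZCenter A) :
    (T.tensUIso X Y).hom ≫ T.incl X Y = T.incl _ _ ≫ (swap X Y).hom := by
  simp only [tensUIso, Category.assoc]
  rw [T.proj_incl, incl_swap_Q]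

theorem intertwines_tensUIso (X Y : ZCenter A) : Intertwines (T.tensUIso X Y).hom
    (halfBraiding (T.obj ((U A).obj Y) ((U A).obj X)))
    (fun B => (flip (halfBraidingIso (T.obj X Y)) B).hom) := fun B => by
  have h1 := (T.intertwines_incl_lower ((U A).obj Y) ((U A).obj X)).comp
    (intertwines_swap_lower X Y) B
  have h2 := Intertwines.flip (x := halfBraidingIso (T.obj X Y)) (y := upperIso X Y)
    (T.intertwines_incl_upper X Y) B
  rw [← cancel_mono (T.incl X Y ▷ B), Category.assoc, Category.assoc]
  refine (congrArg (_ ≫ ·) h2.symm).trans ?_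
  rw [← MonoidalCategory.whiskerLeft_comp_assoc, ← comp_whiskerRight, tensUIso_incl]
  exact h1

/-- The tensor structure of `U`. -/
def tensU (X Y : ZCenter A) : T.obj ((U A).obj Y) ((U A).obj X) ≅ (U A).obj (T.obj X Y) :=
  centerIso (Y := (U A).obj (T.obj X Y)) (T.tensUIso X Y) (by
    rw [halfBraiding_U]
    exact T.intertwines_tensUIso X Y)

/-- The inclusion of `X ⊗̄ Y`, as a morphism from the object underlying `U (X ⊗̄ Y)`. -/
def inclU (X Y : ZCenter A) :
    (F A).obj ((U A).obj (T.obj X Y)) ⟶ (F A).obj X ⊗ (F A).obj Y :=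
  T.incl X Y

instance (X Y : ZCenter A) : IsSplitMono (T.inclU X Y) := ⟨⟨T.proj X Y, T.incl_proj X Y⟩⟩

theorem tensU_inclU (X Y : ZCenter A) : (F A).map (T.tensU X Y).hom ≫ T.inclU X Y =
    T.incl _ _ ≫ (swap X Y).hom :=
  T.tensUIso_incl X Y

theorem U_map_inclU {X X' Y Y' : ZCenter A} (f : X ⟶ X') (g : Y ⟶ Y') :
    (F A).map ((U A).map (T.map f g)) ≫ T.inclU X' Y' =
      T.inclU X Y ≫ ((F A).map f ⊗ₘ (F A).map g) :=
  T.map_incl f g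

theorem U_associator_inclU (X Y Z : ZCenter A) :
    (F A).map ((U A).map (T.associator X Y Z).hom) ≫ T.inclU X (T.obj Y Z) ≫
      (F A).obj X ◁ T.incl Y Z =
    T.inclU (T.obj X Y) Z ≫ T.incl X Y ▷ (F A).obj Z ≫ (α_ _ _ _).hom :=
  T.associator_hom_incl X Y Z

theorem tensU_naturality {X X' Y Y' : ZCenter A} (f : X ⟶ X') (g : Y ⟶ Y') :
    T.map ((U A).map g) ((U A).map f) ≫ (T.tensU X' Y').hom =
      (T.tensU X Y).hom ≫ (U A).map (T.map f g) := by
  apply (F A).map_injective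
  rw [← cancel_mono (T.inclU X' Y')]
  simp only [Functor.map_comp, Category.assoc]
  rw [T.tensU_inclU, reassoc_of% T.map_incl, U_map_inclU, reassoc_of% T.tensU_inclU,
    swap_naturality]

theorem swap_incl_whiskerRight (X Y Z : ZCenter A) :
    (swap (T.obj X Y) Z).hom ≫ T.incl X Y ▷ (F A).obj Z =
      (F A).obj ((U A).obj Z) ◁ T.inclU X Y ≫ swapLeft Z ((F A).obj X ⊗ (F A).obj Y) :=
  (BraidedCategory.braiding_naturality_right ((F A).obj Z) (T.incl X Y)).symm

theorem swap_whiskerLeft_incl (X Y Z : ZCenter A) :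
    (swap X (T.obj Y Z)).hom ≫ (F A).obj X ◁ T.incl Y Z =
      T.inclU Y Z ▷ (F A).obj ((U A).obj X) ≫ swapRight ((F A).obj Y ⊗ (F A).obj Z) X :=
  (BraidedCategory.braiding_naturality_left (T.incl Y Z) ((F A).obj X)).symm

theorem associator_inv_incl (X Y Z : ZCenter A) : (F A).map (T.associator X Y Z).inv ≫
    T.incl (T.obj X Y) Z ≫ T.incl X Y ▷ (F A).obj Z =
      T.incl X (T.obj Y Z) ≫ (F A).obj X ◁ T.incl Y Z ≫ (α_ _ _ _).inv := by
  rw [← cancel_epi ((F A).map (T.associator X Y Z).hom), ← Functor.map_comp_assoc,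
    Iso.hom_inv_id, (F A).map_id, Category.id_comp, ← cancel_mono (α_ _ _ _).hom]
  simp only [Category.assoc, Iso.inv_hom_id, Category.comp_id]
  exact (T.associator_hom_incl X Y Z).symm

/-- After the inclusions in the triple tensor product of `A`, both sides are the braiding that
reverses three factors, and `swap_hexagon` equates them. -/
theorem tensU_associativity (X Y Z : ZCenter A) :
    T.map (𝟙 ((U A).obj Z)) (T.tensU X Y).hom ≫ (T.tensU (T.obj X Y) Z).hom ≫
      (U A).map (T.associator X Y Z).hom =
    (T.associator ((U A).obj Z) ((U A).obj Y) ((U A).obj X)).inv ≫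
      T.map (T.tensU Y Z).hom (𝟙 ((U A).obj X)) ≫ (T.tensU X (T.obj Y Z)).hom := by
  apply (F A).map_injective
  rw [← cancel_mono (T.inclU X (T.obj Y Z)), ← cancel_mono ((F A).obj X ◁ T.incl Y Z)]
  simp only [Functor.map_comp, Category.assoc]
  rw [T.U_associator_inclU, reassoc_of% T.tensU_inclU, reassoc_of% T.swap_incl_whiskerRight,
    reassoc_of% T.tensU_inclU, T.swap_whiskerLeft_incl, reassoc_of% T.map_incl,
    reassoc_of% T.map_incl, (F A).map_id, (F A).map_id, id_tensorHom, tensorHom_id,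
    ← MonoidalCategory.whiskerLeft_comp_assoc, ← comp_whiskerRight_assoc, T.tensU_inclU,
    T.tensU_inclU, MonoidalCategory.whiskerLeft_comp_assoc, comp_whiskerRight_assoc,
    reassoc_of% T.associator_inv_incl, swap_hexagon]

end ReducedImages

/-! ### Coherent unit constraints from a weak unit -/

section Semigroup

/-- A category with an associative tensor product, without unit. -/
structure SemigroupStructure (C : Type u) [Category.{v} C] where
  /-- The tensor product of objects. -/
  obj : C → C → C
  /-- The tensor product of morphisms. -/
  map : ∀ {X X' Y Y' : C}, (X ⟶ X') → (Y ⟶ Y') → (obj X Y ⟶ obj X' Y')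
  map_id : ∀ X Y, map (𝟙 X) (𝟙 Y) = 𝟙 (obj X Y)
  map_comp : ∀ {X X' X'' Y Y' Y'' : C} (f : X ⟶ X') (f' : X' ⟶ X'') (g : Y ⟶ Y') (g' : Y' ⟶ Y''),
    map (f ≫ f') (g ≫ g') = map f g ≫ map f' g'
  /-- The associativity constraint. -/
  assoc : ∀ X Y Z : C, obj (obj X Y) Z ≅ obj X (obj Y Z)
  assoc_naturality : ∀ {X X' Y Y' Z Z' : C} (f : X ⟶ X') (g : Y ⟶ Y') (h : Z ⟶ Z'),
    map (map f g) h ≫ (assoc X' Y' Z').hom = (assoc X Y Z).hom ≫ map f (map g h)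
  pentagon : ∀ W X Y Z : C, map (assoc W X Y).hom (𝟙 Z) ≫ (assoc W (obj X Y) Z).hom ≫
    map (𝟙 W) (assoc X Y Z).hom = (assoc (obj W X) Y Z).hom ≫ (assoc W X (obj Y Z)).hom

namespace SemigroupStructure

variable {C : Type u} [Category.{v} C] (S : SemigroupStructure C)

theorem map_id_comp {W X Y Z : C} (f : X ⟶ Y) (g : Y ⟶ Z) :
    S.map (𝟙 W) (f ≫ g) = S.map (𝟙 W) f ≫ S.map (𝟙 W) g := by
  rw [← S.map_comp, Category.comp_id]

theorem map_comp_id {W X Y Z : C} (f : X ⟶ Y) (g : Y ⟶ Z) :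
    S.map (f ≫ g) (𝟙 W) = S.map f (𝟙 W) ≫ S.map g (𝟙 W) := by
  rw [← S.map_comp, Category.comp_id]

/-- The tensor product of isomorphisms. -/
def mapIso {X X' Y Y' : C} (f : X ≅ X') (g : Y ≅ Y') : S.obj X Y ≅ S.obj X' Y' where
  hom := S.map f.hom g.hom
  inv := S.map f.inv g.inv
  hom_inv_id := by rw [← S.map_comp, f.hom_inv_id, g.hom_inv_id, S.map_id]
  inv_hom_id := by rw [← S.map_comp, f.inv_hom_id, g.inv_hom_id, S.map_id]

/-- A two-sided unit, in the weak sense that tensoring with it is isomorphic to the identity. -/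
structure WeakUnit where
  /-- The unit object. -/
  unit : C
  /-- Left multiplication by the unit is isomorphic to the identity. -/
  left : ∀ X, S.obj unit X ≅ X
  /-- Right multiplication by the unit is isomorphic to the identity. -/
  right : ∀ X, S.obj X unit ≅ X
  left_naturality : ∀ {X Y : C} (f : X ⟶ Y), S.map (𝟙 unit) f ≫ (left Y).hom = (left X).hom ≫ f
  right_naturality : ∀ {X Y : C} (f : X ⟶ Y), S.map f (𝟙 unit) ≫ (right Y).hom = (right X).hom ≫ f

/-- A weak left unit and a weak right unit give a weak unit. -/
def weakUnitOfLeftRight {I J : C} (l : ∀ X, S.obj I X ≅ X) (r : ∀ X, S.obj X J ≅ X)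
    (hl : ∀ {X Y : C} (f : X ⟶ Y), S.map (𝟙 I) f ≫ (l Y).hom = (l X).hom ≫ f)
    (hr : ∀ {X Y : C} (f : X ⟶ Y), S.map f (𝟙 J) ≫ (r Y).hom = (r X).hom ≫ f) : S.WeakUnit where
  unit := I
  left := l
  -- The two units are isomorphic through `I ⊗ J`.
  right X := S.mapIso (Iso.refl X) ((r I).symm ≪≫ l J) ≪≫ r X
  left_naturality := hl
  right_naturality {X Y} f := by
    simp only [mapIso, Iso.trans_hom, Iso.refl_hom, Category.assoc]
    rw [← hr, ← Category.assoc, ← Category.assoc, ← S.map_comp, ← S.map_comp]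
    simp

namespace WeakUnit

variable {S} (E : S.WeakUnit)

/-- The left unit constraint determined by the isomorphism `I ⊗ I ≅ I`. -/
def lam (X : C) : S.obj E.unit X ≅ X :=
  (E.left (S.obj E.unit X)).symm ≪≫ (S.assoc E.unit E.unit X).symm ≪≫
    S.mapIso (E.left E.unit) (Iso.refl X) ≪≫ E.left X

/-- The right unit constraint determined by the isomorphism `I ⊗ I ≅ I`. -/
def rho (X : C) : S.obj X E.unit ≅ X :=
  (E.right (S.obj X E.unit)).symm ≪≫ S.assoc X E.unit E.unit ≪≫
    S.mapIso (Iso.refl X) (E.left E.unit) ≪≫ E.right X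

/-- This equation characterizes the constraint, since tensoring with the unit is faithful;
naturality of `left` at `lam` itself reduces it to the definition. -/
theorem map_lam (X : C) : S.map (𝟙 E.unit) (E.lam X).hom =
    (S.assoc E.unit E.unit X).inv ≫ S.map (E.left E.unit).hom (𝟙 X) := by
  rw [← cancel_mono (E.left X).hom, E.left_naturality]
  simp [lam, mapIso]

theorem map_rho (X : C) : S.map (E.rho X).hom (𝟙 E.unit) =
    (S.assoc X E.unit E.unit).hom ≫ S.map (𝟙 X) (E.left E.unit).hom := by
  rw [← cancel_mono (E.right X).hom, E.right_naturality]
  simp [rho, mapIso]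

theorem left_ext {X Y : C} {f g : X ⟶ Y} (h : S.map (𝟙 E.unit) f = S.map (𝟙 E.unit) g) : f = g := by
  rw [← cancel_epi (E.left X).hom, ← E.left_naturality, ← E.left_naturality, h]

theorem right_ext {X Y : C} {f g : X ⟶ Y} (h : S.map f (𝟙 E.unit) = S.map g (𝟙 E.unit)) : f = g := by
  rw [← cancel_epi (E.right X).hom, ← E.right_naturality, ← E.right_naturality, h]

theorem lam_naturality {X Y : C} (f : X ⟶ Y) :
    S.map (𝟙 E.unit) f ≫ (E.lam Y).hom = (E.lam X).hom ≫ f := by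
  apply E.left_ext
  rw [S.map_id_comp, S.map_id_comp, map_lam, map_lam, ← cancel_epi (S.assoc E.unit E.unit X).hom,
    ← reassoc_of% S.assoc_naturality (𝟙 E.unit) (𝟙 E.unit) f]
  simp only [Category.assoc, Iso.hom_inv_id_assoc, S.map_id, ← S.map_comp, Category.comp_id,
    Category.id_comp]

theorem rho_naturality {X Y : C} (f : X ⟶ Y) :
    S.map f (𝟙 E.unit) ≫ (E.rho Y).hom = (E.rho X).hom ≫ f := by
  apply E.right_ext
  rw [S.map_comp_id, S.map_comp_id, map_rho, map_rho,
    reassoc_of% S.assoc_naturality f (𝟙 E.unit) (𝟙 E.unit)]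
  simp only [Category.assoc, S.map_id, ← S.map_comp, Category.comp_id, Category.id_comp]

theorem triangle (X Y : C) : (S.assoc X E.unit Y).hom ≫ S.map (𝟙 X) (E.lam Y).hom =
    S.map (E.rho X).hom (𝟙 Y) := by
  -- The triangle in disguise: the pentagon for `X`, `I`, `I`, `Y`, with both constraints expressed
  -- through the one isomorphism `I ⊗ I ≅ I`. Interchange with the invertible `lam` then gives the
  -- triangle itself.
  have key : S.map (𝟙 (S.obj X E.unit)) (E.lam Y).hom ≫ (S.assoc X E.unit Y).hom =
      S.map (E.rho X).hom (𝟙 (S.obj E.unit Y)) := by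
    have h1 := S.assoc_naturality (𝟙 X) (𝟙 E.unit) (E.lam Y).hom
    have h2 := S.assoc_naturality (E.rho X).hom (𝟙 E.unit) (𝟙 Y)
    have h3 := S.assoc_naturality (𝟙 X) (E.left E.unit).hom (𝟙 Y)
    have h4 := S.pentagon X E.unit E.unit Y
    rw [S.map_id] at h1 h2
    rw [h1, map_lam, ← cancel_epi (S.assoc (S.obj X E.unit) E.unit Y).hom, ← h2, map_rho,
      S.map_comp_id, Category.assoc, h3, S.map_id_comp, ← reassoc_of% h4, ← reassoc_of% S.map_id_comp]
    simp [S.map_id]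
  have : IsIso (S.map (𝟙 (S.obj X E.unit)) (E.lam Y).hom) :=
    (S.mapIso (Iso.refl (S.obj X E.unit)) (E.lam Y)).isIso_hom
  rw [← cancel_epi (S.map (𝟙 (S.obj X E.unit)) (E.lam Y).hom), reassoc_of% key, ← S.map_comp,
    ← S.map_comp, Category.id_comp, Category.comp_id, Category.comp_id, Category.id_comp]

/-- The monoidal structure determined by a weak unit. -/
abbrev monoidalCategoryStruct : MonoidalCategoryStruct C where
  tensorObj := S.obj
  whiskerLeft X _ _ f := S.map (𝟙 X) f
  whiskerRight f Y := S.map f (𝟙 Y)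
  tensorHom := S.map
  tensorUnit := E.unit
  associator := S.assoc
  leftUnitor := E.lam
  rightUnitor := E.rho

/-- The monoidal category determined by a weak unit. -/
abbrev monoidalCategory : MonoidalCategory C :=
  letI := E.monoidalCategoryStruct
  MonoidalCategory.ofTensorHom
    (id_tensorHom_id := S.map_id)
    (tensorHom_comp_tensorHom := fun f g f' g' => (S.map_comp f f' g g').symm)
    (associator_naturality := fun f g h => S.assoc_naturality f g h)
    (leftUnitor_naturality := fun f => E.lam_naturality f)
    (rightUnitor_naturality := fun f => E.rho_naturality f)
    (pentagon := S.pentagon)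
    (triangle := E.triangle)

end WeakUnit

end SemigroupStructure

end Semigroup

/-! ### Multiplicative equivalences preserve units -/

section MonoidalFunctor

variable {C : Type*} [Category* C] [MonoidalCategory C] {D : Type*} [Category* D]
  [MonoidalCategory D] (G : C ⥤ D)

/-- An associative multiplicative structure on a functor. -/
structure MultiplicativeFunctor where
  /-- The tensorator. -/
  iso : ∀ X Y : C, G.obj X ⊗ G.obj Y ≅ G.obj (X ⊗ Y)
  naturality_left : ∀ {X Y : C} (f : X ⟶ Y) (X' : C),
    G.map f ▷ G.obj X' ≫ (iso Y X').hom = (iso X X').hom ≫ G.map (f ▷ X')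
  naturality_right : ∀ {X Y : C} (X' : C) (f : X ⟶ Y),
    G.obj X' ◁ G.map f ≫ (iso X' Y).hom = (iso X' X).hom ≫ G.map (X' ◁ f)
  associativity : ∀ X Y Z : C,
    (iso X Y).hom ▷ G.obj Z ≫ (iso (X ⊗ Y) Z).hom ≫ G.map (α_ X Y Z).hom =
      (α_ (G.obj X) (G.obj Y) (G.obj Z)).hom ≫ G.obj X ◁ (iso Y Z).hom ≫ (iso X (Y ⊗ Z)).hom

namespace MultiplicativeFunctor

variable {G} (M : MultiplicativeFunctor G)

/-- The action of the image of the unit from the left. -/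
def unitLeft (X : C) : G.obj (𝟙_ C) ⊗ G.obj X ≅ G.obj X := M.iso (𝟙_ C) X ≪≫ G.mapIso (λ_ X)

theorem unitLeft_naturality {X Y : C} (f : X ⟶ Y) :
    G.obj (𝟙_ C) ◁ G.map f ≫ (M.unitLeft Y).hom = (M.unitLeft X).hom ≫ G.map f := by
  simp only [unitLeft, Iso.trans_hom, Functor.mapIso_hom, Category.assoc]
  rw [reassoc_of% M.naturality_right, ← G.map_comp, leftUnitor_naturality, G.map_comp]

theorem unitLeft_tensor (X Y : C) : (M.unitLeft X).hom ▷ G.obj Y ≫ (M.iso X Y).hom =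
    (α_ _ _ _).hom ≫ G.obj (𝟙_ C) ◁ (M.iso X Y).hom ≫ (M.unitLeft (X ⊗ Y)).hom := by
  simp only [unitLeft, Iso.trans_hom, Functor.mapIso_hom, comp_whiskerRight, Category.assoc]
  rw [M.naturality_left, ← reassoc_of% M.associativity, ← G.map_comp]
  simp

theorem unitLeft_whiskerLeft (X Y : C) : (α_ _ _ _).hom ≫ G.obj X ◁ (M.unitLeft Y).hom =
    ((M.iso X (𝟙_ C)).hom ≫ G.map (ρ_ X).hom) ▷ G.obj Y := by
  rw [← cancel_mono (M.iso X Y).hom]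
  simp only [unitLeft, Iso.trans_hom, Functor.mapIso_hom, comp_whiskerRight, Category.assoc,
    MonoidalCategory.whiskerLeft_comp]
  rw [M.naturality_left, M.naturality_right, ← reassoc_of% M.associativity, ← G.map_comp]
  simp

variable [G.IsEquivalence]

/-- A preimage of the unit object. -/
def unitPreimage (_ : MultiplicativeFunctor G) : G.obj (G.objPreimage (𝟙_ D)) ≅ 𝟙_ D :=
  G.objObjPreimageIso (𝟙_ D)

/-- The comparison of unit objects. -/
def unitIso : G.obj (𝟙_ C) ≅ 𝟙_ D :=
  (ρ_ _).symm ≪≫ whiskerLeftIso _ M.unitPreimage.symm ≪≫ M.unitLeft _ ≪≫ M.unitPreimage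

/-- The comparison is built from a preimage `Z` of the unit. The isomorphism from the product of `G
Z` and `G X` to `G X` is `G` of some `g`, up to `iso`, by fullness; compatibility of `unitLeft` with
products and morphisms then carries the statement from `Z` to `X`. -/
theorem unitIso_whiskerRight (X : C) :
    M.unitIso.hom ▷ G.obj X ≫ (λ_ (G.obj X)).hom = (M.unitLeft X).hom := by
  set Z := G.objPreimage (𝟙_ D)
  set e : G.obj Z ≅ 𝟙_ D := M.unitPreimage
  obtain ⟨g, hg⟩ := G.map_surjective ((M.iso Z X).inv ≫ e.hom ▷ G.obj X ≫ (λ_ (G.obj X)).hom)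
  have hg' : (M.iso Z X).hom ≫ G.map g = e.hom ▷ G.obj X ≫ (λ_ (G.obj X)).hom := by
    rw [hg, Iso.hom_inv_id_assoc]
  have h1 : (M.unitLeft Z).hom ▷ G.obj X ≫ e.hom ▷ G.obj X ≫ (λ_ (G.obj X)).hom =
      (α_ _ _ _).hom ≫ G.obj (𝟙_ C) ◁ (e.hom ▷ G.obj X ≫ (λ_ (G.obj X)).hom) ≫
        (M.unitLeft X).hom := by
    rw [← hg', reassoc_of% M.unitLeft_tensor, ← M.unitLeft_naturality,
      MonoidalCategory.whiskerLeft_comp_assoc]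
  calc
    _ = (ρ_ _).inv ▷ G.obj X ≫ (G.obj (𝟙_ C) ◁ e.inv) ▷ G.obj X ≫ (M.unitLeft Z).hom ▷ G.obj X ≫
        e.hom ▷ G.obj X ≫ (λ_ (G.obj X)).hom := by
      simp [unitIso, e, Z]
    _ = 𝟙 _ ⊗≫ G.obj (𝟙_ C) ◁ (e.inv ≫ e.hom) ▷ G.obj X ⊗≫ (M.unitLeft X).hom := by
      rw [h1]; monoidal
    _ = _ := by rw [e.inv_hom_id]; monoidal

/-- The equation is checked after tensoring with the image of the preimage of the unit, which is
harmless because that image is isomorphic to the unit. -/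
theorem whiskerLeft_unitIso (X : C) : G.obj X ◁ M.unitIso.hom ≫ (ρ_ (G.obj X)).hom =
    (M.iso X (𝟙_ C)).hom ≫ G.map (ρ_ X).hom := by
  have h1 : (G.obj X ◁ M.unitIso.hom ≫ (ρ_ (G.obj X)).hom) ▷ G.obj (G.objPreimage (𝟙_ D)) =
      ((M.iso X (𝟙_ C)).hom ≫ G.map (ρ_ X).hom) ▷ G.obj (G.objPreimage (𝟙_ D)) := by
    rw [← M.unitLeft_whiskerLeft, ← M.unitIso_whiskerRight]
    monoidal
  have h2 : (G.obj X ◁ M.unitIso.hom ≫ (ρ_ (G.obj X)).hom) ▷ 𝟙_ D =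
      ((M.iso X (𝟙_ C)).hom ≫ G.map (ρ_ X).hom) ▷ 𝟙_ D := by
    rw [← cancel_epi (_ ◁ M.unitPreimage.hom), whisker_exchange, whisker_exchange, h1]
  rwa [whiskerRight_id, whiskerRight_id, cancel_epi, cancel_mono] at h2

/-- An equivalence with an associative multiplicative structure is a monoidal functor. -/
abbrev monoidal : G.Monoidal :=
  Functor.CoreMonoidal.toMonoidal
    { εIso := M.unitIso.symm
      μIso := M.iso
      μIso_hom_natural_left := M.naturality_left
      μIso_hom_natural_right := M.naturality_right
      associativity := M.associativity
      left_unitality := fun X => by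
        have h := M.unitIso_whiskerRight X
        rw [Iso.symm_hom, ← cancel_epi (M.unitIso.hom ▷ G.obj X), h, ← comp_whiskerRight_assoc,
          Iso.hom_inv_id, id_whiskerRight, Category.id_comp]
        rfl
      right_unitality := fun X => by
        have h := M.whiskerLeft_unitIso X
        rw [Iso.symm_hom, ← h, ← MonoidalCategory.whiskerLeft_comp_assoc, Iso.inv_hom_id,
          MonoidalCategory.whiskerLeft_id, Category.id_comp] }

end MultiplicativeFunctor

end MonoidalFunctor

/-! ### Actions of `ℤ/2` from involutions -/

section Action

attribute [local instance] endofunctorMonoidalCategory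

variable {C : Type*} [Category* C] (T : C ⥤ C) (a : T ⋙ T ≅ 𝟭 C)

/-- The powers of an endofunctor, for exponents modulo `2`. -/
def powMod2 : ZMod 2 → (C ⥤ C)
  | 0 => 𝟭 C
  | 1 => T

variable {T}

/-- The multiplication of the powers of an involution. -/
def mulMod2 : ∀ g h : ZMod 2, powMod2 T g ⋙ powMod2 T h ≅ powMod2 T (g + h)
  | 0, 0 => Iso.refl _
  | 0, 1 => Iso.refl _
  | 1, 0 => Iso.refl _
  | 1, 1 => a

/-- Of the eight cases only `1, 1, 1` has content, and it is the hypothesis `h`. -/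
theorem mulMod2_associativity (h : ∀ X, T.map (a.hom.app X) = a.hom.app (T.obj X)) (g₁ g₂ g₃ : ZMod 2)
    (X : C) : (powMod2 T g₃).map ((mulMod2 a g₁ g₂).hom.app X) ≫
      (mulMod2 a (g₁ + g₂) g₃).hom.app X ≫ eqToHom (by rw [add_assoc]) =
    (mulMod2 a g₂ g₃).hom.app ((powMod2 T g₁).obj X) ≫ (mulMod2 a g₁ (g₂ + g₃)).hom.app X := by
  match g₁, g₂, g₃ with
  | 0, 0, 0 => exact Category.id_comp _
  | 0, 0, 1 =>
    have e : T.map (𝟙 X) ≫ 𝟙 (T.obj X) ≫ 𝟙 (T.obj X) = 𝟙 (T.obj X) ≫ 𝟙 (T.obj X) := by simp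
    exact e
  | 0, 1, 0 => exact Category.id_comp _
  | 0, 1, 1 =>
    have e : T.map (𝟙 (T.obj X)) ≫ a.hom.app X ≫ 𝟙 X = a.hom.app X ≫ 𝟙 X := by simp
    exact e
  | 1, 0, 0 => exact Category.id_comp _
  | 1, 0, 1 =>
    have e : T.map (𝟙 (T.obj X)) ≫ a.hom.app X ≫ 𝟙 X = 𝟙 (T.obj (T.obj X)) ≫ a.hom.app X := by simp
    exact e
  | 1, 1, 0 =>
    have e : a.hom.app X ≫ 𝟙 X ≫ 𝟙 X = 𝟙 (T.obj (T.obj X)) ≫ a.hom.app X := by simp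
    exact e
  | 1, 1, 1 =>
    have e : T.map (a.hom.app X) ≫ 𝟙 (T.obj X) ≫ 𝟙 (T.obj X) =
        a.hom.app (T.obj X) ≫ 𝟙 (T.obj X) := by simpa using h X
    exact e

theorem zero_mulMod2 (g : ZMod 2) (X : C) : (powMod2 T g).map (𝟙 X) ≫
    (mulMod2 a 0 g).hom.app X ≫ eqToHom (by rw [zero_add]) = 𝟙 ((powMod2 T g).obj X) := by
  match g with
  | 0 =>
    have e : 𝟙 X ≫ 𝟙 X ≫ 𝟙 X = 𝟙 X := by simp
    exact e
  | 1 =>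
    have e : T.map (𝟙 X) ≫ 𝟙 (T.obj X) ≫ 𝟙 (T.obj X) = 𝟙 (T.obj X) := by simp
    exact e

theorem mulMod2_zero (g : ZMod 2) (X : C) : 𝟙 ((powMod2 T g).obj X) ≫
    (mulMod2 a g 0).hom.app X ≫ eqToHom (by rw [add_zero]) = 𝟙 ((powMod2 T g).obj X) := by
  match g with
  | 0 =>
    have e : 𝟙 X ≫ 𝟙 X ≫ 𝟙 X = 𝟙 X := by simp
    exact e
  | 1 =>
    have e : 𝟙 (T.obj X) ≫ 𝟙 (T.obj X) ≫ 𝟙 (T.obj X) = 𝟙 (T.obj X) := by simp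
    exact e

variable (T) in
/-- The functor underlying the action of `ℤ/2` determined by an involution. -/
def actionMod2 : Discrete (Multiplicative (ZMod 2)) ⥤ (C ⥤ C) :=
  Discrete.functor fun g => powMod2 T g.toAdd

theorem actionMod2_map_app {g h : Discrete (Multiplicative (ZMod 2))} (f : g ⟶ h) (X : C) :
    ((actionMod2 T).map f).app X = eqToHom (by rw [Discrete.ext (Discrete.eq_of_hom f)]) := by
  obtain rfl := Discrete.ext (Discrete.eq_of_hom f)
  obtain rfl : f = 𝟙 _ := Subsingleton.elim _ _
  simp

open Functor.LaxMonoidal Functor.OplaxMonoidal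

/-- The monoidal structure of the action of `ℤ/2` determined by an involution. -/
def actionMod2CoreMonoidal (h : ∀ X, T.map (a.hom.app X) = a.hom.app (T.obj X)) :
    (actionMod2 T).CoreMonoidal where
  εIso := Iso.refl (𝟭 C)
  μIso g h := mulMod2 a g.as.toAdd h.as.toAdd
  μIso_hom_natural_left {g g'} f h := by
    obtain rfl := Discrete.ext (Discrete.eq_of_hom f)
    obtain rfl : f = 𝟙 _ := Subsingleton.elim _ _
    simp
  μIso_hom_natural_right {g g'} h f := by
    obtain rfl := Discrete.ext (Discrete.eq_of_hom f)
    obtain rfl : f = 𝟙 _ := Subsingleton.elim _ _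
    simp
  associativity g₁ g₂ g₃ := by
    refine NatTrans.ext (funext fun X => ?_)
    refine Eq.trans ?_ (Category.id_comp _).symm
    refine Eq.trans ?_ (mulMod2_associativity a h g₁.as.toAdd g₂.as.toAdd g₃.as.toAdd X)
    exact congrArg (_ ≫ _ ≫ ·) (actionMod2_map_app _ X)
  left_unitality g := by
    refine NatTrans.ext (funext fun X => ?_)
    refine (zero_mulMod2 a g.as.toAdd X).symm.trans ?_
    exact congrArg (_ ≫ _ ≫ ·) (actionMod2_map_app _ X).symm
  right_unitality g := by
    refine NatTrans.ext (funext fun X => ?_)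
    refine (mulMod2_zero a g.as.toAdd X).symm.trans ?_
    exact congrArg (_ ≫ _ ≫ ·) (actionMod2_map_app _ X).symm

/-- The action of `ℤ/2` determined by an involution. -/
def zmod2Action (h : ∀ X, T.map (a.hom.app X) = a.hom.app (T.obj X)) : ZMod2Action T a where
  action := actionMod2 T
  monoidal := (actionMod2CoreMonoidal a h).toMonoidal
  gen := Iso.refl T
  square := by
    refine NatTrans.ext (funext fun X => ?_)
    have e : (𝟙 (T.obj (T.obj X)) ≫ T.map (𝟙 (T.obj X))) ≫ a.hom.app X =
        a.hom.app X ≫ 𝟙 X ≫ 𝟙 X := by simp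
    have e' (f : (⟨Multiplicative.ofAdd 1⟩ ⊗ ⟨Multiplicative.ofAdd 1⟩ :
        Discrete (Multiplicative (ZMod 2))) ⟶ 𝟙_ _) : 𝟙 X = ((actionMod2 T).map f).app X :=
      (actionMod2_map_app (T := T) f X).symm
    refine e.trans ?_
    exact congrArg (a.hom.app X ≫ · ≫ 𝟙 X) (e' _)

end Action

/-! ### The twist as an isomorphism from the identity to the square of `U` -/

section

variable {A : Type u} [Category.{v} A] [MonoidalCategory A] [BraidedCategory A] [RigidCategory A]
  [RibbonCategory A]

/-- Naturality of the twist at `x B`, expanded on both sides: the twist of `B` cancels by naturality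
of `x`, and the two double braidings are those of `flip (flip x)`. -/
theorem intertwines_twist {V : A} (x : ∀ B : A, B ⊗ V ≅ V ⊗ B)
    (hx : ∀ {B C : A} (f : B ⟶ C), f ▷ V ≫ (x C).hom = (x B).hom ≫ V ◁ f) :
    Intertwines (RibbonCategory.twist V).hom (fun B => (x B).hom)
      (fun B => (flip (flip x) B).hom) := fun B => by
  have h1 := RibbonCategory.twist_naturality (x B).hom
  rw [RibbonCategory.twist_tensor, RibbonCategory.twist_tensor, MonoidalCategory.tensorHom_def,
    MonoidalCategory.tensorHom_def'] at h1
  have h2 := hx (RibbonCategory.twist B).hom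
  have h3 : flip (flip x) B = β_ B V ≪≫ β_ V B ≪≫ x B ≪≫ (β_ B V).symm ≪≫ (β_ V B).symm := by
    ext
    simp [flip]
  rw [← whisker_exchange] at h1
  simp only [Category.assoc] at h1
  have h4 : B ◁ (RibbonCategory.twist V).hom ≫ (β_ B V).hom ≫ (β_ V B).hom ≫ (x B).hom =
      (x B).hom ≫ (RibbonCategory.twist V).hom ▷ B ≫ (β_ V B).hom ≫ (β_ B V).hom := by
    rw [← cancel_epi ((RibbonCategory.twist B).hom ▷ V), reassoc_of% h2]
    rw [← whisker_exchange_assoc, ← h1, whisker_exchange_assoc]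
  change _ ≫ (flip (flip x) B).hom = (x B).hom ≫ _
  rw [h3]
  simp only [Iso.trans_hom, Iso.symm_hom]
  rw [reassoc_of% h4]
  simp

theorem halfBraidingIso_naturality (X : ZCenter A) {B C : A} (f : B ⟶ C) :
    f ▷ (F A).obj X ≫ (halfBraidingIso X C).hom = (halfBraidingIso X B).hom ≫ (F A).obj X ◁ f :=
  hb_inv_naturality (Sigma.snd X) f

/-- The square of `U` is isomorphic to the identity. -/
def doubleU (X : ZCenter A) : (U A).obj ((U A).obj X) ≅ X :=
  (centerIso (Y := (U A).obj ((U A).obj X)) (RibbonCategory.twist ((F A).obj X)) (by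
    have h := intertwines_twist (halfBraidingIso X) (halfBraidingIso_naturality X)
    have e : halfBraiding ((U A).obj ((U A).obj X)) =
        fun B => (flip (flip (halfBraidingIso X)) B).hom := by
      have e' : halfBraidingIso ((U A).obj X) = flip (halfBraidingIso X) :=
        funext fun B => Iso.ext (congrFun (halfBraiding_U X) B)
      rw [halfBraiding_U, e']
      rfl
    rw [e]
    exact h)).symm

variable (A) in
/-- The natural isomorphism `U ∘ U ≅ 𝟭` given by the inverse twist. -/
def doubleUIso : U A ⋙ U A ≅ 𝟭 (ZCenter A) :=
  NatIso.ofComponents doubleU fun {X Y} f => (F A).map_injective (by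
    have h := RibbonCategory.twist_naturality ((F A).map f)
    change (F A).map f ≫ (RibbonCategory.twist ((F A).obj Y)).inv =
      (RibbonCategory.twist ((F A).obj X)).inv ≫ (F A).map f
    rw [Iso.comp_inv_eq, Category.assoc, h, Iso.inv_hom_id_assoc])

theorem F_map_doubleUIso (X : ZCenter A) :
    (F A).map ((doubleUIso A).hom.app X) = (RibbonCategory.twist ((F A).obj X)).inv := rfl

theorem U_map_doubleUIso (X : ZCenter A) :
    (U A).map ((doubleUIso A).hom.app X) = (doubleUIso A).hom.app ((U A).obj X) :=
  (F A).map_injective rfl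

instance : (U A).IsEquivalence :=
  (CategoryTheory.Equivalence.mk (U A) (U A) (doubleUIso A).symm (doubleUIso A)).isEquivalence_functor

instance : (UOp A).IsEquivalence :=
  haveI : (mopFunctor (ZCenter A)).IsEquivalence :=
    (MonoidalOpposite.mopEquiv (ZCenter A)).isEquivalence_functor
  inferInstance

end

/-! ### The right unit and existence of the reduced tensor product -/

namespace ReducedImages

variable {k : Type w} [Field k] [IsAlgClosed k] {A : Type u} [Category.{v} A] [Abelian A]
  [Linear k A] [MonoidalCategory A] [BraidedCategory A] [RigidCategory A] [RibbonCategory A]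
  [IsFusion k A] [MonoidalPreadditive A] [MonoidalLinear k A] [CharZero k] (T : ReducedImages k A)

/-- The reduced tensor product, without its unit. -/
def semigroupStructure : SemigroupStructure (ZCenter A) where
  obj := T.obj
  map := T.map
  map_id := T.map_id
  map_comp := T.map_comp
  assoc := T.associator
  assoc_naturality := T.associator_naturality
  pentagon := T.pentagon

/-- Tensoring with `U I` on the right, for the unit object `I`, is isomorphic to the identity. -/
def rightUnitor (X : ZCenter A) : T.obj X ((U A).obj (endCenter k A)) ≅ X :=
  T.semigroupStructure.mapIso ((doubleUIso A).symm.app X) (Iso.refl _) ≪≫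
    T.tensU (endCenter k A) ((U A).obj X) ≪≫ (U A).mapIso (T.leftUnitor ((U A).obj X)) ≪≫
    (doubleUIso A).app X

theorem rightUnitor_naturality {X Y : ZCenter A} (f : X ⟶ Y) :
    T.map f (𝟙 ((U A).obj (endCenter k A))) ≫ (T.rightUnitor Y).hom =
      (T.rightUnitor X).hom ≫ f := by
  have h1 := T.tensU_naturality (𝟙 (endCenter k A)) ((U A).map f)
  have h2 := congrArg (U A).map (T.leftUnitor_naturality ((U A).map f))
  have h3 := (doubleUIso A).hom.naturality f
  have h4 := (doubleUIso A).inv.naturality f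
  have h5 : T.map f (𝟙 ((U A).obj (endCenter k A))) ≫ T.map ((doubleUIso A).inv.app Y) (𝟙 _) =
      T.map ((doubleUIso A).inv.app X) (𝟙 _) ≫ T.map ((U A).map ((U A).map f)) (𝟙 _) := by
    rw [← T.map_comp, ← T.map_comp]
    exact congrArg (T.map · _) h4
  rw [(U A).map_id] at h1
  rw [(U A).map_comp, (U A).map_comp] at h2
  change T.map f (𝟙 _) ≫ T.map ((doubleUIso A).inv.app Y) (𝟙 _) ≫ (T.tensU _ _).hom ≫
    (U A).map (T.leftUnitor ((U A).obj Y)).hom ≫ (doubleUIso A).hom.app Y =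
    (T.map ((doubleUIso A).inv.app X) (𝟙 _) ≫ (T.tensU _ _).hom ≫
    (U A).map (T.leftUnitor ((U A).obj X)).hom ≫ (doubleUIso A).hom.app X) ≫ f
  simp only [Category.assoc]
  rw [reassoc_of% h5, reassoc_of% h1, reassoc_of% h2]
  congr 3

/-- The reduced tensor product on the center. -/
abbrev monoidalCategory : MonoidalCategory (ZCenter A) :=
  (T.semigroupStructure.weakUnitOfLeftRight T.leftUnitor T.rightUnitor T.leftUnitor_naturality
    T.rightUnitor_naturality).monoidalCategory

/-- The monoidal structure on the center is a reduced tensor product. -/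
def reducedTensorProduct : letI := T.monoidalCategory; ReducedTensorProduct k A :=
  letI := T.monoidalCategory
  { incl := T.incl
    proj := T.proj
    incl_proj := T.incl_proj
    proj_incl := T.proj_incl
    halfBraiding_eq := T.halfBraiding_eq
    tensorHom_eq := T.F_map_map
    associator_eq := T.F_map_associator_hom }

end ReducedImages

/-! ### Transfer to an arbitrary reduced tensor product -/

namespace ReducedTensorProduct

variable {k : Type w} [Field k] [IsAlgClosed k] {A : Type u} [Category.{v} A] [Abelian A]
  [Linear k A] [MonoidalCategory A] [BraidedCategory A] [RigidCategory A] [RibbonCategory A]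
  [IsFusion k A] [MonoidalPreadditive A] [MonoidalLinear k A] [CharZero k]
  [MonoidalCategory (ZCenter A)] (R : ReducedTensorProduct k A)

/-- The images of the projections that form a reduced tensor product. -/
abbrev images : ReducedImages k A where
  obj X Y := X ⊗ Y
  incl := R.incl
  proj := R.proj
  incl_proj := R.incl_proj
  proj_incl := R.proj_incl
  halfBraiding_eq := R.halfBraiding_eq

theorem images_map {X X' Y Y' : ZCenter A} (f : X ⟶ X') (g : Y ⟶ Y') :
    R.images.map f g = f ⊗ₘ g :=
  (F A).map_injective (R.tensorHom_eq f g).symm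

/-- The forgetful functor is faithful, so the given associator, prescribed on underlying morphisms,
is the constructed one. Unit constraints need no comparison, as the unit of a multiplicative
equivalence is automatic. -/
theorem images_associator (X Y Z : ZCenter A) : R.images.associator X Y Z = α_ X Y Z :=
  Iso.ext ((F A).map_injective
    ((R.images.F_map_associator_hom X Y Z).trans (R.associator_eq X Y Z).symm))

/-- The tensor structure of `U`. -/
def tensU (X Y : ZCenter A) : (U A).obj Y ⊗ (U A).obj X ≅ (U A).obj (X ⊗ Y) := R.images.tensU X Y

theorem tensU_naturality {X X' Y Y' : ZCenter A} (f : X ⟶ X') (g : Y ⟶ Y') :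
    ((U A).map g ⊗ₘ (U A).map f) ≫ (R.tensU X' Y').hom =
      (R.tensU X Y).hom ≫ (U A).map (f ⊗ₘ g) := by
  have h := R.images.tensU_naturality f g
  rw [images_map, images_map] at h
  exact h

theorem tensU_associativity (X Y Z : ZCenter A) :
    (U A).obj Z ◁ (R.tensU X Y).hom ≫ (R.tensU (X ⊗ Y) Z).hom ≫ (U A).map (α_ X Y Z).hom =
      (α_ ((U A).obj Z) ((U A).obj Y) ((U A).obj X)).inv ≫
        (R.tensU Y Z).hom ▷ (U A).obj X ≫ (R.tensU X (Y ⊗ Z)).hom := by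
  have h := R.images.tensU_associativity X Y Z
  rw [images_map, images_map, images_associator, images_associator, id_tensorHom,
    tensorHom_id] at h
  exact h

/-- The tensor structure of `U` as a functor to the opposite tensor category. -/
def multiplicativeFunctor : MultiplicativeFunctor (UOp A) where
  iso X Y := (R.tensU X Y).mop
  naturality_left {X Y} f X' := Quiver.Hom.unmop_inj (by
    have h := R.tensU_naturality f (𝟙 X')
    rw [tensorHom_id, (U A).map_id, id_tensorHom] at h
    exact h)
  naturality_right {X Y} X' f := Quiver.Hom.unmop_inj (by
    have h := R.tensU_naturality (𝟙 X') f
    rw [id_tensorHom, (U A).map_id, tensorHom_id] at h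
    exact h)
  associativity X Y Z := Quiver.Hom.unmop_inj (R.tensU_associativity X Y Z)

end ReducedTensorProduct

end Premodular

end

open CategoryTheory MonoidalCategory Premodular Functor.LaxMonoidal in
theorem propositionp {k : Type*} [Field k] [IsAlgClosed k] [CharZero k]
    {A : Type*} [Category* A] [Abelian A] [Linear k A]
    [MonoidalCategory A] [MonoidalPreadditive A] [MonoidalLinear k A]
    [BraidedCategory A] [RigidCategory A] [RibbonCategory A] [IsFusion k A] :
    (∃ _ : MonoidalCategory (ZCenter A), Nonempty (ReducedTensorProduct k A)) ∧
    ∀ [MonoidalCategory (ZCenter A)] (R : ReducedTensorProduct k A),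
      (UOp A).IsEquivalence ∧
      ∃ (_ : (UOp A).Monoidal) (a : U A ⋙ U A ≅ 𝟭 (ZCenter A)),
        (∀ X Y : ZCenter A,
          (F A).map (μ (UOp A) X Y).unmop ≫ R.incl X Y =
            R.incl ((U A).obj Y) ((U A).obj X) ≫ (β_ ((F A).obj Y) ((F A).obj X)).hom) ∧
        (∀ X : ZCenter A,
          (F A).map (a.hom.app X) = (RibbonCategory.twist ((F A).obj X)).inv) ∧
        Nonempty (ZMod2Action (U A) a) := by
  refine ⟨?_, fun R => ⟨inferInstance, R.multiplicativeFunctor.monoidal, doubleUIso A,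
    fun X Y => R.images.tensU_inclU X Y, F_map_doubleUIso,
    ⟨zmod2Action (doubleUIso A) U_map_doubleUIso⟩⟩⟩
  obtain ⟨T⟩ := nonempty_reducedImages (k := k) (A := A)
  exact ⟨T.monoidalCategory, ⟨T.reducedTensorProduct⟩⟩
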